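/- **Model.** Let $n\ge 3$, let $V$ be a set of $n$ nodes, let $\lambda>0$ and let $d$ be a positive integer. For each pair $\{u,v\}$ of distinct nodes there are two links, $uv$ and $vu$, each of capacity $D=D(n)\in\{0,1,2,\dots\}$. Calls arrive in a Poisson process of rate $\lambda\binom n2$. Each call is for a uniformly random pair $e=\{u,v\}$, and $d$ candidate intermediate nodes are picked for it uniformly at random with replacement from $V\setminus\{u,v\}$. A call for $\{u,v\}$ that is routed via $w$ occupies one unit of each of the links $uw$ and $vw$ until it ends; durations are exponential with mean $1$, and pairs, candidates, durations and arrivals are all independent. A route is available if both of its links have load less than $D$ just before the call arrives. In a *general dynamic alternative routing algorithm* (GDAR) each call is routed, without knowledge of the future, via one of its candidates whose route is available; if there is none, the call fails (is lost). In the *balanced* algorithm (BDAR) the call is routed via an available candidate that minimises the larger of the current loads of the two links of its route (with any tie-breaking). Let $\|X_0\|$ be the number of calls in progress at time $0$. The initial state $X_0$ is arbitrary, possibly random, with $\mathbf E\|X_0\|<\infty$, and the initial calls have independent residual durations, exponential with mean $1$. **Theorem.** Let $\lambda>0$ be fixed and let $d\ge 2$ be a fixed integer. There is a constant $\kappa=\kappa(\lambda,d)$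 such that for every constant $K>0$ there is a constant $c=c(\lambda,d,K)>0$ for which the following holds. Let $t_1=t_1(n)\ge \ln(\mathbf E\|X_0\|+1)+\kappa\ln n$, and consider the interval $[t_1,t_1+n^K]$. (a) If $D(n)\ge \ln\ln n/\ln d+c$ and the BDAR algorithm is used, then the expected number of calls lost during the interval is $o(1)$ as $n\to\infty$. (b) If $D(n)\le \ln\ln n/\ln d-c$ and any GDAR algorithm is used, then with probability tending to $1$ as $n\to\infty$ at least $n^{K+2-d-o(1)}$ calls are lost during the interval. -/

import Mathlib

open MeasureTheory ProbabilityTheory Filter Topology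
open scoped ENNReal

namespace AltRouting

universe u

/-- The node set is `Fin n`, an edge is a non-diagonal unordered pair of nodes.  A two-link path
`(e, w)` consists of an edge `e = {u, v}` and a node `w ∉ e`: it uses the links `uw` and `vw`. -/
abbrev TwoPath (n : ℕ) : Type :=
  {p : Sym2 (Fin n) × Fin n // ¬ p.1.IsDiag ∧ p.2 ∉ p.1}

/-- A load vector: the number of calls in progress on each two-link path. -/
abbrev LoadVector (n : ℕ) : Type := TwoPath n → ℕ

/-- The load of the link `vu` (ordered: calls with end `v` that are routed via `u`). -/
def linkLoad {n : ℕ} (x : LoadVector n) (v u : Fin n) : ℕ :=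
  ∑ p : TwoPath n, if v ∈ p.1.1 ∧ p.1.2 = u then x p else 0

/-- An arriving call: its edge `ends`, and the `d` candidate intermediate nodes picked for it. -/
@[ext] structure Call (n d : ℕ) where
  ends : Sym2 (Fin n)
  cand : Fin d → Fin n
  not_isDiag : ¬ ends.IsDiag
  cand_notMem : ∀ i, cand i ∉ ends

instance (n d : ℕ) : MeasurableSpace (Call n d) := ⊤

/-- The random variables describing the evolution of the network on a sample space `Ω`.
Arriving calls are numbered `0, 1, 2, …`. -/
structure Evolution (n d : ℕ) (Ω : Type u) where
  /-- the load vector at time `0` -/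
  init : Ω → LoadVector n
  /-- private randomness that the routing algorithm may use -/
  aux : Ω → ℝ
  /-- `gap j`: time between the arrivals of calls `j - 1` and `j` (from time `0` if `j = 0`) -/
  gap : ℕ → Ω → ℝ
  /-- the arriving calls with their candidate nodes -/
  call : ℕ → Ω → Call n d
  /-- the durations of the arriving calls -/
  dur : ℕ → Ω → ℝ
  /-- `res p k`: residual duration at time `0` of the `k`-th initial call on the path `p`
  (relevant only for `k < init p`) -/
  res : TwoPath n → ℕ → Ω → ℝ
  /-- the intermediate node via which call `j` is routed, `none` if call `j` is lost -/
  via : ℕ → Ω → Option (Fin n)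

/-- Labels of the independent sources of randomness. -/
inductive Source (n : ℕ) where
  | start : Source n
  | gap : ℕ → Source n
  | call : ℕ → Source n
  | dur : ℕ → Source n
  | res : TwoPath n → ℕ → Source n

namespace Evolution

variable {n d : ℕ} {Ω : Type u}

/-- The arrival time of call `j`. -/
def arrival (S : Evolution n d Ω) (j : ℕ) (ω : Ω) : ℝ :=
  ∑ i ∈ Finset.range (j + 1), S.gap i ω

open Classical in
/-- The load vector just before the arrival of call `j`, that is, the left limit of the
load process at that time: for each path, the initial calls and the earlier calls routed along it
which have not yet ended. -/
noncomputable def loadBefore (S : Evolution n d Ω) (j : ℕ) (ω : Ω) : LoadVector n := fun p =>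
  ((Finset.range (S.init ω p)).filter (fun k => S.arrival j ω ≤ S.res p k ω)).card +
  ((Finset.range j).filter (fun i => (S.call i ω).ends = p.1.1 ∧ S.via i ω = some p.1.2 ∧
      S.arrival j ω ≤ S.arrival i ω + S.dur i ω)).card

/-- The larger of the loads, just before the arrival of call `j`, of the two links of the route
through its `i`-th candidate node. -/
noncomputable def maxLoad (S : Evolution n d Ω) (j : ℕ) (ω : Ω) (i : Fin d) : ℕ :=
  (Finset.univ.filter (fun v => v ∈ (S.call j ω).ends)).sup
    (fun v => linkLoad (S.loadBefore j ω) v ((S.call j ω).cand i))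

/-- With link capacity `D`, the route of call `j` through its `i`-th candidate node is available:
both of its links have spare capacity. -/
def Available (S : Evolution n d Ω) (D j : ℕ) (ω : Ω) (i : Fin d) : Prop :=
  ∀ v ∈ (S.call j ω).ends, linkLoad (S.loadBefore j ω) v ((S.call j ω).cand i) < D

/-- What has been observed up to and including the arrival of call `j`: the initial state and the
private randomness, the arrival times, edges and candidates of the calls `0, …, j`, and, for the
earlier calls and the initial calls, the durations as far as they have elapsed. -/
@[reducible] def info (S : Evolution n d Ω) (j : ℕ) : MeasurableSpace Ω :=
  MeasurableSpace.comap (fun ω => (S.init ω, S.aux ω)) inferInstance ⊔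
  (⨆ i ∈ Finset.range (j + 1), MeasurableSpace.comap (S.gap i) inferInstance) ⊔
  (⨆ i ∈ Finset.range (j + 1), MeasurableSpace.comap (S.call i) inferInstance) ⊔
  (⨆ i ∈ Finset.range j, MeasurableSpace.comap
    (fun ω => min (S.dur i ω) (S.arrival j ω - S.arrival i ω)) inferInstance) ⊔
  (⨆ (p : TwoPath n) (k : ℕ), MeasurableSpace.comap
    (fun ω => min (S.res p k ω) (S.arrival j ω)) inferInstance)

/-- The σ-algebra generated by a source of randomness.  The initial state and the private
randomness form one source, so they may depend on each other. -/
@[reducible] def sourceAlgebra (S : Evolution n d Ω) : Source n → MeasurableSpace Ω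
  | .start => MeasurableSpace.comap (fun ω => (S.init ω, S.aux ω)) inferInstance
  | .gap j => MeasurableSpace.comap (S.gap j) inferInstance
  | .call j => MeasurableSpace.comap (S.call j) inferInstance
  | .dur j => MeasurableSpace.comap (S.dur j) inferInstance
  | .res p k => MeasurableSpace.comap (S.res p k) inferInstance

/-- The probabilistic assumptions: calls arrive in a Poisson process of rate `lam * (n choose 2)`,
edges are uniform, the `d` candidates are uniform with replacement among the nodes off the edge,
durations (and the residual durations of the initial calls) are exponential with mean `1`,
everything is independent, and routing decisions do not anticipate the future. -/
structure IsModel [MeasurableSpace Ω] (S : Evolution n d Ω) (lam : ℝ) (P : Measure Ω) :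
    Prop where
  measurable_init : Measurable S.init
  measurable_aux : Measurable S.aux
  measurable_gap : ∀ j, Measurable (S.gap j)
  measurable_call : ∀ j, Measurable (S.call j)
  measurable_dur : ∀ j, Measurable (S.dur j)
  measurable_res : ∀ p k, Measurable (S.res p k)
  law_gap : ∀ j, P.map (S.gap j) = expMeasure (lam * (n.choose 2 : ℝ))
  law_call : ∀ j (q : Call n d), P {ω | S.call j ω = q} =
    ENNReal.ofReal (1 / (n.choose 2 : ℝ) * (1 / ((n : ℝ) - 2)) ^ d)
  law_dur : ∀ j, P.map (S.dur j) = expMeasure 1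
  law_res : ∀ p k, P.map (S.res p k) = expMeasure 1
  indep : iIndep S.sourceAlgebra P
  nonanticipating : ∀ j, @Measurable Ω (Option (Fin n)) (S.info j) ⊤ (S.via j)

/-- A general dynamic alternative routing algorithm with link capacity `D`: each call is routed
via one of its candidates whose route is available; it is lost only if there is none. -/
def IsGDAR [MeasurableSpace Ω] (S : Evolution n d Ω) (D : ℕ) (P : Measure Ω) : Prop :=
  ∀ᵐ ω ∂P, ∀ j,
    (∃ i, S.Available D j ω i ∧ S.via j ω = some ((S.call j ω).cand i)) ∨
    ((∀ i, ¬ S.Available D j ω i) ∧ S.via j ω = none)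

/-- The balanced algorithm: each call is routed via a candidate whose route is available and
minimises the larger of the loads of its two links (ties are broken in any way). -/
def IsBDAR [MeasurableSpace Ω] (S : Evolution n d Ω) (D : ℕ) (P : Measure Ω) : Prop :=
  ∀ᵐ ω ∂P, ∀ j,
    (∃ i, S.Available D j ω i ∧ (∀ i', S.Available D j ω i' → S.maxLoad j ω i ≤ S.maxLoad j ω i') ∧
      S.via j ω = some ((S.call j ω).cand i)) ∨
    ((∀ i, ¬ S.Available D j ω i) ∧ S.via j ω = none)

/-- The total number of calls in progress at time `0`. -/
def initTotal (S : Evolution n d Ω) (ω : Ω) : ℝ := ∑ p : TwoPath n, (S.init ω p : ℝ)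

/-- The number of calls that arrive during `[a, b]` and are lost. -/
noncomputable def lost (S : Evolution n d Ω) (a b : ℝ) (ω : Ω) : ℝ≥0∞ :=
  ({j : ℕ | S.arrival j ω ∈ Set.Icc a b ∧ S.via j ω = none}.encard : ℝ≥0∞)

end Evolution

end AltRouting

/-!
The argument rests on one filtration. Before call `l` is considered, `Evolution.past` reveals the
initial state, all arrival times (also the future ones), all residual durations, and the earlier
calls with their complete durations. Routing decisions are adapted to it, while call `l` and its
duration are independent of it. With the arrival times known in advance, "call `l` is of a given
kind and still in progress when call `i` arrives" is an event with an explicit conditional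
probability (`IsModel.lintegral_call_dur`), and the number of `l` for which it occurs satisfies the
Chernoff bounds of independent events (`chernoff_upper`, `chernoff_lower`). No stationary
distribution is needed.

*The balanced algorithm loses few calls.* This is the layered induction for `d`-choice allocation.
A call that is placed on a link of load at least `k` has only candidates that lead, from one of its
two ends, to load at least `k` (`mem_highCalls_of_balanced`). If every node has at most `x` links of
load at least `k`, then a proportion of at most `(2 / n) (6 x / n) ^ d` of all calls has this
property at a given node, so the number of such calls in progress there, and with it the number of
links of load at least `k + 1`, is at most of order `n (x / n) ^ d`
(`via_ne_none_of_occurrences_lt`, `sum_profile_le`, `IsModel.prob_lost_inter_le`). Once a constant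
level is passed, the proportion `x / n` is raised to the power `d` at each level, up to constants,
and drops to `n ^ (-3 / 4)` within `log log n / log d + O(1)` levels (`exists_profile_eq`). From
there a bounded number of further levels makes the failure probability an arbitrarily small power
of `n`. All this takes place in a window of `O(μ log n)` arrivals before the call considered, where
`μ` is the arrival rate. The window is exceptional if its arrivals are too dense, or if initial
calls or calls from before the window survive into its second part. The exceptional events are
summed over all calls that arrive in the given interval of time; the index of an arrival at a given
time is random, so these sums are handled by a renewal estimate, in which the weight of the last few
gaps factorizes from the expected number of arrivals in the interval
(`IsModel.tsum_lintegral_window_le`). The result is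
`IsModel.exists_lintegral_lost_le_of_isBDAR`. The waiting time it needs depends on the length of the
interval, whereas `κ` must not depend on `K`; this is repaired by applying it on `[t, t + n]` and
then on `[t + n, t + n + n ^ K]`, as `n` eventually exceeds any multiple of `log n`.

*Every algorithm loses many calls.* Fix one node `v` and a window of at most `μ` arrivals. It lasts
at most time `3` except with exponentially small probability, so calls of duration at least `3` stay
throughout. Divide the window into slots of geometrically decreasing lengths, one for each level
`k ≤ D`. If many nodes `w` have exactly `k` long calls on the link `vw`, then a call at `v` may have
all its candidates among them, and then every algorithm must either lose it or raise one of these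
nodes to level `k + 1` (`occurrences_riseEvent_le`). The proportion of nodes at level `k` is again
raised to the power `d` at each step, up to factors geometric in `k`, and for
`D ≤ log log n / log d - c` there would still be at least `√n` nodes at level `D + 1`. No link can
carry that many calls, so at least `√n` calls are lost in the window (`le_occurrences_lostEvent`,
`IsModel.prob_lost_window_lt`). An interval of length `n ^ K` contains about `n ^ K / 4` such
windows, counted from its first arrival (`IsModel.prob_lost_lt_le`). This gives at least `n ^ K`
lost calls, and `K + 2 - d ≤ K`, so the error term in the exponent can be taken to be zero.
-/

namespace AltRouting

universe u

/-! ### Exponential variables and independence -/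

theorem expMeasure_ae_nonneg (r : ℝ) : ∀ᵐ x ∂expMeasure r, 0 ≤ x := by
  have h : expMeasure r (Set.Iio 0) = 0 := by
    rw [expMeasure, gammaMeasure, withDensity_apply _ measurableSet_Iio]
    exact lintegral_gammaPDF_of_nonpos le_rfl
  rw [ae_iff]
  convert h using 2
  ext x
  simp

/-- Laplace transform of the exponential law, also at negative arguments `-θ < r`. -/
theorem lintegral_exp_expMeasure {r θ : ℝ} (hr : 0 < r) (hθ : 0 < r + θ) :
    ∫⁻ x, ENNReal.ofReal (Real.exp (-(θ * x))) ∂expMeasure r = ENNReal.ofReal (r / (r + θ)) := by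
  have h1 : expMeasure r = volume.withDensity (exponentialPDF r) := rfl
  have hm : ∀ s, Measurable (exponentialPDF s) := fun s =>
    (measurable_exponentialPDFReal s).ennreal_ofReal
  rw [h1, lintegral_withDensity_eq_lintegral_mul _ (hm r) (by fun_prop)]
  have h2 : ∀ x, (exponentialPDF r * fun x => ENNReal.ofReal (Real.exp (-(θ * x)))) x
      = ENNReal.ofReal (r / (r + θ)) * exponentialPDF (r + θ) x := by
    intro x
    simp only [Pi.mul_apply]
    rcases lt_or_ge x 0 with hx | hx
    · simp [exponentialPDF_of_neg hx]
    · rw [exponentialPDF_of_nonneg hx, exponentialPDF_of_nonneg hx,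
        ← ENNReal.ofReal_mul (by positivity), ← ENNReal.ofReal_mul (by positivity)]
      congr 1
      have : Real.exp (-((r + θ) * x)) = Real.exp (-(r * x)) * Real.exp (-(θ * x)) := by
        rw [← Real.exp_add]; congr 1; ring
      rw [this]
      field_simp
  simp_rw [h2]
  rw [lintegral_const_mul _ (hm _), lintegral_exponentialPDF_eq_one hθ, mul_one]

theorem expMeasure_Ici {r : ℝ} (hr : 0 < r) (a : ℝ) :
    expMeasure r (Set.Ici a) = ENNReal.ofReal (Real.exp (-(r * max a 0))) := by
  have := isProbabilityMeasure_expMeasure hr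
  have h0 : expMeasure r {a} = 0 :=
    withDensity_absolutelyContinuous volume (exponentialPDF r) (by simp)
  have h1 : expMeasure r (Set.Ici a) = expMeasure r (Set.Ioi a) :=
    measure_congr (Ioi_ae_eq_Ici' h0).symm
  have h2 := cdf_expMeasure_eq hr a
  rw [cdf_eq_real] at h2
  have h3 : (expMeasure r).real (Set.Ioi a) = 1 - (expMeasure r).real (Set.Iic a) := by
    rw [← Set.compl_Iic, measureReal_compl measurableSet_Iic]; simp
  rw [h1, ← ofReal_measureReal, h3, h2]
  split_ifs with h
  · rw [max_eq_left h]; congr 1; ring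
  · rw [max_eq_right (le_of_not_ge h)]; simp

section Indep

/-- Integrating out a real random variable that is independent of a `σ`-algebra. -/
theorem lintegral_of_indep {Ω β : Type*} [MeasurableSpace β] {m mΩ : MeasurableSpace Ω}
    {P : Measure Ω} [IsProbabilityMeasure P] (hm : m ≤ mΩ)
    {X : Ω → ℝ} (hX : Measurable X) (hind : Indep m (MeasurableSpace.comap X inferInstance) P)
    {Y : Ω → β} (hY : Measurable[m] Y) {φ : β × ℝ → ℝ≥0∞} (hφ : Measurable φ) :
    ∫⁻ ω, φ (Y ω, X ω) ∂P = ∫⁻ ω, ∫⁻ x, φ (Y ω, x) ∂(P.map X) ∂P := by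
  have hY' : Measurable Y := hY.mono hm le_rfl
  have h1 : IndepFun Y X P := by
    rw [IndepFun_iff_Indep]
    exact indep_of_indep_of_le_left hind hY.comap_le
  have h2 := (indepFun_iff_map_prod_eq_prod_map_map hY'.aemeasurable hX.aemeasurable).1 h1
  have : IsProbabilityMeasure (P.map X) := Measure.isProbabilityMeasure_map hX.aemeasurable
  have : IsProbabilityMeasure (P.map Y) := Measure.isProbabilityMeasure_map hY'.aemeasurable
  rw [← lintegral_map (f := φ) hφ (hY'.prodMk hX), h2, lintegral_prod _ hφ.aemeasurable,
    lintegral_map _ hY']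
  exact hφ.lintegral_prod_right'

/-- An independent exponential variable exceeds a threshold `a ω` with conditional probability
`exp (-r a⁺)`. -/
theorem lintegral_mul_indicator_exp {Ω : Type*} {m mΩ : MeasurableSpace Ω}
    {P : Measure Ω} [IsProbabilityMeasure P] (hm : m ≤ mΩ)
    {X : Ω → ℝ} (hX : Measurable X) (hind : Indep m (MeasurableSpace.comap X inferInstance) P)
    {r : ℝ} (hr : 0 < r) (hlaw : P.map X = expMeasure r)
    {f : Ω → ℝ≥0∞} (hf : Measurable[m] f) {a : Ω → ℝ} (ha : Measurable[m] a) :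
    ∫⁻ ω, f ω * {ω | a ω ≤ X ω}.indicator 1 ω ∂P
      = ∫⁻ ω, f ω * ENNReal.ofReal (Real.exp (-(r * max (a ω) 0))) ∂P := by
  have hS : MeasurableSet {q : (ℝ≥0∞ × ℝ) × ℝ | q.1.2 ≤ q.2} :=
    measurableSet_le (by fun_prop) (by fun_prop)
  have key := lintegral_of_indep (P := P) hm hX hind (hf.prodMk ha)
    (φ := fun q => q.1.1 * {q : (ℝ≥0∞ × ℝ) × ℝ | q.1.2 ≤ q.2}.indicator 1 q)
    ((by fun_prop : Measurable fun q : (ℝ≥0∞ × ℝ) × ℝ => q.1.1).mul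
      (measurable_one.indicator hS))
  have e1 : ∀ ω, {ω | a ω ≤ X ω}.indicator (1 : Ω → ℝ≥0∞) ω
      = {q : (ℝ≥0∞ × ℝ) × ℝ | q.1.2 ≤ q.2}.indicator 1 ((f ω, a ω), X ω) := by
    intro ω; simp [Set.indicator]
  simp_rw [e1]
  rw [key]
  refine lintegral_congr fun ω => ?_
  have e2 : ∀ x, {q : (ℝ≥0∞ × ℝ) × ℝ | q.1.2 ≤ q.2}.indicator (1 : (ℝ≥0∞ × ℝ) × ℝ → ℝ≥0∞)
        ((f ω, a ω), x)
      = (Set.Ici (a ω)).indicator 1 x := by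
    intro x; simp [Set.indicator]
  simp_rw [e2]
  rw [lintegral_const_mul _ (measurable_one.indicator measurableSet_Ici),
    lintegral_indicator_one measurableSet_Ici, hlaw, expMeasure_Ici hr]

end Indep

/-! ### Exponential moments of sums of indicators along a filtration -/

section Chernoff

variable {Ω : Type*} {mΩ : MeasurableSpace Ω} {P : Measure Ω}

open Classical in
/-- The number of indices `l` with `b ≤ l < e` whose event `E l` occurs. -/
noncomputable def occurrences (E : ℕ → Set Ω) (b e : ℕ) (ω : Ω) : ℕ :=
  ((Finset.Ico b e).filter (fun l => ω ∈ E l)).card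

theorem occurrences_self (E : ℕ → Set Ω) (b : ℕ) (ω : Ω) : occurrences E b b ω = 0 := by
  simp [occurrences]

open Classical in
theorem occurrences_succ (E : ℕ → Set Ω) {b e : ℕ} (hbe : b ≤ e) (ω : Ω) :
    occurrences E b (e + 1) ω = occurrences E b e ω + if ω ∈ E e then 1 else 0 := by
  unfold occurrences
  rw [← Finset.insert_Ico_right_eq_Ico_add_one hbe, Finset.filter_insert]
  split_ifs with h
  · rw [Finset.card_insert_of_notMem (by simp)]
  · simp

theorem measurable_occurrences {G : ℕ → MeasurableSpace Ω} (hG : Monotone G) {E : ℕ → Set Ω}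
    (hE : ∀ l, MeasurableSet[G (l + 1)] (E l)) {b e : ℕ} (hbe : b ≤ e) :
    Measurable[G e] (occurrences E b e) := by
  induction e, hbe using Nat.le_induction with
  | base =>
    have : occurrences E b b = fun _ => 0 := by ext ω; exact occurrences_self E b ω
    rw [this]; exact measurable_const
  | succ e hbe ih =>
    have : occurrences E b (e + 1) = fun ω => occurrences E b e ω + (E e).indicator 1 ω := by
      ext ω; rw [occurrences_succ E hbe]; simp [Set.indicator]
    rw [this]
    let _ := G (e + 1)
    exact (ih.mono (hG (Nat.le_succ e)) le_rfl).add (measurable_one.indicator (hE e))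

/-- Both Chernoff bounds below rest on the recursion for `∫ 1_A u ^ #{l : E l}`. -/
theorem lintegral_pow_occurrences_succ {G : ℕ → MeasurableSpace Ω} (hle : ∀ l, G l ≤ mΩ)
    {E : ℕ → Set Ω} (hE : ∀ l, MeasurableSet[G (l + 1)] (E l)) {b e : ℕ} (hbe : b ≤ e)
    (u : ℝ≥0∞) (Z : Ω → ℝ≥0∞) :
    ∫⁻ ω, Z ω * u ^ occurrences E b (e + 1) ω ∂P
      = ∫⁻ ω in E e, (Z ω * u ^ occurrences E b e ω) * u ∂P
        + ∫⁻ ω in (E e)ᶜ, Z ω * u ^ occurrences E b e ω ∂P := by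
  have hm : MeasurableSet (E e) := hle _ _ (hE e)
  rw [← lintegral_add_compl _ hm]
  congr 1
  · refine setLIntegral_congr_fun hm fun ω hω => ?_
    simp only [occurrences_succ E hbe, if_pos hω, pow_succ, mul_assoc]
  · refine setLIntegral_congr_fun hm.compl fun ω hω => ?_
    simp only [occurrences_succ E hbe, if_neg (by exact hω : ω ∉ E e), add_zero]

/-- The step of the lower Chernoff bound: halving a part `J` of proportion at least `q` of an
integral `I` reduces `I` by the factor `1 - q / 2`. -/
theorem half_mul_add_le {I J J' : ℝ≥0∞} (hfin : I ≠ ∞) (hIJ : J + J' = I) {q : ℝ} (hq0 : 0 ≤ q)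
    (h2 : ENNReal.ofReal q * I ≤ J) :
    J * ENNReal.ofReal (1 / 2) + J' ≤ ENNReal.ofReal (1 - q / 2) * I := by
  have hJ : J ≠ ∞ := ne_top_of_le_ne_top hfin (by rw [← hIJ]; exact le_self_add)
  have hJ' : J' ≠ ∞ := ne_top_of_le_ne_top hfin (by rw [← hIJ]; exact le_add_self)
  lift I to NNReal using hfin
  lift J to NNReal using hJ
  lift J' to NNReal using hJ'
  rw [← ENNReal.ofReal_coe_nnreal, ← ENNReal.ofReal_coe_nnreal (p := J'),
    ← ENNReal.ofReal_coe_nnreal (p := I), ← ENNReal.ofReal_mul (by positivity),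
    ← ENNReal.ofReal_add (by positivity) (by positivity),
    ← ENNReal.ofReal_mul' (by positivity)]
  rw [← ENNReal.ofReal_coe_nnreal, ← ENNReal.ofReal_coe_nnreal (p := J),
    ← ENNReal.ofReal_mul (by positivity),
    ENNReal.ofReal_le_ofReal_iff (by positivity)] at h2
  have h4 : (J : ℝ) + J' = I := by exact_mod_cast hIJ
  apply ENNReal.ofReal_le_ofReal
  linarith

/-- Upper Chernoff bound: if, given the past and on `A`, the event `E l` has conditional
probability at most `q l`, then the number of the events that occur has exponential moments no
larger than those of independent events. -/
theorem chernoff_upper {G : ℕ → MeasurableSpace Ω} (hG : Monotone G) (hle : ∀ l, G l ≤ mΩ)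
    {E : ℕ → Set Ω} (hE : ∀ l, MeasurableSet[G (l + 1)] (E l)) {b e : ℕ} (hbe : b ≤ e)
    {A : Set Ω} (hA : MeasurableSet[G b] A) {q : ℕ → ℝ} (hq0 : ∀ l, 0 ≤ q l)
    (hq : ∀ l, b ≤ l → l < e → ∀ Z : Ω → ℝ≥0∞, Measurable[G l] Z →
      ∫⁻ ω in E l, A.indicator Z ω ∂P ≤ ENNReal.ofReal (q l) * ∫⁻ ω, A.indicator Z ω ∂P)
    {u : ℝ} (hu : 1 ≤ u) (h : ℕ) :
    P (A ∩ {ω | h ≤ occurrences E b e ω}) ≤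
      ENNReal.ofReal (u⁻¹ ^ h * Real.exp ((u - 1) * ∑ l ∈ Finset.Ico b e, q l)) * P A := by
  have hu0 : 0 < u := by linarith
  have hAm : MeasurableSet A := hle _ _ hA
  have key : ∀ e', b ≤ e' → e' ≤ e →
      ∫⁻ ω, A.indicator 1 ω * ENNReal.ofReal u ^ occurrences E b e' ω ∂P ≤
      ENNReal.ofReal (Real.exp ((u - 1) * ∑ l ∈ Finset.Ico b e', q l)) * P A := by
    intro e' hbe'
    induction e', hbe' using Nat.le_induction with
    | base =>
      intro _
      simp [occurrences_self, lintegral_indicator_one hAm]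
    | succ e' hbe' ih =>
      intro he'
      rw [lintegral_pow_occurrences_succ hle hE hbe']
      set Z : Ω → ℝ≥0∞ := fun ω => ENNReal.ofReal u ^ occurrences E b e' ω with hZ
      have hZm : Measurable[G e'] Z := by
        have h1 := measurable_occurrences hG hE hbe'
        exact (measurable_from_nat (f := fun k => ENNReal.ofReal u ^ k)).comp h1
      have e1 : ∀ ω, A.indicator 1 ω * Z ω = A.indicator Z ω := by
        intro ω; by_cases hω : ω ∈ A <;> simp [hω]
      have hm : Measurable fun ω => A.indicator Z ω := (hZm.mono (hle _) le_rfl).indicator hAm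
      have h2 := hq e' hbe' (by omega) Z hZm
      have h3 := (lintegral_congr e1).symm.le.trans (ih (by omega))
      change ∫⁻ ω in E e', (A.indicator 1 ω * Z ω) * ENNReal.ofReal u ∂P
        + ∫⁻ ω in (E e')ᶜ, A.indicator 1 ω * Z ω ∂P ≤ _
      simp only [e1]
      rw [lintegral_mul_const _ hm]
      have hu' : ENNReal.ofReal u = 1 + ENNReal.ofReal (u - 1) := by
        rw [← ENNReal.ofReal_one, ← ENNReal.ofReal_add zero_le_one (by linarith)]
        congr 1; ring
      calc (∫⁻ ω in E e', A.indicator Z ω ∂P) * ENNReal.ofReal u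
            + ∫⁻ ω in (E e')ᶜ, A.indicator Z ω ∂P
          = (∫⁻ ω in E e', A.indicator Z ω ∂P + ∫⁻ ω in (E e')ᶜ, A.indicator Z ω ∂P)
            + ENNReal.ofReal (u - 1) * ∫⁻ ω in E e', A.indicator Z ω ∂P := by
            rw [hu']; ring
        _ ≤ ∫⁻ ω, A.indicator Z ω ∂P + ENNReal.ofReal (u - 1) *
            (ENNReal.ofReal (q e') * ∫⁻ ω, A.indicator Z ω ∂P) := by
            rw [lintegral_add_compl _ (hle _ _ (hE e'))]
            gcongr
        _ = ENNReal.ofReal (1 + (u - 1) * q e') * ∫⁻ ω, A.indicator Z ω ∂P := by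
            rw [ENNReal.ofReal_add zero_le_one (mul_nonneg (by linarith) (hq0 _)),
              ENNReal.ofReal_mul (by linarith)]
            simp; ring
        _ ≤ ENNReal.ofReal (Real.exp ((u - 1) * q e')) *
            (ENNReal.ofReal (Real.exp ((u - 1) * ∑ l ∈ Finset.Ico b e', q l)) * P A) := by
            gcongr
            rw [add_comm]; exact Real.add_one_le_exp _
        _ = _ := by
            rw [← mul_assoc, ← ENNReal.ofReal_mul (Real.exp_pos _).le, ← Real.exp_add,
              Finset.sum_Ico_succ_top hbe']
            congr 3; ring
  have h1 := key e hbe le_rfl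
  have hocc : Measurable (occurrences E b e) :=
    (measurable_occurrences hG hE hbe).mono (hle _) le_rfl
  have hset : MeasurableSet (A ∩ {ω | h ≤ occurrences E b e ω}) :=
    hAm.inter (measurableSet_le measurable_const hocc)
  have h2 : ENNReal.ofReal u ^ h * P (A ∩ {ω | h ≤ occurrences E b e ω}) ≤
      ∫⁻ ω, A.indicator 1 ω * ENNReal.ofReal u ^ occurrences E b e ω ∂P := by
    rw [← lintegral_indicator_one hset,
      ← lintegral_const_mul _ (measurable_one.indicator hset)]
    refine lintegral_mono fun ω => ?_
    by_cases hω : ω ∈ A ∩ {ω | h ≤ occurrences E b e ω}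
    · simp only [Set.indicator_of_mem hω, Set.indicator_of_mem hω.1, Pi.one_apply, one_mul, mul_one]
      exact pow_le_pow_right₀ (by simpa using ENNReal.ofReal_le_ofReal hu) hω.2
    · simp [Set.indicator_of_notMem hω]
  have h3 : P (A ∩ {ω | h ≤ occurrences E b e ω}) =
      ENNReal.ofReal (u⁻¹ ^ h) * (ENNReal.ofReal u ^ h *
        P (A ∩ {ω | h ≤ occurrences E b e ω})) := by
    rw [← mul_assoc, ← ENNReal.ofReal_pow hu0.le, ← ENNReal.ofReal_mul (by positivity),
      ← mul_pow, inv_mul_cancel₀ hu0.ne']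
    simp
  rw [h3, ENNReal.ofReal_mul (by positivity), mul_assoc]
  exact mul_le_mul_right (h2.trans h1) _

/-- Lower Chernoff bound: if, given the past and on `A`, the event `E l` has conditional
probability at least `q`, then fewer than a quarter of `(e - b) * q` events is unlikely. -/
theorem chernoff_lower [IsFiniteMeasure P] {G : ℕ → MeasurableSpace Ω} (hG : Monotone G)
    (hle : ∀ l, G l ≤ mΩ)
    {E : ℕ → Set Ω} (hE : ∀ l, MeasurableSet[G (l + 1)] (E l)) {b e : ℕ} (hbe : b ≤ e)
    {A : Set Ω} (hA : MeasurableSet[G b] A) {q : ℝ} (hq0 : 0 ≤ q)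
    (hq : ∀ l, b ≤ l → l < e → ∀ Z : Ω → ℝ≥0∞, Measurable[G l] Z →
      ENNReal.ofReal q * ∫⁻ ω, A.indicator Z ω ∂P ≤ ∫⁻ ω in E l, A.indicator Z ω ∂P)
    {x : ℝ} (hx : 4 * x ≤ (e - b : ℕ) * q) :
    P (A ∩ {ω | (occurrences E b e ω : ℝ) < x}) ≤
      ENNReal.ofReal (Real.exp (- x)) * P A := by
  have hAm : MeasurableSet A := hle _ _ hA
  have half : ENNReal.ofReal (1 / 2) + ENNReal.ofReal (1 / 2) = 1 := by
    rw [← ENNReal.ofReal_add (by norm_num) (by norm_num)]; norm_num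
  have key : ∀ e', b ≤ e' → e' ≤ e →
      ∫⁻ ω, A.indicator 1 ω * ENNReal.ofReal (1 / 2) ^ occurrences E b e' ω ∂P ≤
      ENNReal.ofReal (Real.exp (-((e' - b : ℕ) * q / 2))) * P A := by
    intro e' hbe'
    induction e', hbe' using Nat.le_induction with
    | base =>
      intro _
      simp [occurrences_self, lintegral_indicator_one hAm]
    | succ e' hbe' ih =>
      intro he'
      rw [lintegral_pow_occurrences_succ hle hE hbe']
      set Z : Ω → ℝ≥0∞ := fun ω => ENNReal.ofReal (1 / 2) ^ occurrences E b e' ω with hZ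
      have hZ1 : ∀ ω, Z ω ≤ 1 := fun ω => pow_le_one₀ zero_le
        (by simp)
      have hZm : Measurable[G e'] Z := by
        have h1 := measurable_occurrences hG hE hbe'
        exact (measurable_from_nat (f := fun k => ENNReal.ofReal (1 / 2) ^ k)).comp h1
      have e1 : ∀ ω, A.indicator 1 ω * Z ω = A.indicator Z ω := by
        intro ω; by_cases hω : ω ∈ A <;> simp [hω]
      have hm : Measurable fun ω => A.indicator Z ω := (hZm.mono (hle _) le_rfl).indicator hAm
      have h2 := hq e' hbe' (by omega) Z hZm
      have h3 := (lintegral_congr e1).symm.le.trans (ih (by omega))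
      have hfin : ∫⁻ ω, A.indicator Z ω ∂P ≠ ∞ := by
        refine ne_top_of_le_ne_top (measure_ne_top P Set.univ) ?_
        calc ∫⁻ ω, A.indicator Z ω ∂P ≤ ∫⁻ ω, 1 ∂P := lintegral_mono fun ω => by
              by_cases hω : ω ∈ A <;> simp [hω, hZ1 ω]
          _ = P Set.univ := by simp
      change ∫⁻ ω in E e', (A.indicator 1 ω * Z ω) * ENNReal.ofReal (1 / 2) ∂P
        + ∫⁻ ω in (E e')ᶜ, A.indicator 1 ω * Z ω ∂P ≤ _
      simp only [e1]
      rw [lintegral_mul_const _ hm]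
      set I := ∫⁻ ω, A.indicator Z ω ∂P
      set J := ∫⁻ ω in E e', A.indicator Z ω ∂P
      set J' := ∫⁻ ω in (E e')ᶜ, A.indicator Z ω ∂P
      have hIJ : J + J' = I := lintegral_add_compl _ (hle _ _ (hE e'))
      calc J * ENNReal.ofReal (1 / 2) + J'
          ≤ ENNReal.ofReal (1 - q / 2) * I := by
            exact half_mul_add_le hfin hIJ hq0 h2
        _ ≤ ENNReal.ofReal (Real.exp (-(q / 2))) *
            (ENNReal.ofReal (Real.exp (-((e' - b : ℕ) * q / 2))) * P A) := by
            gcongr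
            have := Real.add_one_le_exp (-(q / 2)); linarith
        _ = _ := by
            rw [← mul_assoc, ← ENNReal.ofReal_mul (Real.exp_pos _).le, ← Real.exp_add,
              Nat.succ_sub hbe']
            push_cast
            congr 3; ring
  have h1 := key e hbe le_rfl
  have hocc : Measurable (occurrences E b e) :=
    (measurable_occurrences hG hE hbe).mono (hle _) le_rfl
  have hset : MeasurableSet (A ∩ {ω | (occurrences E b e ω : ℝ) < x}) :=
    hAm.inter (measurableSet_lt (measurable_from_nat.comp hocc) measurable_const)
  have h2 : ENNReal.ofReal (Real.exp (- x)) * P (A ∩ {ω | (occurrences E b e ω : ℝ) < x}) ≤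
      ∫⁻ ω, A.indicator 1 ω * ENNReal.ofReal (1 / 2) ^ occurrences E b e ω ∂P := by
    rw [← lintegral_indicator_one hset,
      ← lintegral_const_mul _ (measurable_one.indicator hset)]
    refine lintegral_mono fun ω => ?_
    by_cases hω : ω ∈ A ∩ {ω | (occurrences E b e ω : ℝ) < x}
    · simp only [Set.indicator_of_mem hω, Set.indicator_of_mem hω.1, Pi.one_apply, one_mul, mul_one]
      rw [← ENNReal.ofReal_pow (by norm_num)]
      apply ENNReal.ofReal_le_ofReal
      have h5 : (Real.exp (-1)) ≤ 1 / 2 := by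
        have := Real.add_one_le_exp (1 : ℝ)
        rw [Real.exp_neg, one_div]
        exact inv_anti₀ (by norm_num) (by linarith)
      have h6 : (occurrences E b e ω : ℝ) < x := hω.2
      calc Real.exp (-x) ≤ Real.exp (-(occurrences E b e ω : ℝ)) := by gcongr
        _ = Real.exp (-1) ^ occurrences E b e ω := by rw [← Real.exp_nat_mul]; ring_nf
        _ ≤ _ := by gcongr
    · simp [Set.indicator_of_notMem hω]
  have h3 : P (A ∩ {ω | (occurrences E b e ω : ℝ) < x}) =
      ENNReal.ofReal (Real.exp x) * (ENNReal.ofReal (Real.exp (-x)) *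
        P (A ∩ {ω | (occurrences E b e ω : ℝ) < x})) := by
    rw [← mul_assoc, ← ENNReal.ofReal_mul (by positivity), ← Real.exp_add]
    simp
  rw [h3]
  calc _ ≤ ENNReal.ofReal (Real.exp x) *
      (ENNReal.ofReal (Real.exp (-((e - b : ℕ) * q / 2))) * P A) := by
        exact mul_le_mul_right (h2.trans h1) _
    _ ≤ _ := by
        rw [← mul_assoc, ← ENNReal.ofReal_mul (by positivity), ← Real.exp_add]
        gcongr
        linarith

end Chernoff

/-! ### The filtration that reveals all arrival times in advance -/

noncomputable instance (n d : ℕ) : Fintype (Call n d) := by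
  classical
  exact Fintype.ofInjective (fun q : Call n d => (q.ends, q.cand)) fun q q' h => by
    ext1 <;> simp_all

/-- The sources of randomness that are revealed before call `l` arrives: the initial state, *all*
gaps and residual durations, and the earlier calls with their whole durations. -/
def pastSources (n l : ℕ) : Set (Source n) :=
  {s | match s with
    | .start => True
    | .gap _ => True
    | .call j => j < l
    | .dur j => j < l
    | .res _ _ => True}

namespace Evolution

variable {n d : ℕ} {Ω : Type u}

/-- The `σ`-algebra of everything that happens before call `l` arrives, enlarged by all gaps
between arrivals (also the future ones), all residual durations, and the whole durations of the
earlier calls.  Routing decisions are still adapted to it, and the call `l` and its duration are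
still independent of it. -/
@[reducible] def past (S : Evolution n d Ω) (l : ℕ) : MeasurableSpace Ω :=
  ⨆ s ∈ pastSources n l, S.sourceAlgebra s

/-- The `σ`-algebra generated by the gaps before the arrivals `0, …, j - 1`. -/
@[reducible] def gapsBefore (S : Evolution n d Ω) (j : ℕ) : MeasurableSpace Ω :=
  ⨆ s ∈ {s : Source n | ∃ i < j, s = .gap i}, S.sourceAlgebra s

theorem sourceAlgebra_le_past (S : Evolution n d Ω) {l : ℕ} {s : Source n}
    (hs : s ∈ pastSources n l) : S.sourceAlgebra s ≤ S.past l :=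
  le_iSup₂_of_le s hs le_rfl

theorem past_mono (S : Evolution n d Ω) : Monotone S.past := by
  intro l l' h
  refine biSup_mono fun s hs => ?_
  cases s <;> simp_all [pastSources] <;> omega

theorem gapsBefore_mono (S : Evolution n d Ω) : Monotone S.gapsBefore := by
  intro l l' h
  refine biSup_mono fun s hs => ?_
  obtain ⟨i, hi, rfl⟩ := hs
  exact ⟨i, by omega, rfl⟩

theorem gapsBefore_le_past (S : Evolution n d Ω) (j l : ℕ) : S.gapsBefore j ≤ S.past l := by
  refine biSup_mono fun s hs => ?_
  obtain ⟨i, hi, rfl⟩ := hs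
  simp [pastSources]

theorem measurable_gap_gapsBefore (S : Evolution n d Ω) {i j : ℕ} (h : i < j) :
    Measurable[S.gapsBefore j] (S.gap i) :=
  Measurable.of_comap_le (le_iSup₂_of_le (f := fun s _ => S.sourceAlgebra s)
    (.gap i) ⟨i, h, rfl⟩ le_rfl)

theorem measurable_arrival_gapsBefore (S : Evolution n d Ω) {i j : ℕ} (h : i < j) :
    Measurable[S.gapsBefore j] (S.arrival i) := by
  unfold arrival
  refine Finset.measurable_sum _ fun k hk => S.measurable_gap_gapsBefore ?_
  simp at hk; omega

theorem measurable_start_past (S : Evolution n d Ω) (l : ℕ) :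
    Measurable[S.past l] fun ω => (S.init ω, S.aux ω) :=
  Measurable.of_comap_le (S.sourceAlgebra_le_past (s := .start) (by simp [pastSources]))

theorem measurable_init_past (S : Evolution n d Ω) (l : ℕ) (p : TwoPath n) :
    Measurable[S.past l] fun ω => S.init ω p :=
  (measurable_pi_apply p).comp (measurable_fst.comp (S.measurable_start_past l))

theorem measurable_gap_past (S : Evolution n d Ω) (l j : ℕ) :
    Measurable[S.past l] (S.gap j) :=
  Measurable.of_comap_le (S.sourceAlgebra_le_past (s := .gap j) (by simp [pastSources]))

theorem measurable_arrival_past (S : Evolution n d Ω) (l j : ℕ) :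
    Measurable[S.past l] (S.arrival j) := by
  unfold arrival
  exact Finset.measurable_sum _ fun k _ => S.measurable_gap_past l k

theorem measurable_res_past (S : Evolution n d Ω) (l : ℕ) (p : TwoPath n) (k : ℕ) :
    Measurable[S.past l] (S.res p k) :=
  Measurable.of_comap_le (S.sourceAlgebra_le_past (s := .res p k) (by simp [pastSources]))

theorem measurable_call_past (S : Evolution n d Ω) {l j : ℕ} (h : j < l) :
    Measurable[S.past l] (S.call j) :=
  Measurable.of_comap_le (S.sourceAlgebra_le_past (s := .call j) (by simpa [pastSources]))

theorem measurable_dur_past (S : Evolution n d Ω) {l j : ℕ} (h : j < l) :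
    Measurable[S.past l] (S.dur j) :=
  Measurable.of_comap_le (S.sourceAlgebra_le_past (s := .dur j) (by simpa [pastSources]))

theorem info_le_past (S : Evolution n d Ω) {j l : ℕ} (h : j < l) : S.info j ≤ S.past l := by
  unfold info
  refine sup_le (sup_le (sup_le (sup_le ?_ ?_) ?_) ?_) ?_
  · exact (S.measurable_start_past l).comap_le
  · exact iSup₂_le fun i _ => (S.measurable_gap_past l i).comap_le
  · refine iSup₂_le fun i hi => (S.measurable_call_past ?_).comap_le
    simp at hi; omega
  · refine iSup₂_le fun i hi => Measurable.comap_le ?_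
    simp at hi
    exact (S.measurable_dur_past (by omega)).min
      ((S.measurable_arrival_past l j).sub (S.measurable_arrival_past l i))
  · exact iSup₂_le fun p k => Measurable.comap_le
      ((S.measurable_res_past l p k).min (S.measurable_arrival_past l j))

theorem measurableSet_call_past (S : Evolution n d Ω) {l j : ℕ} (h : j < l)
    (C : Set (Call n d)) : MeasurableSet[S.past l] {ω | S.call j ω ∈ C} :=
  S.measurable_call_past h (MeasurableSpace.measurableSet_top (s := C))

theorem arrival_succ (S : Evolution n d Ω) (j : ℕ) (ω : Ω) :
    S.arrival (j + 1) ω = S.arrival j ω + S.gap (j + 1) ω := by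
  simp [arrival, Finset.sum_range_succ]

theorem arrival_mono {S : Evolution n d Ω} {ω : Ω} (h : ∀ j, 0 ≤ S.gap j ω) :
    Monotone fun j => S.arrival j ω :=
  monotone_nat_of_le_succ fun j => by rw [arrival_succ]; linarith [h (j + 1)]

/-- Loads just before the arrival of call `j` are determined by the enlarged past. -/
theorem measurable_loadBefore_past (S : Evolution n d Ω) {l j : ℕ} (hjl : j ≤ l)
    (hvia : ∀ i < l, ∀ o, MeasurableSet[S.past l] {ω | S.via i ω = o})
    (p : TwoPath n) : Measurable[S.past l] fun ω => S.loadBefore j ω p := by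
  classical
  let _ := S.past l
  have h1 : Measurable fun ω => ((Finset.range (S.init ω p)).filter
      (fun k => S.arrival j ω ≤ S.res p k ω)).card := by
    have h2 : Measurable fun q : ℕ × Ω => ((Finset.range q.1).filter
        (fun k => S.arrival j q.2 ≤ S.res p k q.2)).card := by
      refine measurable_from_prod_countable_right fun m => ?_
      simp only [Finset.card_filter]
      refine Finset.measurable_sum _ fun k _ => ?_
      exact Measurable.ite (measurableSet_le (S.measurable_arrival_past l j)
        (S.measurable_res_past l p k)) measurable_const measurable_const
    exact h2.comp ((S.measurable_init_past l p).prodMk measurable_id)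
  refine h1.add ?_
  simp only [Finset.card_filter]
  refine Finset.measurable_sum _ fun i hi => ?_
  have hij : i < l := by simp at hi; omega
  refine Measurable.ite ?_ measurable_const measurable_const
  exact (S.measurableSet_call_past hij {q | q.ends = p.1.1}).inter
    ((hvia i hij _).inter (measurableSet_le (S.measurable_arrival_past l j)
      ((S.measurable_arrival_past l i).add (S.measurable_dur_past hij))))

variable [mΩ : MeasurableSpace Ω] {S : Evolution n d Ω} {lam : ℝ} {P : Measure Ω}

theorem IsModel.sourceAlgebra_le (hS : S.IsModel lam P) (s : Source n) :
    S.sourceAlgebra s ≤ mΩ := by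
  cases s with
  | start => exact (hS.measurable_init.prodMk hS.measurable_aux).comap_le
  | gap j => exact (hS.measurable_gap j).comap_le
  | call j => exact (hS.measurable_call j).comap_le
  | dur j => exact (hS.measurable_dur j).comap_le
  | res p k => exact (hS.measurable_res p k).comap_le

theorem IsModel.past_le (hS : S.IsModel lam P) (l : ℕ) : S.past l ≤ mΩ :=
  iSup₂_le fun s _ => hS.sourceAlgebra_le s

theorem IsModel.gapsBefore_le (hS : S.IsModel lam P) (l : ℕ) : S.gapsBefore l ≤ mΩ :=
  iSup₂_le fun s _ => hS.sourceAlgebra_le s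

theorem IsModel.measurable_arrival (hS : S.IsModel lam P) (j : ℕ) : Measurable (S.arrival j) :=
  (S.measurable_arrival_past 0 j).mono (hS.past_le 0) le_rfl

theorem IsModel.measurable_via_past (hS : S.IsModel lam P) {l j : ℕ} (h : j < l) :
    @Measurable Ω (Option (Fin n)) (S.past l) ⊤ (S.via j) :=
  (hS.nonanticipating j).mono (S.info_le_past h) le_rfl

theorem IsModel.measurableSet_via (hS : S.IsModel lam P) {l j : ℕ} (h : j < l)
    (o : Option (Fin n)) : MeasurableSet[S.past l] {ω | S.via j ω = o} :=
  hS.measurable_via_past h (MeasurableSpace.measurableSet_top (s := {o}))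

theorem IsModel.indep_call (hS : S.IsModel lam P) (l : ℕ) :
    Indep (S.past l) (MeasurableSpace.comap (S.call l) inferInstance) P := by
  have := indep_iSup_of_disjoint hS.sourceAlgebra_le hS.indep (S := pastSources n l)
    (T := {Source.call l}) (by simp [pastSources])
  rwa [iSup_singleton] at this

theorem IsModel.indep_dur (hS : S.IsModel lam P) (l : ℕ) :
    Indep (S.past l ⊔ MeasurableSpace.comap (S.call l) inferInstance)
      (MeasurableSpace.comap (S.dur l) inferInstance) P := by
  have := indep_iSup_of_disjoint hS.sourceAlgebra_le hS.indep
    (S := pastSources n l ∪ {Source.call l}) (T := {Source.dur l}) (by simp [pastSources])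
  rwa [iSup_union, iSup_singleton, iSup_singleton] at this

theorem IsModel.indep_gap (hS : S.IsModel lam P) (j : ℕ) :
    Indep (S.gapsBefore j) (MeasurableSpace.comap (S.gap j) inferInstance) P := by
  have := indep_iSup_of_disjoint hS.sourceAlgebra_le hS.indep
    (S := {s : Source n | ∃ i < j, s = .gap i}) (T := {Source.gap j})
    (by simp)
  rwa [iSup_singleton] at this

theorem IsModel.ae_gap_nonneg (hS : S.IsModel lam P) : ∀ᵐ ω ∂P, ∀ j, 0 ≤ S.gap j ω := by
  rw [ae_all_iff]
  intro j
  have h := expMeasure_ae_nonneg (lam * (n.choose 2 : ℝ))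
  rw [← hS.law_gap j] at h
  exact ae_of_ae_map (hS.measurable_gap j).aemeasurable h

theorem IsModel.measurable_linkLoad (hS : S.IsModel lam P) {l j : ℕ} (hjl : j ≤ l)
    (v w : Fin n) : Measurable[S.past l] fun ω => linkLoad (S.loadBefore j ω) v w := by
  unfold linkLoad
  refine Finset.measurable_sum _ fun p _ => ?_
  by_cases h : v ∈ p.1.1 ∧ p.1.2 = w
  · simpa only [if_pos h] using
      S.measurable_loadBefore_past hjl (fun i hi o => hS.measurableSet_via hi o) p
  · simp only [if_neg h]; exact measurable_const

/-- The probability that an arriving call, with its candidates, is a given one. -/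
noncomputable def callMass (n d : ℕ) : ℝ := 1 / (n.choose 2 : ℝ) * (1 / ((n : ℝ) - 2)) ^ d

variable [IsProbabilityMeasure P]

/-- Given the enlarged past, a call falls into a random set `C` of calls and lasts for at least the
time `a` with probability `|C| * callMass * exp (-a⁺)`. -/
theorem IsModel.lintegral_call_dur (hS : S.IsModel lam P) (l : ℕ) {C : Ω → Finset (Call n d)}
    (hC : ∀ q, MeasurableSet[S.past l] {ω | q ∈ C ω}) {a : Ω → ℝ} (ha : Measurable[S.past l] a)
    {Z : Ω → ℝ≥0∞} (hZ : Measurable[S.past l] Z) :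
    ∫⁻ ω in {ω | S.call l ω ∈ C ω ∧ a ω ≤ S.dur l ω}, Z ω ∂P =
      ∫⁻ ω, Z ω * ((C ω).card * ENNReal.ofReal (callMass n d)
        * ENNReal.ofReal (Real.exp (-max (a ω) 0))) ∂P := by
  classical
  have hle := hS.past_le l
  have hCm : ∀ q, MeasurableSet {ω | q ∈ C ω} := fun q => hle _ (hC q)
  have hZm : Measurable Z := hZ.mono hle le_rfl
  have ham : Measurable a := ha.mono hle le_rfl
  have hcall : ∀ q, MeasurableSet {ω | S.call l ω = q} := fun q =>
    hS.measurable_call l (MeasurableSpace.measurableSet_top (s := {q}))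
  have hdur : MeasurableSet {ω | a ω ≤ S.dur l ω} := measurableSet_le ham (hS.measurable_dur l)
  have hE : MeasurableSet {ω | S.call l ω ∈ C ω ∧ a ω ≤ S.dur l ω} := by
    have : {ω | S.call l ω ∈ C ω ∧ a ω ≤ S.dur l ω} =
        (⋃ q, {ω | q ∈ C ω} ∩ {ω | S.call l ω = q}) ∩ {ω | a ω ≤ S.dur l ω} := by
      ext ω; simp
    rw [this]
    exact (MeasurableSet.iUnion fun q => (hCm q).inter (hcall q)).inter hdur
  have e1 : ∀ ω, {ω | S.call l ω ∈ C ω ∧ a ω ≤ S.dur l ω}.indicator Z ω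
      = ∑ q, (Z ω * {ω | q ∈ C ω}.indicator 1 ω * {ω | S.call l ω = q}.indicator 1 ω)
          * {ω | a ω ≤ S.dur l ω}.indicator 1 ω := by
    intro ω
    rw [Finset.sum_eq_single (S.call l ω)]
    · by_cases h1 : S.call l ω ∈ C ω <;> by_cases h2 : a ω ≤ S.dur l ω <;>
        simp [Set.indicator, h1, h2]
    · intro q _ hq
      simp [Set.indicator, hq.symm]
    · simp
  rw [← lintegral_indicator hE]
  simp_rw [e1]
  have hone : ∀ {s : Set Ω}, MeasurableSet s → Measurable (s.indicator (1 : Ω → ℝ≥0∞)) :=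
    fun hs => measurable_one.indicator hs
  rw [lintegral_finsetSum]
  swap
  · exact fun q _ => ((hZm.mul (hone (hCm q))).mul (hone (hcall q))).mul (hone hdur)
  have e2 : ∀ q, ∫⁻ ω, (Z ω * {ω | q ∈ C ω}.indicator 1 ω * {ω | S.call l ω = q}.indicator 1 ω)
          * {ω | a ω ≤ S.dur l ω}.indicator 1 ω ∂P
      = ∫⁻ ω, Z ω * {ω | q ∈ C ω}.indicator 1 ω * (ENNReal.ofReal (callMass n d) *
          ENNReal.ofReal (Real.exp (-max (a ω) 0))) ∂P := by
    intro q
    have hm2 : S.past l ⊔ MeasurableSpace.comap (S.call l) inferInstance ≤ mΩ :=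
      sup_le hle (hS.measurable_call l).comap_le
    have hZq : Measurable[S.past l] fun ω => Z ω * {ω | q ∈ C ω}.indicator 1 ω := by
      let _ := S.past l
      exact hZ.mul (measurable_one.indicator (hC q))
    have hcq : MeasurableSet[MeasurableSpace.comap (S.call l) inferInstance]
        {ω | S.call l ω = q} := ⟨{q}, MeasurableSpace.measurableSet_top, by ext; simp⟩
    have hf : Measurable[S.past l ⊔ MeasurableSpace.comap (S.call l) inferInstance]
        fun ω => Z ω * {ω | q ∈ C ω}.indicator 1 ω * {ω | S.call l ω = q}.indicator 1 ω := by
      have h1 := hZq.mono (le_sup_left (b := MeasurableSpace.comap (S.call l) inferInstance)) le_rfl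
      have h2 := (le_sup_right (a := S.past l)) _ hcq
      let _ := S.past l ⊔ MeasurableSpace.comap (S.call l) inferInstance
      exact h1.mul (measurable_one.indicator h2)
    rw [lintegral_mul_indicator_exp hm2 (hS.measurable_dur l) (hS.indep_dur l) one_pos
      (hS.law_dur l) hf (ha.mono le_sup_left le_rfl)]
    have e3 : ∀ ω, (Z ω * {ω | q ∈ C ω}.indicator 1 ω * {ω | S.call l ω = q}.indicator 1 ω)
        * ENNReal.ofReal (Real.exp (-(1 * max (a ω) 0)))
        = (Z ω * {ω | q ∈ C ω}.indicator 1 ω * ENNReal.ofReal (Real.exp (-max (a ω) 0)))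
          * {ω | S.call l ω = q}.indicator 1 ω := by
      intro ω; rw [one_mul]; ring
    simp_rw [e3]
    have hg : Measurable[MeasurableSpace.comap (S.call l) inferInstance]
        ({ω | S.call l ω = q}.indicator (1 : Ω → ℝ≥0∞)) := by
      let _ := MeasurableSpace.comap (S.call l) inferInstance
      exact measurable_one.indicator hcq
    have hF : Measurable[S.past l] fun ω => Z ω * {ω | q ∈ C ω}.indicator 1 ω *
        ENNReal.ofReal (Real.exp (-max (a ω) 0)) := by
      let _ := S.past l
      exact hZq.mul (by fun_prop)
    rw [lintegral_mul_eq_lintegral_mul_lintegral_of_independent_measurableSpace hle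
      (hS.measurable_call l).comap_le (hS.indep_call l) hF hg,
      lintegral_indicator_one (hcall q), hS.law_call, ← callMass,
      ← lintegral_mul_const _ (hF.mono hle le_rfl)]
    refine lintegral_congr fun ω => by ring
  simp_rw [e2]
  rw [← lintegral_finsetSum]
  swap
  · exact fun q _ => (hZm.mul (hone (hCm q))).mul (by fun_prop)
  refine lintegral_congr fun ω => ?_
  rw [← Finset.sum_mul, ← Finset.mul_sum]
  have : ∑ q, {ω | q ∈ C ω}.indicator (1 : Ω → ℝ≥0∞) ω = (C ω).card := by
    simp [Set.indicator]
  rw [this]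
  ring

theorem callMass_nonneg (hn : 3 ≤ n) : 0 ≤ callMass n d := by
  have : (3 : ℝ) ≤ n := by exact_mod_cast hn
  have h : 0 ≤ 1 / ((n : ℝ) - 2) := one_div_nonneg.2 (by linarith)
  unfold callMass
  positivity

/-- One-step upper bound in the form that `chernoff_upper` asks for: given the enlarged past, a call
in `C` of duration at least `a` has probability at most `p * t`. -/
theorem IsModel.setLIntegral_call_dur_le (hS : S.IsModel lam P) (l : ℕ)
    {C : Ω → Finset (Call n d)}
    (hC : ∀ q, MeasurableSet[S.past l] {ω | q ∈ C ω}) {a : Ω → ℝ} (ha : Measurable[S.past l] a)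
    {A : Set Ω} (hA : MeasurableSet[S.past l] A) {p t : ℝ}
    (hp : ∀ ω ∈ A, (C ω).card * callMass n d ≤ p) (ht : ∀ ω ∈ A, Real.exp (-max (a ω) 0) ≤ t)
    (hp0 : 0 ≤ p)
    {Z : Ω → ℝ≥0∞} (hZ : Measurable[S.past l] Z) :
    ∫⁻ ω in {ω | S.call l ω ∈ C ω ∧ a ω ≤ S.dur l ω}, A.indicator Z ω ∂P
      ≤ ENNReal.ofReal (p * t) * ∫⁻ ω, A.indicator Z ω ∂P := by
  have hZA : Measurable[S.past l] (A.indicator Z) := by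
    let _ := S.past l
    exact hZ.indicator hA
  rw [hS.lintegral_call_dur l hC ha hZA,
    ← lintegral_const_mul _ (hZA.mono (hS.past_le l) le_rfl)]
  refine lintegral_mono fun ω => ?_
  by_cases hω : ω ∈ A
  · rw [mul_comm, ENNReal.ofReal_mul hp0]
    refine mul_le_mul_left (mul_le_mul' ?_ (ENNReal.ofReal_le_ofReal (ht ω hω))) _
    rw [← ENNReal.ofReal_natCast, ← ENNReal.ofReal_mul (by positivity)]
    exact ENNReal.ofReal_le_ofReal (hp ω hω)
  · simp [hω]

/-- One-step lower bound in the form that `chernoff_lower` asks for. -/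
theorem IsModel.le_setLIntegral_call_dur (hS : S.IsModel lam P) (l : ℕ)
    {C : Ω → Finset (Call n d)}
    (hC : ∀ q, MeasurableSet[S.past l] {ω | q ∈ C ω}) {a : ℝ} (ha : 0 ≤ a)
    {A : Set Ω} (hA : MeasurableSet[S.past l] A) {p : ℝ}
    (hp : ∀ ω ∈ A, p ≤ (C ω).card * callMass n d)
    {Z : Ω → ℝ≥0∞} (hZ : Measurable[S.past l] Z) :
    ENNReal.ofReal (p * Real.exp (-a)) * ∫⁻ ω, A.indicator Z ω ∂P ≤
      ∫⁻ ω in {ω | S.call l ω ∈ C ω ∧ a ≤ S.dur l ω}, A.indicator Z ω ∂P := by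
  have hZA : Measurable[S.past l] (A.indicator Z) := by
    let _ := S.past l
    exact hZ.indicator hA
  rw [hS.lintegral_call_dur l hC measurable_const hZA,
    ← lintegral_const_mul _ (hZA.mono (hS.past_le l) le_rfl)]
  refine lintegral_mono fun ω => ?_
  by_cases hω : ω ∈ A
  · rw [mul_comm, max_eq_left ha, ENNReal.ofReal_mul' (Real.exp_pos _).le]
    refine mul_le_mul_right (mul_le_mul_left ?_ _) _
    rw [← ENNReal.ofReal_natCast, ← ENNReal.ofReal_mul (by positivity)]
    exact ENNReal.ofReal_le_ofReal (hp ω hω)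
  · simp [hω]

end Evolution

/-! ### Arrival times -/

/-- The rate `λ * (n choose 2)` at which calls arrive in the network. -/
noncomputable def rate (lam : ℝ) (n : ℕ) : ℝ := lam * (n.choose 2 : ℝ)

namespace Evolution

section

variable {n d : ℕ} {Ω : Type u}

theorem prod_exp_gap (S : Evolution n d Ω) (θ : ℝ) (j : ℕ) {s s' : ℕ} (hs : s ≤ s') (ω : Ω) :
    ∏ l ∈ Finset.Ico s s', ENNReal.ofReal (Real.exp (-(θ * S.gap (j + 1 + l) ω))) =
      ENNReal.ofReal (Real.exp (-(θ * (S.arrival (j + s') ω - S.arrival (j + s) ω)))) := by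
  induction s', hs using Nat.le_induction with
  | base => simp
  | succ s' hs ih =>
    rw [Finset.prod_Ico_succ_top hs, ih, ← ENNReal.ofReal_mul (Real.exp_pos _).le, ← Real.exp_add,
      ← add_assoc j, arrival_succ, show j + 1 + s' = j + s' + 1 by ring]
    congr 2
    ring

end

variable {n d : ℕ} {Ω : Type u} [mΩ : MeasurableSpace Ω] {S : Evolution n d Ω} {lam : ℝ}
  {P : Measure Ω}

theorem IsModel.measurableSet_arrival_mem (hS : S.IsModel lam P) (j : ℕ) (a b : ℝ) :
    MeasurableSet {ω | S.arrival j ω ∈ Set.Icc a b} :=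
  (hS.measurable_arrival j) measurableSet_Icc

/-- The function `V t = e (μℓ + 1) min (1, exp (-(t - a) / ℓ))` is superharmonic for the random walk
of arrival times, with drift at least `1` on `[a, a + ℓ]`; it bounds the expected number of visits
to that interval. -/
theorem indicator_add_lintegral_potential_le {μ ℓ : ℝ} (hμ : 0 < μ) (hℓ : 0 < ℓ) (a t : ℝ) :
    (Set.Icc a (a + ℓ)).indicator 1 t + ∫⁻ x, ENNReal.ofReal (Real.exp 1 * (μ * ℓ + 1) *
        min 1 (Real.exp (-(ℓ⁻¹ * (t + x - a))))) ∂expMeasure μ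
      ≤ ENNReal.ofReal (Real.exp 1 * (μ * ℓ + 1) * min 1 (Real.exp (-(ℓ⁻¹ * (t - a))))) := by
  have := isProbabilityMeasure_expMeasure hμ
  have hC : 0 ≤ Real.exp 1 * (μ * ℓ + 1) := by positivity
  rcases lt_or_ge t a with hta | hta
  · have h1 : t ∉ Set.Icc a (a + ℓ) := fun h => absurd h.1 (not_le.2 hta)
    have h2 : (1 : ℝ) ≤ Real.exp (-(ℓ⁻¹ * (t - a))) := by
      rw [Real.one_le_exp_iff]
      have := mul_nonneg (inv_pos.2 hℓ).le (sub_nonneg.2 hta.le)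
      linarith
    rw [Set.indicator_of_notMem h1, zero_add, min_eq_left h2]
    calc _ ≤ ∫⁻ x, ENNReal.ofReal (Real.exp 1 * (μ * ℓ + 1) * 1) ∂expMeasure μ := by
          refine lintegral_mono fun x => ENNReal.ofReal_le_ofReal ?_
          gcongr
          exact min_le_left _ _
      _ = _ := by simp
  · have h2 : Real.exp (-(ℓ⁻¹ * (t - a))) ≤ 1 := by
      rw [Real.exp_le_one_iff]
      have := mul_nonneg (inv_pos.2 hℓ).le (sub_nonneg.2 hta)
      linarith
    rw [min_eq_right h2]
    set c := Real.exp (-(ℓ⁻¹ * (t - a))) with hc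
    have hcpos : 0 < c := Real.exp_pos _
    have h3 : ∫⁻ x, ENNReal.ofReal (Real.exp 1 * (μ * ℓ + 1) *
        min 1 (Real.exp (-(ℓ⁻¹ * (t + x - a))))) ∂expMeasure μ
        ≤ ENNReal.ofReal (Real.exp 1 * (μ * ℓ + 1) * c * (μ / (μ + ℓ⁻¹))) := by
      rw [ENNReal.ofReal_mul (by positivity), ← lintegral_exp_expMeasure hμ (by positivity),
        ← lintegral_const_mul _ (by fun_prop)]
      refine lintegral_mono fun x => ?_
      rw [← ENNReal.ofReal_mul (by positivity)]
      apply ENNReal.ofReal_le_ofReal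
      rw [mul_assoc _ c, hc, ← Real.exp_add]
      gcongr
      refine (min_le_right _ _).trans (Real.exp_le_exp.2 (le_of_eq ?_))
      ring
    refine (add_le_add_right h3 _).trans ?_
    by_cases hI : t ∈ Set.Icc a (a + ℓ)
    · rw [Set.indicator_of_mem hI, Pi.one_apply, ← ENNReal.ofReal_one,
        ← ENNReal.ofReal_add zero_le_one (by positivity)]
      apply ENNReal.ofReal_le_ofReal
      have h4 : Real.exp (-1) ≤ c := by
        rw [hc, Real.exp_le_exp, neg_le_neg_iff, inv_mul_le_iff₀ hℓ]
        linarith [hI.2]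
      have h5 : μ / (μ + ℓ⁻¹) = μ * ℓ / (μ * ℓ + 1) := by field_simp
      rw [h5]
      have h6 : Real.exp 1 * (μ * ℓ + 1) * c * (μ * ℓ / (μ * ℓ + 1))
        = Real.exp 1 * c * (μ * ℓ) := by field_simp
      rw [h6]
      have h7 : 1 ≤ Real.exp 1 * c := by
        calc (1 : ℝ) = Real.exp 1 * Real.exp (-1) := by rw [← Real.exp_add]; simp
          _ ≤ _ := by gcongr
      nlinarith
    · rw [Set.indicator_of_notMem hI, zero_add]
      apply ENNReal.ofReal_le_ofReal
      have : μ / (μ + ℓ⁻¹) ≤ 1 := by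
        rw [div_le_one (by positivity)]
        linarith [inv_pos.2 hℓ]
      calc _ ≤ Real.exp 1 * (μ * ℓ + 1) * c * 1 := by gcongr
        _ = _ := mul_one _

/-- The expected number of arrivals in an interval of length `ℓ` is at most `e (μℓ + 1)`. -/
theorem IsModel.tsum_arrival_mem_le [IsProbabilityMeasure P] (hS : S.IsModel lam P)
    (hμ : 0 < rate lam n) {ℓ : ℝ}
    (hℓ : 0 < ℓ) (a : ℝ) :
    ∑' j, P {ω | S.arrival j ω ∈ Set.Icc a (a + ℓ)}
      ≤ ENNReal.ofReal (Real.exp 1 * (rate lam n * ℓ + 1)) := by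
  set μ := rate lam n with hμdef
  set V : ℝ → ℝ≥0∞ := fun t =>
    ENNReal.ofReal (Real.exp 1 * (μ * ℓ + 1) * min 1 (Real.exp (-(ℓ⁻¹ * (t - a))))) with hV
  have hVm : Measurable V := by fun_prop
  have hm := fun j => hS.measurable_arrival j
  have hI : ∀ j, MeasurableSet {ω | S.arrival j ω ∈ Set.Icc a (a + ℓ)} := fun j =>
    (hm j) measurableSet_Icc
  refine ENNReal.tsum_le_of_sum_range_le fun N => ?_
  refine le_trans (le_add_right (b := _) (c := ∫⁻ ω, V (S.arrival N ω) ∂P) le_rfl) ?_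
  induction N with
  | zero =>
    rw [Finset.sum_range_zero, zero_add]
    calc _ ≤ ∫⁻ ω, ENNReal.ofReal (Real.exp 1 * (μ * ℓ + 1)) ∂P := by
          refine lintegral_mono fun ω => ENNReal.ofReal_le_ofReal ?_
          refine (mul_le_mul_of_nonneg_left (min_le_left _ _) (by positivity)).trans_eq (mul_one _)
      _ = _ := by simp
  | succ N ih =>
    refine le_trans ?_ ih
    rw [Finset.sum_range_succ, add_assoc]
    refine add_le_add_right ?_ _
    have h1 := lintegral_of_indep (P := P) (hS.gapsBefore_le (N + 1)) (hS.measurable_gap (N + 1))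
      (hS.indep_gap (N + 1)) (S.measurable_arrival_gapsBefore (Nat.lt_succ_self N))
      (φ := fun q => V (q.1 + q.2)) (by fun_prop)
    simp only at h1
    simp_rw [arrival_succ]
    rw [h1, hS.law_gap, ← lintegral_indicator_one (hI N),
      ← lintegral_add_left (measurable_one.indicator (hI N))]
    refine lintegral_mono fun ω => ?_
    exact indicator_add_lintegral_potential_le hμ hℓ a (S.arrival N ω)

/-- Weights that depend on the last `r` gaps before an arrival factorize from the event that this
arrival falls into a given interval, after summation over all arrivals. -/
theorem IsModel.tsum_lintegral_window_le [IsProbabilityMeasure P] (hS : S.IsModel lam P)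
    (hμ : 0 < rate lam n) {ℓ : ℝ}
    (hℓ : 0 < ℓ) {f : ℕ → ℝ → ℝ≥0∞} (hf : ∀ l, Measurable (f l)) (r : ℕ) (a : ℝ) :
    ∑' j, ∫⁻ ω, (Set.Icc a (a + ℓ)).indicator 1 (S.arrival (j + r) ω) *
        ∏ l ∈ Finset.range r, f l (S.gap (j + 1 + l) ω) ∂P
      ≤ ENNReal.ofReal (Real.exp 1 * (rate lam n * ℓ + 1)) *
        ∏ l ∈ Finset.range r, ∫⁻ x, f l x ∂expMeasure (rate lam n) := by
  have hind : ∀ a : ℝ, Measurable ((Set.Icc a (a + ℓ)).indicator (1 : ℝ → ℝ≥0∞)) := fun a =>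
    measurable_one.indicator measurableSet_Icc
  induction r generalizing a with
  | zero =>
    simp only [add_zero, Finset.range_zero, Finset.prod_empty, mul_one]
    refine le_trans (le_of_eq (tsum_congr fun j => ?_)) (hS.tsum_arrival_mem_le hμ hℓ a)
    rw [← lintegral_indicator_one (hS.measurableSet_arrival_mem j a (a + ℓ))]
    rfl
  | succ r ih =>
    set ν := expMeasure (rate lam n) with hν
    have hνp : IsProbabilityMeasure ν := isProbabilityMeasure_expMeasure hμ
    set W : ℕ → Ω → ℝ≥0∞ := fun j ω => ∏ l ∈ Finset.range r, f l (S.gap (j + 1 + l) ω) with hW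
    have hWm : ∀ j, Measurable (W j) := fun j => Finset.measurable_prod _ fun l _ =>
      (hf l).comp (hS.measurable_gap _)
    have hT := fun j => hS.measurable_arrival j
    have h1 : ∀ j, ∫⁻ ω, (Set.Icc a (a + ℓ)).indicator 1 (S.arrival (j + (r + 1)) ω) *
        ∏ l ∈ Finset.range (r + 1), f l (S.gap (j + 1 + l) ω) ∂P
        = ∫⁻ x, f r x * ∫⁻ ω, (Set.Icc (a - x) (a - x + ℓ)).indicator 1 (S.arrival (j + r) ω)
            * W j ω ∂P ∂ν := by
      intro j
      have hY : Measurable[S.gapsBefore (j + r + 1)] fun ω => (S.arrival (j + r) ω, W j ω) := by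
        refine (S.measurable_arrival_gapsBefore (Nat.lt_succ_self _)).prodMk ?_
        refine Finset.measurable_prod _ fun l hl => (hf l).comp (S.measurable_gap_gapsBefore ?_)
        simp at hl; omega
      have h2 := lintegral_of_indep (P := P) (hS.gapsBefore_le _) (hS.measurable_gap (j + r + 1))
        (hS.indep_gap (j + r + 1)) hY
        (φ := fun q => (Set.Icc a (a + ℓ)).indicator 1 (q.1.1 + q.2) * (q.1.2 * f r q.2))
        (((hind a).comp (by fun_prop)).mul
          ((by fun_prop : Measurable fun q : (ℝ × ℝ≥0∞) × ℝ => q.1.2).mul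
            ((hf r).comp (by fun_prop))))
      have e1 : ∀ ω, (Set.Icc a (a + ℓ)).indicator 1 (S.arrival (j + (r + 1)) ω) *
          ∏ l ∈ Finset.range (r + 1), f l (S.gap (j + 1 + l) ω) =
          (Set.Icc a (a + ℓ)).indicator 1 (S.arrival (j + r) ω + S.gap (j + r + 1) ω) *
          (W j ω * f r (S.gap (j + r + 1) ω)) := by
        intro ω
        rw [Finset.prod_range_succ, ← add_assoc, arrival_succ]
        congr 4
        ring
      simp_rw [e1]
      rw [h2, hS.law_gap, ← rate, ← hν, lintegral_lintegral_swap]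
      · refine lintegral_congr fun x => ?_
        rw [← lintegral_const_mul]
        · refine lintegral_congr fun ω => ?_
          have : (Set.Icc a (a + ℓ)).indicator (1 : ℝ → ℝ≥0∞) (S.arrival (j + r) ω + x)
              = (Set.Icc (a - x) (a - x + ℓ)).indicator 1 (S.arrival (j + r) ω) := by
            have : S.arrival (j + r) ω + x ∈ Set.Icc a (a + ℓ) ↔
                S.arrival (j + r) ω ∈ Set.Icc (a - x) (a - x + ℓ) := by
              simp only [Set.mem_Icc]
              constructor <;> rintro ⟨h1, h2⟩ <;> constructor <;> linarith
            simp [Set.indicator, this]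
          simp only [this]
          ring
        · exact ((hind _).comp (hT _)).mul (hWm j)
      · have : Measurable fun q : Ω × ℝ => (Set.Icc a (a + ℓ)).indicator (1 : ℝ → ℝ≥0∞)
            (S.arrival (j + r) q.1 + q.2) * (W j q.1 * f r q.2) :=
          ((hind a).comp (((hT _).comp measurable_fst).add measurable_snd)).mul
            (((hWm j).comp measurable_fst).mul ((hf r).comp measurable_snd))
        exact this.aemeasurable
    simp_rw [h1]
    have hinner : ∀ j, Measurable fun x => ∫⁻ ω,
        (Set.Icc (a - x) (a - x + ℓ)).indicator 1 (S.arrival (j + r) ω) * W j ω ∂P := by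
      intro j
      have e : ∀ (x : ℝ) (ω : Ω), (Set.Icc (a - x) (a - x + ℓ)).indicator (1 : ℝ → ℝ≥0∞)
          (S.arrival (j + r) ω) = (Set.Icc a (a + ℓ)).indicator 1 (S.arrival (j + r) ω + x) := by
        intro x ω
        have : S.arrival (j + r) ω + x ∈ Set.Icc a (a + ℓ) ↔
            S.arrival (j + r) ω ∈ Set.Icc (a - x) (a - x + ℓ) := by
          simp only [Set.mem_Icc]
          constructor <;> rintro ⟨h1, h2⟩ <;> constructor <;> linarith
        simp [Set.indicator, this]
      simp_rw [e]
      refine Measurable.lintegral_prod_right' (f := fun q : ℝ × Ω =>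
        (Set.Icc a (a + ℓ)).indicator (1 : ℝ → ℝ≥0∞) (S.arrival (j + r) q.2 + q.1) * W j q.2) ?_
      exact ((hind a).comp (((hT _).comp measurable_snd).add measurable_fst)).mul
        ((hWm j).comp measurable_snd)
    rw [← lintegral_tsum]
    swap
    · exact fun j => ((hf r).mul (hinner j)).aemeasurable
    simp_rw [ENNReal.tsum_mul_left]
    rw [Finset.prod_range_succ, ← mul_assoc, ← lintegral_const_mul _ (hf r)]
    refine lintegral_mono fun x => ?_
    rw [mul_comm]
    exact mul_le_mul_left (ih (a - x)) _

/-- The case of `tsum_lintegral_window_le` in which the weight is the exponential of the time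
between two of the last `r` arrivals. -/
theorem IsModel.tsum_lintegral_exp_window_le [IsProbabilityMeasure P] (hS : S.IsModel lam P)
    (hμ : 0 < rate lam n) {ℓ : ℝ}
    (hℓ : 0 < ℓ) {θ : ℝ} (hθ : 0 < rate lam n + θ) {r s s' : ℕ} (hs : s ≤ s') (hs' : s' ≤ r)
    (a : ℝ) :
    ∑' j, ∫⁻ ω in {ω | S.arrival (j + r) ω ∈ Set.Icc a (a + ℓ)},
        ENNReal.ofReal (Real.exp (-(θ * (S.arrival (j + s') ω - S.arrival (j + s) ω)))) ∂P
      ≤ ENNReal.ofReal (Real.exp 1 * (rate lam n * ℓ + 1) *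
        (rate lam n / (rate lam n + θ)) ^ (s' - s)) := by
  have hp : IsProbabilityMeasure (expMeasure (rate lam n)) := isProbabilityMeasure_expMeasure hμ
  set f : ℕ → ℝ → ℝ≥0∞ := fun l x =>
    if l ∈ Finset.Ico s s' then ENNReal.ofReal (Real.exp (-(θ * x))) else 1 with hf
  have hfm : ∀ l, Measurable (f l) := by
    intro l
    by_cases hl : l ∈ Finset.Ico s s'
    · simp only [hf, if_pos hl]; fun_prop
    · simp only [hf, if_neg hl]; exact measurable_const
  have hsub : (Finset.range r).filter (fun l => l ∈ Finset.Ico s s') = Finset.Ico s s' := by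
    ext l; simp; omega
  have h := hS.tsum_lintegral_window_le hμ hℓ hfm r a
  have hprod : ∏ l ∈ Finset.range r, ∫⁻ x, f l x ∂expMeasure (rate lam n)
      = ENNReal.ofReal ((rate lam n / (rate lam n + θ)) ^ (s' - s)) := by
    have : ∀ l, ∫⁻ x, f l x ∂expMeasure (rate lam n) = if l ∈ Finset.Ico s s' then
        ENNReal.ofReal (rate lam n / (rate lam n + θ)) else 1 := by
      intro l
      by_cases hl : l ∈ Finset.Ico s s'
      · simp only [hf, if_pos hl]; exact lintegral_exp_expMeasure hμ hθ
      · simp only [hf, if_neg hl]; simp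
    simp_rw [this]
    rw [← Finset.prod_filter, hsub, Finset.prod_const, Nat.card_Ico,
      ENNReal.ofReal_pow (by positivity)]
  rw [hprod, ← ENNReal.ofReal_mul (by positivity)] at h
  refine le_trans (le_of_eq (tsum_congr fun j => ?_)) h
  rw [← lintegral_indicator (hS.measurableSet_arrival_mem _ a (a + ℓ))]
  refine lintegral_congr fun ω => ?_
  have hw : ∏ l ∈ Finset.range r, f l (S.gap (j + 1 + l) ω) =
      ENNReal.ofReal (Real.exp (-(θ * (S.arrival (j + s') ω - S.arrival (j + s) ω)))) := by
    simp only [hf]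
    rw [← Finset.prod_filter, hsub]
    exact prod_exp_gap S θ j hs ω
  have hIt : ω ∈ {ω | S.arrival (j + r) ω ∈ Set.Icc a (a + ℓ)} ↔
      S.arrival (j + r) ω ∈ Set.Icc a (a + ℓ) := Iff.rfl
  rw [hw]
  by_cases hω : S.arrival (j + r) ω ∈ Set.Icc a (a + ℓ)
  · rw [Set.indicator_of_mem (hIt.2 hω), Set.indicator_of_mem hω, Pi.one_apply, one_mul]
  · rw [Set.indicator_of_notMem (fun h => hω (hIt.1 h)), Set.indicator_of_notMem hω, zero_mul]

/-- The time between two arrivals is independent of the gaps before the first of them. -/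
theorem IsModel.lintegral_mul_exp_arrival_sub (hS : S.IsModel lam P) (hμ : 0 < rate lam n)
    {θ : ℝ} (hθ : 0 < rate lam n + θ) (b m : ℕ) {Z : Ω → ℝ≥0∞}
    (hZ : Measurable[S.gapsBefore (b + 1)] Z) :
    ∫⁻ ω, Z ω * ENNReal.ofReal (Real.exp (-(θ * (S.arrival (b + m) ω - S.arrival b ω)))) ∂P
      = ENNReal.ofReal ((rate lam n / (rate lam n + θ)) ^ m) * ∫⁻ ω, Z ω ∂P := by
  induction m with
  | zero => simp
  | succ m ih =>
    have hY : Measurable[S.gapsBefore (b + m + 1)] fun ω => Z ω *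
        ENNReal.ofReal (Real.exp (-(θ * (S.arrival (b + m) ω - S.arrival b ω)))) := by
      refine (hZ.mono (S.gapsBefore_mono (by omega)) le_rfl).mul ?_
      have h1 := S.measurable_arrival_gapsBefore (Nat.lt_succ_self (b + m))
      have h2 := S.measurable_arrival_gapsBefore (i := b) (j := b + m + 1) (by omega)
      let _ := S.gapsBefore (b + m + 1)
      exact (Real.measurable_exp.comp ((h1.sub h2).const_mul θ).neg).ennreal_ofReal
    have hg : Measurable[MeasurableSpace.comap (S.gap (b + m + 1)) inferInstance] fun ω =>
        ENNReal.ofReal (Real.exp (-(θ * S.gap (b + m + 1) ω))) :=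
      (by fun_prop : Measurable fun x : ℝ => ENNReal.ofReal (Real.exp (-(θ * x)))).comp
        (comap_measurable (S.gap (b + m + 1)))
    have h := lintegral_mul_eq_lintegral_mul_lintegral_of_independent_measurableSpace
      (hS.gapsBefore_le _) (hS.measurable_gap (b + m + 1)).comap_le (hS.indep_gap (b + m + 1)) hY hg
    have hlast : ∫⁻ ω, ENNReal.ofReal (Real.exp (-(θ * S.gap (b + m + 1) ω))) ∂P
        = ENNReal.ofReal (rate lam n / (rate lam n + θ)) := by
      rw [← lintegral_exp_expMeasure hμ hθ, rate, ← hS.law_gap (b + m + 1),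
        lintegral_map (by fun_prop) (hS.measurable_gap _)]
    rw [hlast, ih] at h
    rw [pow_succ, ENNReal.ofReal_mul (by positivity)]
    refine Eq.trans (lintegral_congr fun ω => ?_) (h.trans (by ring))
    rw [mul_assoc, ← ENNReal.ofReal_mul (Real.exp_pos _).le, ← Real.exp_add, ← add_assoc,
      arrival_succ]
    congr 3
    ring

/-- Exponential moments of an arrival time. -/
theorem IsModel.lintegral_exp_arrival (hS : S.IsModel lam P) (hμ : 0 < rate lam n)
    {θ : ℝ} (hθ : 0 < rate lam n + θ) (j : ℕ) :
    ∫⁻ ω, ENNReal.ofReal (Real.exp (-(θ * S.arrival j ω))) ∂P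
      = ENNReal.ofReal ((rate lam n / (rate lam n + θ)) ^ (j + 1)) := by
  have h0 : ∫⁻ ω, ENNReal.ofReal (Real.exp (-(θ * S.arrival 0 ω))) ∂P
      = ENNReal.ofReal (rate lam n / (rate lam n + θ)) := by
    rw [← lintegral_exp_expMeasure hμ hθ, rate, ← hS.law_gap 0,
      lintegral_map (by fun_prop) (hS.measurable_gap _)]
    simp [arrival]
  have hZ : Measurable[S.gapsBefore (0 + 1)] fun ω =>
      ENNReal.ofReal (Real.exp (-(θ * S.arrival 0 ω))) := by
    have h1 := S.measurable_arrival_gapsBefore (i := 0) (j := 0 + 1) (by omega)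
    let _ := S.gapsBefore (0 + 1)
    exact (Real.measurable_exp.comp (h1.const_mul θ).neg).ennreal_ofReal
  have h := hS.lintegral_mul_exp_arrival_sub hμ hθ 0 j hZ
  rw [h0, ← ENNReal.ofReal_mul (by positivity), ← pow_succ] at h
  rw [← h]
  refine lintegral_congr fun ω => ?_
  rw [← ENNReal.ofReal_mul (Real.exp_pos _).le, ← Real.exp_add]
  congr 2
  simp
  ring

end Evolution

/-! ### Counting calls -/

section Counting

variable {n d : ℕ}

open Classical in
/-- The end other than `v` of a call, together with its candidates. -/
noncomputable def otherEnd (v : Fin n) (q : Call n d) : (_ : Fin n) × (Fin d → Fin n) :=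
  ⟨if h : v ∈ q.ends then Sym2.Mem.other h else v, q.cand⟩

theorem ends_eq_otherEnd {v : Fin n} {q : Call n d} (h : v ∈ q.ends) :
    q.ends = s(v, (otherEnd v q).1) := by
  simp [otherEnd, h]

theorem otherEnd_ne {v : Fin n} {q : Call n d} (h : v ∈ q.ends) : (otherEnd v q).1 ≠ v := by
  intro h1
  have h2 := q.not_isDiag
  rw [ends_eq_otherEnd h, h1] at h2
  exact h2 rfl

theorem otherEnd_injOn (v : Fin n) : Set.InjOn (otherEnd (d := d) v) {q | v ∈ q.ends} := by
  intro q hq q' hq' h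
  ext1
  · rw [ends_eq_otherEnd hq, ends_eq_otherEnd hq', h]
  · have : (otherEnd v q).2 = (otherEnd v q').2 := by rw [h]
    exact this

/-- Upper bound for the number of calls at `v` whose candidates lie in a set `B u` that may depend
on the other end `u`. -/
theorem card_calls_le (v : Fin n) (B : Fin n → Finset (Fin n)) {T : Finset (Call n d)}
    (hv : ∀ q ∈ T, v ∈ q.ends) (hT : ∀ q ∈ T, ∀ i, q.cand i ∈ B (otherEnd v q).1) :
    T.card ≤ ∑ u ∈ Finset.univ.erase v, (B u).card ^ d := by
  classical
  have h : T.card ≤ ((Finset.univ.erase v).sigma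
      fun u => Fintype.piFinset fun _ : Fin d => B u).card := by
    refine Finset.card_le_card_of_injOn (otherEnd v) (fun q hq => ?_)
      ((otherEnd_injOn v).mono fun q hq => hv q hq)
    simp only [Finset.coe_sigma, Set.mem_sigma_iff, Finset.mem_coe, Finset.mem_erase,
      Finset.mem_univ, and_true, Fintype.mem_piFinset]
    exact ⟨otherEnd_ne (hv q hq), hT q hq⟩
  simpa [Finset.card_sigma] using h

theorem le_card_calls (v : Fin n) (B : Fin n → Finset (Fin n)) {T : Finset (Call n d)}
    (hB : ∀ u, v ∉ B u ∧ u ∉ B u)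
    (hT : ∀ q : Call n d, v ∈ q.ends → (∀ i, q.cand i ∈ B (otherEnd v q).1) → q ∈ T) :
    ∑ u ∈ Finset.univ.erase v, (B u).card ^ d ≤ T.card := by
  classical
  have h : ((Finset.univ.erase v).sigma
      fun u => Fintype.piFinset fun _ : Fin d => B u).card ≤ T.card := by
    refine Finset.card_le_card_of_surjOn (otherEnd v) ?_
    rintro ⟨u, f⟩ huf
    simp only [Finset.coe_sigma, Set.mem_sigma_iff, Finset.mem_coe, Finset.mem_erase,
      Finset.mem_univ, and_true, Fintype.mem_piFinset] at huf
    obtain ⟨hu, hf⟩ := huf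
    let q : Call n d := ⟨s(v, u), f, by simpa using Ne.symm hu, fun i hi => by
      have h1 := hf i
      rcases Sym2.mem_iff.1 hi with h2 | h2
      · rw [h2] at h1; exact (hB u).1 h1
      · rw [h2] at h1; exact (hB u).2 h1⟩
    have hvq : v ∈ q.ends := Sym2.mem_mk_left v u
    have ho : (otherEnd v q).1 = u := by
      have := ends_eq_otherEnd hvq
      exact (Sym2.congr_right.1 this).symm
    refine ⟨q, hT q hvq (by rw [ho]; exact hf), ?_⟩
    exact Sigma.ext ho (heq_of_eq rfl)
  simpa [Finset.card_sigma] using h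

theorem card_mul_callMass (hn : 3 ≤ n) (y : ℝ) :
    ((n : ℝ) - 1) * y ^ d * Evolution.callMass n d = 2 / n * (y / (n - 2)) ^ d := by
  have h3 : (3 : ℝ) ≤ n := by exact_mod_cast hn
  have h0 : (n : ℝ) ≠ 0 := by linarith
  have h1 : (n : ℝ) - 1 ≠ 0 := by linarith
  have h2 : (n : ℝ) - 2 ≠ 0 := by linarith
  unfold Evolution.callMass
  rw [Nat.cast_choose_two, div_pow, div_pow]
  field_simp
  simp

/-- At most `2 / n` of the calls involve a given node. -/
theorem card_mul_callMass_le_of_mem (hn : 3 ≤ n) (v : Fin n) {T : Finset (Call n d)}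
    (hv : ∀ q ∈ T, v ∈ q.ends) : T.card * Evolution.callMass n d ≤ 2 / n := by
  have h3 : (3 : ℝ) ≤ n := by exact_mod_cast hn
  have h := card_calls_le v (fun u => {u, v}ᶜ) hv fun q hq i => by
    have := q.cand_notMem i
    rw [ends_eq_otherEnd (hv q hq)] at this
    simp only [Sym2.mem_iff, not_or] at this
    simp [this.1, this.2]
  have h4 : ∀ u ∈ Finset.univ.erase v, (({u, v} : Finset (Fin n))ᶜ).card ^ d = (n - 2) ^ d := by
    intro u hu
    rw [Finset.card_compl, Finset.card_pair (by simpa using hu)]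
    simp
  rw [Finset.sum_congr rfl h4] at h
  simp only [Finset.sum_const, Finset.card_erase_of_mem (Finset.mem_univ v), Finset.card_univ,
    Fintype.card_fin, smul_eq_mul] at h
  have h5 : (T.card : ℝ) ≤ ((n : ℝ) - 1) * ((n : ℝ) - 2) ^ d := by
    have : (T.card : ℝ) ≤ ((n - 1 : ℕ) : ℝ) * ((n - 2 : ℕ) : ℝ) ^ d := by exact_mod_cast h
    rw [Nat.cast_sub (by omega), Nat.cast_sub (by omega)] at this
    simpa using this
  calc _ ≤ ((n : ℝ) - 1) * ((n : ℝ) - 2) ^ d * Evolution.callMass n d :=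
        mul_le_mul_of_nonneg_right h5 (Evolution.callMass_nonneg hn)
    _ = _ := by rw [card_mul_callMass hn, div_self (by linarith)]; simp

/-- If every node has at most `x` bad partners, then a proportion of at most `(2 / n) (6 x / n) ^ d`
of the calls involve a given node and have only candidates that are bad for one of the ends. -/
theorem card_mul_callMass_le (hn : 3 ≤ n) (v : Fin n) (B : Fin n → Finset (Fin n)) {x : ℝ}
    (hB : ∀ u, ((B u).card : ℝ) ≤ x) {T : Finset (Call n d)} (hv : ∀ q ∈ T, v ∈ q.ends)
    (hT : ∀ q ∈ T, ∀ i, ∃ u ∈ q.ends, q.cand i ∈ B u) :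
    T.card * Evolution.callMass n d ≤ 2 / n * (6 * x / n) ^ d := by
  classical
  have h3 : (3 : ℝ) ≤ n := by exact_mod_cast hn
  have hx : 0 ≤ x := (Nat.cast_nonneg _).trans (hB v)
  have h := card_calls_le v (fun u => B u ∪ B v) hv fun q hq i => by
    obtain ⟨u, hu, hi⟩ := hT q hq i
    rw [ends_eq_otherEnd (hv q hq), Sym2.mem_iff] at hu
    rcases hu with rfl | rfl <;> simp [hi]
  have h4 : ∀ u, (((B u ∪ B v).card ^ d : ℕ) : ℝ) ≤ (2 * x) ^ d := by
    intro u
    have : ((B u ∪ B v).card : ℝ) ≤ (B u).card + (B v).card := by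
      exact_mod_cast Finset.card_union_le _ _
    push_cast
    gcongr
    linarith [hB u, hB v]
  have h5 : (T.card : ℝ) ≤ ((n : ℝ) - 1) * (2 * x) ^ d := by
    have h6 : (T.card : ℝ) ≤ ∑ u ∈ Finset.univ.erase v, (((B u ∪ B v).card ^ d : ℕ) : ℝ) := by
      exact_mod_cast h
    refine h6.trans ((Finset.sum_le_sum fun u _ => h4 u).trans (le_of_eq ?_))
    simp only [Finset.sum_const, Finset.card_erase_of_mem (Finset.mem_univ v), Finset.card_univ,
      Fintype.card_fin, nsmul_eq_mul]
    rw [Nat.cast_sub (by omega)]; simp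
  calc _ ≤ ((n : ℝ) - 1) * (2 * x) ^ d * Evolution.callMass n d :=
        mul_le_mul_of_nonneg_right h5 (Evolution.callMass_nonneg hn)
    _ = 2 / n * (2 * x / (n - 2)) ^ d := card_mul_callMass hn _
    _ ≤ _ := by
        have h6 : 2 * x / (n - 2) ≤ 6 * x / n := by
          rw [div_le_div_iff₀ (by linarith) (by linarith)]
          nlinarith
        have h7 : 0 ≤ 2 * x / ((n : ℝ) - 2) := div_nonneg (by linarith) (by linarith)
        gcongr

end Counting

/-! ### Loads and heights of calls -/

namespace Evolution

variable {n d : ℕ} {Ω : Type u}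

/-- The load of the link `vw` just before the arrival of call `j`. -/
noncomputable def load (S : Evolution n d Ω) (j : ℕ) (ω : Ω) (v w : Fin n) : ℕ :=
  linkLoad (S.loadBefore j ω) v w

/-- The call `l` has not yet ended when the call `i` arrives. -/
def InProgress (S : Evolution n d Ω) (l i : ℕ) (ω : Ω) : Prop :=
  S.arrival i ω ≤ S.arrival l ω + S.dur l ω

open Classical in
/-- The calls before `i` that use the link `vw` and are in progress when call `i` arrives. -/
noncomputable def callsOn (S : Evolution n d Ω) (i : ℕ) (ω : Ω) (v w : Fin n) : Finset ℕ :=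
  (Finset.range i).filter fun l =>
    v ∈ (S.call l ω).ends ∧ S.via l ω = some w ∧ S.InProgress l i ω

open Classical in
/-- The number of calls at `v` in progress when call `i` arrives that found, on their own arrival,
a load of at least `k` on the link at `v` via which they were routed. -/
noncomputable def heightCount (S : Evolution n d Ω) (k i : ℕ) (ω : Ω) (v : Fin n) : ℕ :=
  ((Finset.range i).filter fun l => v ∈ (S.call l ω).ends ∧
    (∃ w, S.via l ω = some w ∧ k ≤ S.load l ω v w) ∧ S.InProgress l i ω).card

open Classical in
/-- The nodes `w` such that the link `vw` has load at least `k` when call `i` arrives. -/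
noncomputable def loadedLinks (S : Evolution n d Ω) (k i : ℕ) (ω : Ω) (v : Fin n) :
    Finset (Fin n) :=
  Finset.univ.filter fun w => k ≤ S.load i ω v w

open Classical in
/-- The calls at `v` all of whose candidates lead, on one of their two links, to a load of at
least `k` just before the arrival of call `l`. -/
noncomputable def highCalls (S : Evolution n d Ω) (k l : ℕ) (ω : Ω) (v : Fin n) :
    Finset (Call n d) :=
  Finset.univ.filter fun q => v ∈ q.ends ∧ ∀ i, ∃ u ∈ q.ends, k ≤ S.load l ω u (q.cand i)

/-- Calls use nodes off their edge as intermediate nodes. -/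
def ViaOffEnds (S : Evolution n d Ω) (ω : Ω) : Prop :=
  ∀ l w, S.via l ω = some w → w ∉ (S.call l ω).ends

variable {S : Evolution n d Ω} {ω : Ω}

theorem mem_callsOn {i l : ℕ} {v w : Fin n} : l ∈ S.callsOn i ω v w ↔
    l < i ∧ v ∈ (S.call l ω).ends ∧ S.via l ω = some w ∧ S.InProgress l i ω := by
  simp [callsOn]

/-- The load of a link splits into a contribution `c` of the initial calls and the `callsOn`; `c`
vanishes when the initial calls have ended. -/
theorem load_eq (hvia : S.ViaOffEnds ω) (i : ℕ) (v w : Fin n) :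
    ∃ c, S.load i ω v w = c + (S.callsOn i ω v w).card ∧
      ((∀ p, ∀ k < S.init ω p, S.res p k ω < S.arrival i ω) → c = 0) := by
  classical
  refine ⟨∑ p : TwoPath n, if v ∈ p.1.1 ∧ p.1.2 = w then
    ((Finset.range (S.init ω p)).filter (fun k => S.arrival i ω ≤ S.res p k ω)).card else 0,
    ?_, ?_⟩
  · have h1 : (S.callsOn i ω v w).card = ∑ p : TwoPath n, if v ∈ p.1.1 ∧ p.1.2 = w then
        ((Finset.range i).filter (fun l => (S.call l ω).ends = p.1.1 ∧ S.via l ω = some p.1.2 ∧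
          S.arrival i ω ≤ S.arrival l ω + S.dur l ω)).card else 0 := by
      rw [← Finset.sum_filter, ← Finset.card_biUnion]
      · congr 1
        ext l
        simp only [mem_callsOn, InProgress, Finset.mem_filter, Finset.mem_range, Finset.mem_biUnion,
          Finset.mem_univ, true_and, Subtype.exists]
        constructor
        · rintro ⟨hl, hv, hw, ha⟩
          exact ⟨((S.call l ω).ends, w), ⟨(S.call l ω).not_isDiag, hvia l w hw⟩, ⟨hv, rfl⟩, hl,
            rfl, hw, ha⟩
        · rintro ⟨⟨e, w'⟩, _, ⟨hv, rfl⟩, hl, he, hw, ha⟩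
          simp only at he hv hw
          exact ⟨hl, he ▸ hv, hw, ha⟩
      · intro p _ p' _ hpp'
        rw [Function.onFun, Finset.disjoint_left]
        intro l hl hl'
        simp only [Finset.mem_filter] at hl hl'
        apply hpp'
        refine Subtype.ext (Prod.ext (hl.2.1.symm.trans hl'.2.1) ?_)
        exact Option.some_injective _ (hl.2.2.1.symm.trans hl'.2.2.1)
    rw [h1, ← Finset.sum_add_distrib]
    refine Finset.sum_congr rfl fun p _ => ?_
    split_ifs <;> simp [loadBefore]
  · intro h
    refine Finset.sum_eq_zero fun p _ => ?_
    split_ifs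
    · rw [Finset.card_eq_zero, Finset.filter_eq_empty_iff]
      intro k hk
      exact not_le.2 (h p k (by simpa using hk))
    · rfl

theorem card_callsOn_le_load (hvia : S.ViaOffEnds ω) (i : ℕ) (v w : Fin n) :
    (S.callsOn i ω v w).card ≤ S.load i ω v w := by
  obtain ⟨c, hc, -⟩ := load_eq hvia i v w
  omega

/-- Of the calls in progress on a link, the later ones found at least the earlier ones there. -/
theorem le_card_filter_callsOn (hgap : ∀ j, 0 ≤ S.gap j ω) (hvia : S.ViaOffEnds ω)
    {i k s : ℕ} {v w : Fin n}
    (h : k + s ≤ (S.callsOn i ω v w).card) :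
    s ≤ ((S.callsOn i ω v w).filter fun l => k ≤ S.load l ω v w).card := by
  classical
  have hsplit := Finset.card_filter_add_card_filter_not (s := S.callsOn i ω v w)
    (fun l => k ≤ S.load l ω v w)
  suffices hlow : ((S.callsOn i ω v w).filter fun l => ¬ k ≤ S.load l ω v w).card ≤ k by omega
  set F := (S.callsOn i ω v w).filter fun l => ¬ k ≤ S.load l ω v w with hF
  rcases F.eq_empty_or_nonempty with hE | hne
  · simp [hE]
  -- the last of these calls found all the others on the link
  set m := F.max' hne with hm
  have hmF : m ∈ F := F.max'_mem hne
  have hsub : F.erase m ⊆ S.callsOn m ω v w := by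
    intro l hl
    rw [Finset.mem_erase] at hl
    have hlm : l < m := lt_of_le_of_ne (F.le_max' l hl.2) hl.1
    have h1 := (Finset.mem_filter.1 hl.2).1
    have h2 := (Finset.mem_filter.1 hmF).1
    rw [mem_callsOn] at h1 h2 ⊢
    exact ⟨hlm, h1.2.1, h1.2.2.1, (arrival_mono hgap h2.1.le).trans h1.2.2.2⟩
  have h3 := Finset.card_le_card hsub
  have h4 := card_callsOn_le_load hvia m v w
  have h5 := (Finset.mem_filter.1 hmF).2
  rw [Finset.card_erase_of_mem hmF] at h3
  omega

/-- A link of load `k + s` carries at least `s` calls that found load at least `k` there. -/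
theorem le_heightCount_of_le_load (hgap : ∀ j, 0 ≤ S.gap j ω) (hvia : S.ViaOffEnds ω)
    {i : ℕ} (hinit : ∀ p, ∀ k < S.init ω p, S.res p k ω < S.arrival i ω)
    {k s : ℕ} {v w : Fin n} (h : k + s ≤ S.load i ω v w) :
    s ≤ S.heightCount k i ω v := by
  classical
  obtain ⟨c, hc, hc0⟩ := load_eq hvia i v w
  rw [hc0 hinit, zero_add] at hc
  refine (le_card_filter_callsOn hgap hvia (hc ▸ h)).trans (Finset.card_le_card fun l hl => ?_)
  rw [Finset.mem_filter, mem_callsOn] at hl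
  rw [Finset.mem_filter, Finset.mem_range]
  exact ⟨hl.1.1, hl.1.2.1, ⟨w, hl.1.2.2.1, hl.2⟩, hl.1.2.2.2⟩

/-- Each link of load more than `k` at `v` carries a call that found load at least `k` there. -/
theorem card_loadedLinks_le_heightCount (hgap : ∀ j, 0 ≤ S.gap j ω) (hvia : S.ViaOffEnds ω)
    {i : ℕ} (hinit : ∀ p, ∀ k < S.init ω p, S.res p k ω < S.arrival i ω)
    (k : ℕ) (v : Fin n) :
    (S.loadedLinks (k + 1) i ω v).card ≤ S.heightCount k i ω v := by
  classical
  refine Finset.card_le_card_of_surjOn (fun l => (S.via l ω).getD v) ?_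
  intro w hw
  have hw' : k + 1 ≤ S.load i ω v w := (Finset.mem_filter.1 hw).2
  obtain ⟨c, hc, hc0⟩ := load_eq hvia i v w
  rw [hc0 hinit, zero_add] at hc
  have h1 := le_card_filter_callsOn hgap hvia (hc ▸ hw')
  obtain ⟨l, hl⟩ := Finset.card_pos.1 h1
  rw [Finset.mem_filter, mem_callsOn] at hl
  refine ⟨l, ?_, by simp [hl.1.2.2.1]⟩
  rw [Finset.mem_coe, Finset.mem_filter, Finset.mem_range]
  exact ⟨hl.1.1, hl.1.2.1, ⟨w, hl.1.2.2.1, hl.2⟩, hl.1.2.2.2⟩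

theorem mul_card_loadedLinks_le_heightCount (hvia : S.ViaOffEnds ω)
    {i : ℕ} (hinit : ∀ p, ∀ k < S.init ω p, S.res p k ω < S.arrival i ω)
    (k : ℕ) (v : Fin n) :
    k * (S.loadedLinks k i ω v).card ≤ S.heightCount 0 i ω v := by
  classical
  calc k * (S.loadedLinks k i ω v).card = ∑ w ∈ S.loadedLinks k i ω v, k := by
        simp [mul_comm]
    _ ≤ ∑ w ∈ S.loadedLinks k i ω v, (S.callsOn i ω v w).card := by
        refine Finset.sum_le_sum fun w hw => ?_
        obtain ⟨c, hc, hc0⟩ := load_eq hvia i v w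
        rw [hc0 hinit, zero_add] at hc
        rw [← hc]
        exact (Finset.mem_filter.1 hw).2
    _ = ((S.loadedLinks k i ω v).biUnion fun w => S.callsOn i ω v w).card := by
        rw [Finset.card_biUnion]
        intro w _ w' _ hww'
        rw [Function.onFun, Finset.disjoint_left]
        intro l hl hl'
        rw [mem_callsOn] at hl hl'
        exact hww' (Option.some_injective _ (hl.2.2.1.symm.trans hl'.2.2.1))
    _ ≤ _ := by
        refine Finset.card_le_card fun l hl => ?_
        rw [Finset.mem_biUnion] at hl
        obtain ⟨w, _, hl⟩ := hl
        obtain ⟨h1, h2, h3, h4⟩ := mem_callsOn.1 hl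
        rw [Finset.mem_filter, Finset.mem_range]
        exact ⟨h1, h2, ⟨w, h3, Nat.zero_le _⟩, h4⟩

theorem exists_le_load_of_le_maxLoad {j k : ℕ} {i : Fin d} (hk : k ≤ S.maxLoad j ω i) :
    ∃ u ∈ (S.call j ω).ends, k ≤ S.load j ω u ((S.call j ω).cand i) := by
  classical
  have hne : (Finset.univ.filter (fun v => v ∈ (S.call j ω).ends)).Nonempty := by
    induction h : (S.call j ω).ends with
    | _ a b => exact ⟨a, by simp⟩
  obtain ⟨u, hu, h⟩ := Finset.exists_mem_eq_sup _ hne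
    (fun v => linkLoad (S.loadBefore j ω) v ((S.call j ω).cand i))
  refine ⟨u, (Finset.mem_filter.1 hu).2, ?_⟩
  unfold maxLoad at hk
  convert hk.trans_eq _
  rw [load, ← h]

/-- With the balanced algorithm, a call that adds to a link of load at least `k` has no candidate
for which both links have load less than `k`. -/
theorem mem_highCalls_of_balanced {D l k : ℕ} {v w : Fin n}
    (h : (∃ i, S.Available D l ω i ∧
      (∀ i', S.Available D l ω i' → S.maxLoad l ω i ≤ S.maxLoad l ω i') ∧
      S.via l ω = some ((S.call l ω).cand i)) ∨
    ((∀ i, ¬ S.Available D l ω i) ∧ S.via l ω = none))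
    (hv : v ∈ (S.call l ω).ends) (hw : S.via l ω = some w) (hk : k ≤ S.load l ω v w) :
    S.call l ω ∈ S.highCalls k l ω v := by
  classical
  simp only [highCalls, Finset.mem_filter, Finset.mem_univ, true_and]
  refine ⟨hv, fun i' => ?_⟩
  rcases h with ⟨i, hi, hmin, hi'⟩ | ⟨-, h⟩
  · have hwi : (S.call l ω).cand i = w := Option.some_injective _ (hi'.symm.trans hw)
    by_cases hav : S.Available D l ω i'
    · refine exists_le_load_of_le_maxLoad (le_trans ?_ (hmin i' hav))
      refine hk.trans ?_
      rw [← hwi]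
      exact Finset.le_sup (f := fun v => linkLoad (S.loadBefore l ω) v ((S.call l ω).cand i))
        (by simpa using hv)
    · unfold Available at hav
      push Not at hav
      obtain ⟨u, hu, hDu⟩ := hav
      have := hi v hv
      rw [hwi] at this
      exact ⟨u, hu, hk.trans (this.le.trans hDu)⟩
  · rw [h] at hw; exact absurd hw (by simp)

end Evolution

/-! ### Layered induction for the balanced algorithm -/

/-- Sums of a geometric weight over the time since an arrival. -/
theorem sum_exp_neg_le {c : ℝ} (hc : 0 < c) (b i : ℕ) :
    ∑ l ∈ Finset.Ico b i, Real.exp (-(c * ((i : ℝ) - l))) ≤ c⁻¹ := by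
  have key : ∀ N : ℕ, ∑ s ∈ Finset.range N, Real.exp (-(c * (s + 1 : ℕ))) ≤
      c⁻¹ * (1 - Real.exp (-(c * N))) := by
    intro N
    induction N with
    | zero => simp
    | succ N ih =>
      rw [Finset.sum_range_succ]
      have h1 : Real.exp (-(c * N)) = Real.exp c * Real.exp (-(c * (N + 1 : ℕ))) := by
        rw [← Real.exp_add]; congr 1; push_cast; ring
      have h2 := Real.add_one_le_exp c
      have h3 : c⁻¹ * (1 - Real.exp (-(c * (N + 1 : ℕ)))) - c⁻¹ * (1 - Real.exp (-(c * N)))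
          = c⁻¹ * ((Real.exp c - 1) * Real.exp (-(c * (N + 1 : ℕ)))) := by rw [h1]; ring
      have h4 : Real.exp (-(c * (N + 1 : ℕ))) ≤
          c⁻¹ * ((Real.exp c - 1) * Real.exp (-(c * (N + 1 : ℕ)))) := by
        rw [← mul_assoc]
        refine le_mul_of_one_le_left (Real.exp_pos _).le ?_
        rw [le_inv_mul_iff₀ hc]; linarith
      linarith
  rcases le_total b i with h | h
  · have : ∑ l ∈ Finset.Ico b i, Real.exp (-(c * ((i : ℝ) - l)))
        = ∑ s ∈ Finset.range (i - b), Real.exp (-(c * (s + 1 : ℕ))) := by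
      rw [Finset.sum_Ico_eq_sum_range, ← Finset.sum_range_reflect]
      refine Finset.sum_congr rfl fun s hs => ?_
      rw [Finset.mem_range] at hs
      have : ((b + (i - b - 1 - s) : ℕ) : ℝ) = i - (s + 1 : ℕ) := by
        rw [← Nat.cast_sub (by omega)]; congr 1; omega
      rw [this]; congr 3; ring
    rw [this]
    refine (key _).trans ?_
    have := Real.exp_pos (-(c * (i - b : ℕ)))
    calc _ ≤ c⁻¹ * 1 := by gcongr; linarith
      _ = _ := mul_one _
  · rw [Finset.Ico_eq_empty (by omega)]; simpa using hc.le

/-- One step of the layered recursion for the average number of high calls: the old calls and the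
decaying part of the profile contribute a multiple of `exp (-(i - a₀) / 4μ)`, the stationary part
contributes a multiple of `ε ^ d`. -/
theorem sum_profile_le {lam μ n A L ε ε' : ℝ} {d : ℕ} (hlam : 0 < lam) (hn : 0 < n) (hd : 2 ≤ d)
    (hμ : 0 < μ) (hμn : μ ≤ lam * n ^ 2 / 2) (hA : A = 32 * Real.exp 1 * lam) (hL : 1 ≤ L)
    (hAL : 4 * A * 6 ^ d ≤ L) (hε : 0 ≤ ε) (hε' : 8 * Real.exp 1 * lam * 12 ^ d * ε ^ d ≤ ε')
    {j₀ a₀ i : ℕ} (hj : j₀ ≤ a₀) (hi : a₀ ≤ i) :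
    ∑ l ∈ Finset.Ico j₀ i, (if a₀ ≤ l then 2 / n * (6 * (n * min L⁻¹
        (A * Real.exp (-((4 * μ)⁻¹ * ((l : ℝ) - a₀))) + ε)) / n) ^ d else 2 / n) *
        (Real.exp 1 * Real.exp (-((2 * μ)⁻¹ * ((i : ℝ) - l))))
      ≤ n * (A * Real.exp (-((4 * μ)⁻¹ * ((i : ℝ) - a₀))) + ε') / 4 := by
  have hA0 : 0 < A := by rw [hA]; positivity
  set E := Real.exp (-((4 * μ)⁻¹ * ((i : ℝ) - a₀))) with hE
  have hE0 : 0 < E := Real.exp_pos _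
  rw [← Finset.sum_Ico_consecutive _ hj hi]
  have hold : ∑ l ∈ Finset.Ico j₀ a₀, (if a₀ ≤ l then 2 / n * (6 * (n * min L⁻¹
        (A * Real.exp (-((4 * μ)⁻¹ * ((l : ℝ) - a₀))) + ε)) / n) ^ d else 2 / n) *
        (Real.exp 1 * Real.exp (-((2 * μ)⁻¹ * ((i : ℝ) - l))))
      ≤ 2 / n * Real.exp 1 * E * (2 * μ) := by
    have h1 : ∀ l ∈ Finset.Ico j₀ a₀, (if a₀ ≤ l then 2 / n * (6 * (n * min L⁻¹
        (A * Real.exp (-((4 * μ)⁻¹ * ((l : ℝ) - a₀))) + ε)) / n) ^ d else 2 / n) *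
        (Real.exp 1 * Real.exp (-((2 * μ)⁻¹ * ((i : ℝ) - l)))) ≤
        2 / n * Real.exp 1 * E * Real.exp (-((2 * μ)⁻¹ * ((a₀ : ℝ) - l))) := by
      intro l hl
      rw [Finset.mem_Ico] at hl
      have h2 : (a₀ : ℝ) ≤ i := by exact_mod_cast hi
      have h3 : (4 * μ)⁻¹ * ((i : ℝ) - a₀) ≤ (2 * μ)⁻¹ * ((i : ℝ) - a₀) := by
        refine mul_le_mul_of_nonneg_right ?_ (by linarith)
        exact inv_anti₀ (by linarith) (by linarith)
      have h4 : Real.exp (-((2 * μ)⁻¹ * ((i : ℝ) - l))) ≤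
          E * Real.exp (-((2 * μ)⁻¹ * ((a₀ : ℝ) - l))) := by
        rw [hE, ← Real.exp_add, Real.exp_le_exp]
        linarith
      rw [if_neg (by omega), mul_assoc (2 / n), mul_assoc (2 / n), mul_assoc (Real.exp 1)]
      gcongr
    refine (Finset.sum_le_sum h1).trans ?_
    rw [← Finset.mul_sum]
    have := sum_exp_neg_le (c := (2 * μ)⁻¹) (by positivity) j₀ a₀
    rw [inv_inv] at this
    gcongr
  have hnew : ∑ l ∈ Finset.Ico a₀ i, (if a₀ ≤ l then 2 / n * (6 * (n * min L⁻¹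
        (A * Real.exp (-((4 * μ)⁻¹ * ((l : ℝ) - a₀))) + ε)) / n) ^ d else 2 / n) *
        (Real.exp 1 * Real.exp (-((2 * μ)⁻¹ * ((i : ℝ) - l))))
      ≤ 2 / n * Real.exp 1 * 6 ^ d * (L⁻¹ * (2 * A) * E * (4 * μ) + 2 ^ d * ε ^ d * (2 * μ)) := by
    have h1 : ∀ l ∈ Finset.Ico a₀ i, (if a₀ ≤ l then 2 / n * (6 * (n * min L⁻¹
        (A * Real.exp (-((4 * μ)⁻¹ * ((l : ℝ) - a₀))) + ε)) / n) ^ d else 2 / n) *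
        (Real.exp 1 * Real.exp (-((2 * μ)⁻¹ * ((i : ℝ) - l)))) ≤
        2 / n * Real.exp 1 * 6 ^ d * (L⁻¹ * (2 * A) * E * Real.exp (-((4 * μ)⁻¹ * ((i : ℝ) - l)))
          + 2 ^ d * ε ^ d * Real.exp (-((2 * μ)⁻¹ * ((i : ℝ) - l)))) := by
      intro l hl
      rw [Finset.mem_Ico] at hl
      rw [if_pos hl.1]
      set x := A * Real.exp (-((4 * μ)⁻¹ * ((l : ℝ) - a₀))) with hx
      have hx0 : 0 < x := by positivity
      set y := min L⁻¹ (x + ε) with hy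
      have hy0 : 0 ≤ y := le_min (by positivity) (by positivity)
      have hyd : y ^ d ≤ L⁻¹ * (2 * x) + 2 ^ d * ε ^ d := by
        rcases le_total ε x with h | h
        · obtain ⟨m, rfl⟩ : ∃ m, d = m + 2 := ⟨d - 2, by omega⟩
          have h2 : y ≤ 1 := (min_le_left _ _).trans (inv_le_one_of_one_le₀ hL)
          calc y ^ (m + 2) = y ^ m * (y * y) := by ring
            _ ≤ 1 * (L⁻¹ * (2 * x)) := by
                gcongr
                · exact pow_le_one₀ hy0 h2
                · exact min_le_left _ _
                · exact (min_le_right _ _).trans (by linarith)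
            _ ≤ _ := by rw [one_mul]; exact le_add_of_nonneg_right (by positivity)
        · calc y ^ d ≤ (2 * ε) ^ d := by
                gcongr
                exact (min_le_right _ _).trans (by linarith)
            _ = 2 ^ d * ε ^ d := mul_pow _ _ _
            _ ≤ _ := le_add_of_nonneg_left (by positivity)
      have h3 : 6 * (n * y) / n = 6 * y := by field_simp
      have h4 : E * Real.exp (-((4 * μ)⁻¹ * ((i : ℝ) - l))) * A =
          x * Real.exp (-((2 * μ)⁻¹ * ((i : ℝ) - l))) := by
        rw [hE, hx, ← Real.exp_add, mul_assoc, ← Real.exp_add, mul_comm]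
        congr 2
        have : (2 * μ)⁻¹ = 2 * (4 * μ)⁻¹ := by field_simp; norm_num
        rw [this]; ring
      rw [h3, mul_pow]
      calc 2 / n * (6 ^ d * y ^ d) * (Real.exp 1 * Real.exp (-((2 * μ)⁻¹ * ((i : ℝ) - l))))
          ≤ 2 / n * (6 ^ d * (L⁻¹ * (2 * x) + 2 ^ d * ε ^ d)) *
            (Real.exp 1 * Real.exp (-((2 * μ)⁻¹ * ((i : ℝ) - l)))) := by gcongr
        _ = 2 / n * Real.exp 1 * 6 ^ d * (L⁻¹ * 2 * (x * Real.exp (-((2 * μ)⁻¹ * ((i : ℝ) - l))))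
          + 2 ^ d * ε ^ d * Real.exp (-((2 * μ)⁻¹ * ((i : ℝ) - l)))) := by ring
        _ = _ := by rw [← h4]; ring
    refine (Finset.sum_le_sum h1).trans ?_
    rw [← Finset.mul_sum, Finset.sum_add_distrib, ← Finset.mul_sum, ← Finset.mul_sum]
    have h2 := sum_exp_neg_le (c := (2 * μ)⁻¹) (by positivity) a₀ i
    have h4 := sum_exp_neg_le (c := (4 * μ)⁻¹) (by positivity) a₀ i
    rw [inv_inv] at h2 h4
    gcongr
  have hμ' : 4 * μ * Real.exp 1 / n ≤ 2 * Real.exp 1 * lam * n := by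
    rw [div_le_iff₀ hn]
    calc 4 * μ * Real.exp 1 ≤ 4 * (lam * n ^ 2 / 2) * Real.exp 1 := by gcongr
      _ = _ := by ring
  have h12 : (6 : ℝ) ^ d * 2 ^ d = 12 ^ d := by rw [← mul_pow]; norm_num
  calc _ ≤ 2 / n * Real.exp 1 * E * (2 * μ) + 2 / n * Real.exp 1 * 6 ^ d *
        (L⁻¹ * (2 * A) * E * (4 * μ) + 2 ^ d * ε ^ d * (2 * μ)) := add_le_add hold hnew
    _ = 4 * μ * Real.exp 1 / n * (E * (1 + 4 * A * 6 ^ d * L⁻¹) + 6 ^ d * 2 ^ d * ε ^ d) := by ring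
    _ ≤ 2 * Real.exp 1 * lam * n * (E * 4 + 12 ^ d * ε ^ d) := by
        rw [h12]
        gcongr
        have : 4 * A * 6 ^ d * L⁻¹ ≤ 1 := by
          rw [mul_inv_le_iff₀ (by linarith)]; linarith
        linarith
    _ = n * (A * E + 8 * Real.exp 1 * lam * 12 ^ d * ε ^ d) / 4 := by rw [hA]; ring
    _ ≤ _ := by gcongr

namespace Evolution

variable {n d : ℕ} {Ω : Type u}

open Classical in
/-- The calls of `highCalls`, provided that the number of links of load at least `k` at any node is
at most `X l`; this proviso is imposed only for calls that do not arrive before the call `a₀`. -/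
noncomputable def cappedCalls (S : Evolution n d Ω) (X : ℕ → ℝ) (a₀ k l : ℕ) (ω : Ω) (v : Fin n) :
    Finset (Call n d) :=
  if a₀ ≤ l → ∀ u, ((S.loadedLinks k l ω u).card : ℝ) ≤ X l then S.highCalls k l ω v else ∅

/-- The call `l` is one of `cappedCalls` and is still in progress when the call `i` arrives. -/
def highEvent (S : Evolution n d Ω) (X : ℕ → ℝ) (a₀ k i : ℕ) (v : Fin n) (l : ℕ) : Set Ω :=
  {ω | S.call l ω ∈ S.cappedCalls X a₀ k l ω v ∧ S.arrival i ω - S.arrival l ω ≤ S.dur l ω}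

theorem mem_highCalls {S : Evolution n d Ω} {ω : Ω} {k l : ℕ} {v : Fin n} {q : Call n d} :
    q ∈ S.highCalls k l ω v ↔
      v ∈ q.ends ∧ ∀ i, ∃ u ∈ q.ends, k ≤ S.load l ω u (q.cand i) := by
  unfold highCalls
  rw [Finset.mem_filter]
  simp

theorem mem_loadedLinks {S : Evolution n d Ω} {ω : Ω} {k i : ℕ} {v w : Fin n} :
    w ∈ S.loadedLinks k i ω v ↔ k ≤ S.load i ω v w := by
  unfold loadedLinks
  rw [Finset.mem_filter]
  simp

/-- As long as the caps `X` are respected, the calls of height at least `k` in progress are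
occurrences of `highEvent`, which has a controlled conditional probability. -/
theorem heightCount_le_occurrences {S : Evolution n d Ω} {ω : Ω} {X : ℕ → ℝ} {j₀ a₀ k i : ℕ}
    (v : Fin n) (hgap : ∀ j, 0 ≤ S.gap j ω)
    (hbal : ∀ l w, v ∈ (S.call l ω).ends → S.via l ω = some w → k ≤ S.load l ω v w →
      S.call l ω ∈ S.highCalls k l ω v)
    (hold : ∀ l < j₀, S.arrival l ω + S.dur l ω < S.arrival a₀ ω) (hi : a₀ ≤ i)
    (hX : ∀ l, a₀ ≤ l → l < i → ∀ u, ((S.loadedLinks k l ω u).card : ℝ) ≤ X l) :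
    S.heightCount k i ω v ≤ occurrences (S.highEvent X a₀ k i v) j₀ i ω := by
  classical
  unfold heightCount occurrences
  refine Finset.card_le_card fun l hl => ?_
  rw [Finset.mem_filter, Finset.mem_range] at hl
  obtain ⟨hli, hv, ⟨w, hw, hk⟩, hin⟩ := hl
  have hin' : S.arrival i ω ≤ S.arrival l ω + S.dur l ω := hin
  rw [Finset.mem_filter, Finset.mem_Ico]
  refine ⟨⟨?_, hli⟩, ?_, by linarith⟩
  · by_contra hlt
    have h1 := hold l (by omega)
    have h2 : S.arrival a₀ ω ≤ S.arrival i ω := arrival_mono hgap hi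
    linarith
  · unfold cappedCalls
    rw [if_pos fun ha => hX l ha hli]
    exact hbal l w hv hw hk

theorem loadedLinks_anti {S : Evolution n d Ω} {ω : Ω} {k k' i : ℕ} (h : k ≤ k') (v : Fin n) :
    (S.loadedLinks k' i ω v).card ≤ (S.loadedLinks k i ω v).card := by
  classical
  refine Finset.card_le_card fun w hw => ?_
  rw [mem_loadedLinks] at hw ⊢
  omega

/-- The deterministic part of the layered induction: if all the counts of high calls are small,
then no link at the ends of call `j` is saturated. -/
theorem via_ne_none_of_occurrences_lt {S : Evolution n d Ω} {ω : Ω} {D : ℕ} (hd : 0 < d)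
    (hgap : ∀ j, 0 ≤ S.gap j ω)
    (hbal : ∀ j, (∃ i, S.Available D j ω i ∧
        (∀ i', S.Available D j ω i' → S.maxLoad j ω i ≤ S.maxLoad j ω i') ∧
        S.via j ω = some ((S.call j ω).cand i)) ∨
      ((∀ i, ¬ S.Available D j ω i) ∧ S.via j ω = none))
    {j₀ a₀ j : ℕ} (haj : a₀ ≤ j)
    (hinit : ∀ p, ∀ k < S.init ω p, S.res p k ω < S.arrival a₀ ω)
    (hold : ∀ l < j₀, S.arrival l ω + S.dur l ω < S.arrival a₀ ω)
    {k₀ R h : ℕ} (hk₀ : 0 < k₀) (hD : k₀ + R + h ≤ D) {b y₀ : ℝ} {y : ℕ → ℕ → ℝ}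
    (hb : y₀ ≤ k₀ * b)
    {X : ℕ → ℕ → ℝ} (hX0 : ∀ i, X 0 i = b) (hXs : ∀ r i, X (r + 1) i = min b (y r i))
    (hbase : ∀ v, ∀ i ∈ Finset.Icc a₀ j,
      (occurrences (S.highEvent (fun _ => n) a₀ 0 i v) j₀ i ω : ℝ) < y₀)
    (hlevel : ∀ v, ∀ i ∈ Finset.Icc a₀ j, ∀ r < R,
      (occurrences (S.highEvent (X r) a₀ (k₀ + r) i v) j₀ i ω : ℝ) < y r i)
    (hlast : ∀ v, occurrences (S.highEvent (X R) a₀ (k₀ + R) j v) j₀ j ω < h) :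
    S.via j ω ≠ none := by
  classical
  have hvia : S.ViaOffEnds ω := by
    intro l w hw
    rcases hbal l with ⟨i, -, -, hi⟩ | ⟨-, hi⟩
    · rw [Option.some_injective _ (hw.symm.trans hi)]
      exact (S.call l ω).cand_notMem i
    · rw [hi] at hw; exact absurd hw (by simp)
  have hinit' : ∀ i, a₀ ≤ i → ∀ p, ∀ k < S.init ω p, S.res p k ω < S.arrival i ω :=
    fun i hi p k hk => (hinit p k hk).trans_le (arrival_mono hgap hi)
  have hhigh : ∀ (k : ℕ) (v : Fin n) (l : ℕ) (w : Fin n), v ∈ (S.call l ω).ends →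
      S.via l ω = some w → k ≤ S.load l ω v w → S.call l ω ∈ S.highCalls k l ω v :=
    fun k v l w hv hw hk => mem_highCalls_of_balanced (hbal l) hv hw hk
  have h0 : ∀ i ∈ Finset.Icc a₀ j, ∀ v, ((S.loadedLinks k₀ i ω v).card : ℝ) ≤ b := by
    intro i hi v
    have hi' := Finset.mem_Icc.1 hi
    have h1 := mul_card_loadedLinks_le_heightCount hvia (hinit' i hi'.1) k₀ v
    have h2 := heightCount_le_occurrences (X := fun _ => n) v hgap (hhigh 0 v) hold hi'.1
      (fun l _ _ u => by
        have := Finset.card_le_univ (S.loadedLinks 0 l ω u)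
        rw [Fintype.card_fin] at this
        exact_mod_cast this)
    have h3 := hbase v i hi
    have h4 : ((k₀ * (S.loadedLinks k₀ i ω v).card : ℕ) : ℝ) ≤
        (occurrences (S.highEvent (fun _ => n) a₀ 0 i v) j₀ i ω : ℝ) := by
      exact_mod_cast h1.trans h2
    push_cast at h4
    have h5 : (0 : ℝ) < k₀ := by exact_mod_cast hk₀
    exact le_of_mul_le_mul_left (by linarith) h5
  have hall : ∀ r ≤ R, ∀ i ∈ Finset.Icc a₀ j, ∀ v,
      ((S.loadedLinks (k₀ + r) i ω v).card : ℝ) ≤ X r i := by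
    intro r
    induction r with
    | zero => intro _ i hi v; rw [hX0]; exact h0 i hi v
    | succ r ih =>
      intro hr i hi v
      have hi' := Finset.mem_Icc.1 hi
      rw [hXs]
      refine le_min ?_ ?_
      · refine le_trans ?_ (h0 i hi v)
        exact Nat.cast_le.2 (loadedLinks_anti (Nat.le_add_right k₀ (r + 1)) v)
      · have h1 := card_loadedLinks_le_heightCount hgap hvia (hinit' i hi'.1) (k₀ + r) v
        have h2 := heightCount_le_occurrences (X := X r) v hgap (hhigh (k₀ + r) v) hold hi'.1
          (fun l hl hli u => ih (by omega) l (Finset.mem_Icc.2 ⟨hl, by omega⟩) u)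
        exact (Nat.cast_le.2 (h1.trans h2)).trans (hlevel v i hi r (by omega)).le
  intro hnone
  have hunav : ∀ i, ¬ S.Available D j ω i := by
    rcases hbal j with ⟨i, -, -, hi⟩ | ⟨hi, -⟩
    · rw [hnone] at hi; exact absurd hi (by simp)
    · exact hi
  have hu := hunav ⟨0, hd⟩
  unfold Available at hu
  push Not at hu
  obtain ⟨v, -, hv⟩ := hu
  have h1 := le_heightCount_of_le_load hgap hvia (hinit' j haj) (hD.trans hv)
  have h2 := heightCount_le_occurrences (X := X R) v hgap (hhigh (k₀ + R) v) hold haj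
    (fun l hl hli u => hall R le_rfl l (Finset.mem_Icc.2 ⟨hl, by omega⟩) u)
  exact absurd (h1.trans h2) (not_le.2 (hlast v))

variable [mΩ : MeasurableSpace Ω] {S : Evolution n d Ω} {lam : ℝ} {P : Measure Ω}

theorem IsModel.measurable_card_loadedLinks (hS : S.IsModel lam P) (k l : ℕ) (v : Fin n) :
    Measurable[S.past l] fun ω => (S.loadedLinks k l ω v).card := by
  classical
  have hm := fun w => hS.measurable_linkLoad (le_refl l) v w
  let _ := S.past l
  simp only [loadedLinks, Finset.card_filter]
  refine Finset.measurable_sum _ fun w _ => ?_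
  exact Measurable.ite (measurableSet_le measurable_const (hm w))
    measurable_const measurable_const

theorem IsModel.measurableSet_mem_highCalls (hS : S.IsModel lam P) (k l : ℕ) (v : Fin n)
    (q : Call n d) : MeasurableSet[S.past l] {ω | q ∈ S.highCalls k l ω v} := by
  classical
  have hm := fun u w => hS.measurable_linkLoad (le_refl l) u w
  let _ := S.past l
  have : {ω | q ∈ S.highCalls k l ω v} = {ω | v ∈ q.ends} ∩
      ⋂ i, ⋃ u, ({ω | u ∈ q.ends} ∩ {ω | k ≤ linkLoad (S.loadBefore l ω) u (q.cand i)}) := by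
    ext ω
    rw [Set.mem_ofPred_eq, mem_highCalls]
    simp [load]
  rw [this]
  refine (MeasurableSet.const _).inter (MeasurableSet.iInter fun i => MeasurableSet.iUnion fun u =>
    (MeasurableSet.const _).inter (measurableSet_le measurable_const (hm u _)))

theorem IsModel.measurableSet_mem_cappedCalls (hS : S.IsModel lam P) (X : ℕ → ℝ) (a₀ k l : ℕ)
    (v : Fin n) (q : Call n d) : MeasurableSet[S.past l] {ω | q ∈ S.cappedCalls X a₀ k l ω v} := by
  classical
  have h1 := hS.measurableSet_mem_highCalls k l v q
  have hm := fun u => hS.measurable_card_loadedLinks k l u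
  let _ := S.past l
  have : {ω | q ∈ S.cappedCalls X a₀ k l ω v} = ({ω | ¬ a₀ ≤ l} ∪
      ⋂ u, {ω | ((S.loadedLinks k l ω u).card : ℝ) ≤ X l}) ∩ {ω | q ∈ S.highCalls k l ω v} := by
    ext ω
    unfold cappedCalls
    simp only [Set.mem_ofPred_eq, Set.mem_inter_iff, Set.mem_union, Set.mem_iInter]
    by_cases h : a₀ ≤ l → ∀ u, ((S.loadedLinks k l ω u).card : ℝ) ≤ X l
    · rw [if_pos h]; tauto
    · rw [if_neg h]; simp only [Finset.notMem_empty, false_iff]; tauto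
  rw [this]
  refine MeasurableSet.inter ((MeasurableSet.const _).union (MeasurableSet.iInter fun u => ?_)) h1
  exact measurableSet_le (measurable_from_nat.comp (hm u)) measurable_const

theorem IsModel.measurableSet_highEvent (hS : S.IsModel lam P) (X : ℕ → ℝ) (a₀ k i : ℕ)
    (v : Fin n) (l : ℕ) : MeasurableSet[S.past (l + 1)] (S.highEvent X a₀ k i v l) := by
  have h1 := fun q => S.past_mono (Nat.le_succ l) _ (hS.measurableSet_mem_cappedCalls X a₀ k l v q)
  have h2 := fun q => S.measurableSet_call_past (Nat.lt_succ_self l) {q}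
  have h3 := S.measurable_arrival_past (l + 1) i
  have h4 := S.measurable_arrival_past (l + 1) l
  have h5 := S.measurable_dur_past (Nat.lt_succ_self l)
  let _ := S.past (l + 1)
  have : S.highEvent X a₀ k i v l = (⋃ q, {ω | q ∈ S.cappedCalls X a₀ k l ω v} ∩
      {ω | S.call l ω ∈ ({q} : Set (Call n d))}) ∩
      {ω | S.arrival i ω - S.arrival l ω ≤ S.dur l ω} := by
    ext ω; simp [highEvent]
  rw [this]
  exact (MeasurableSet.iUnion fun q => (h1 q).inter (h2 q)).inter
    (measurableSet_le (h3.sub h4) h5)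

variable [IsProbabilityMeasure P]

/-- Chernoff bound for the number of capped high calls in progress, on an event `A` about the gaps
on which the arrivals are not too dense. -/
theorem IsModel.prob_occurrences_highEvent_le (hS : S.IsModel lam P) (hn : 3 ≤ n)
    {X : ℕ → ℝ} {j₀ a₀ k i : ℕ} (hji : j₀ ≤ i) (v : Fin n) {A : Set Ω}
    (hA : MeasurableSet[S.past j₀] A) {c : ℝ}
    (hnice : ∀ ω ∈ A, ∀ l, j₀ ≤ l → l < i → c * ((i : ℝ) - l) - 1 ≤ S.arrival i ω - S.arrival l ω)
    {p : ℕ → ℝ} (hp0 : ∀ l, 0 ≤ p l) (hp : ∀ l, j₀ ≤ l → l < i →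
      2 / n ≤ p l ∨ (a₀ ≤ l ∧ 2 / n * (6 * X l / n) ^ d ≤ p l)) {u : ℝ} (hu : 1 ≤ u) (h : ℕ) :
    P (A ∩ {ω | h ≤ occurrences (S.highEvent X a₀ k i v) j₀ i ω}) ≤
      ENNReal.ofReal (u⁻¹ ^ h * Real.exp ((u - 1) * ∑ l ∈ Finset.Ico j₀ i,
        p l * (Real.exp 1 * Real.exp (-(c * ((i : ℝ) - l)))))) * P A := by
  classical
  refine chernoff_upper S.past_mono hS.past_le (hS.measurableSet_highEvent X a₀ k i v) hji hA
    (fun l => mul_nonneg (hp0 l) (by positivity)) (fun l hl hli Z hZ => ?_) hu h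
  refine hS.setLIntegral_call_dur_le l (hS.measurableSet_mem_cappedCalls X a₀ k l v)
    ((S.measurable_arrival_past l i).sub (S.measurable_arrival_past l l))
    (S.past_mono hl _ hA) (fun ω hω => ?_) (fun ω hω => ?_) (hp0 l) hZ
  · unfold cappedCalls
    have hmem : ∀ q ∈ S.highCalls k l ω v, v ∈ q.ends := fun q hq => by
      exact (mem_highCalls.1 hq).1
    split_ifs with hc
    · rcases hp l hl hli with h1 | ⟨h1, h2⟩
      · exact (card_mul_callMass_le_of_mem hn v hmem).trans h1
      · refine (card_mul_callMass_le hn v (fun u => S.loadedLinks k l ω u) (hc h1) hmem ?_).trans h2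
        intro q hq i'
        obtain ⟨u, hu, hku⟩ := (mem_highCalls.1 hq).2 i'
        exact ⟨u, hu, mem_loadedLinks.2 hku⟩
    · simpa using hp0 l
  · rw [← Real.exp_add, Real.exp_le_exp]
    have h1 := hnice ω hω l hl hli
    have h2 := le_max_left (S.arrival i ω - S.arrival l ω) 0
    change -max (S.arrival i ω - S.arrival l ω) 0 ≤ _
    linarith

end Evolution

theorem rate_le {lam : ℝ} (hlam : 0 < lam) (n : ℕ) : rate lam n ≤ lam * (n : ℝ) ^ 2 / 2 := by
  unfold rate
  rw [Nat.cast_choose_two]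
  have : (0 : ℝ) ≤ n := Nat.cast_nonneg n
  nlinarith

theorem rate_pos {lam : ℝ} (hlam : 0 < lam) {n : ℕ} (hn : 3 ≤ n) : 0 < rate lam n := by
  unfold rate
  have : 0 < n.choose 2 := Nat.choose_pos (by omega)
  positivity

/-- The bound of `chernoff_upper` with `u = 2` for at least `y` occurrences, if at most `y / 4` are
expected. -/
theorem two_inv_pow_mul_exp_le {M y : ℝ} {h : ℕ} (hM : M ≤ y / 4) (hh : y ≤ h) :
    (2 : ℝ)⁻¹ ^ h * Real.exp ((2 - 1) * M) ≤ Real.exp (-(y / 3)) := by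
  have h2 : (2 : ℝ)⁻¹ = Real.exp (-Real.log 2) := by
    rw [Real.exp_neg, Real.exp_log (by norm_num)]
  rw [h2, ← Real.exp_nat_mul, ← Real.exp_add, Real.exp_le_exp]
  have h3 := Real.log_two_gt_d9
  nlinarith

namespace Evolution

variable {n d : ℕ} {Ω : Type u} [mΩ : MeasurableSpace Ω] {S : Evolution n d Ω} {lam : ℝ}
  {P : Measure Ω} [IsProbabilityMeasure P]

/-- The layered induction: on an event about the gaps on which the arrivals with indices from `j₀`
to `j` are not too dense, and if all calls that arrived before `j₀` have ended when call `a₀`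
arrives, the call `j` is unlikely to be lost. -/
theorem IsModel.prob_lost_inter_le (hS : S.IsModel lam P) (hlam : 0 < lam) (hn : 3 ≤ n)
    (hd : 2 ≤ d) {D : ℕ} (hbal : S.IsBDAR D P) {j₀ a₀ j : ℕ} (hja : j₀ ≤ a₀) (haj : a₀ ≤ j)
    {A : Set Ω} (hA : MeasurableSet[S.past j₀] A)
    (hnice : ∀ ω ∈ A, ∀ l i, j₀ ≤ l → l < i → i ≤ j →
      (2 * rate lam n)⁻¹ * ((i : ℝ) - l) - 1 ≤ S.arrival i ω - S.arrival l ω)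
    {α L : ℝ} (hα : α = 32 * Real.exp 1 * lam) (hL : 1 ≤ L) (hαL : 4 * α * 6 ^ d ≤ L)
    {ε : ℕ → ℝ} {εmin : ℝ} (hε0 : ε 0 = L⁻¹) (hmin0 : 0 ≤ εmin) (hmin : ∀ r, εmin ≤ ε r)
    (hεs : ∀ r, 8 * Real.exp 1 * lam * 12 ^ d * ε r ^ d ≤ ε (r + 1))
    {k₀ R h : ℕ} (hk₀ : 8 * Real.exp 1 * lam * L ≤ k₀) (hD : k₀ + R + h ≤ D)
    {u : ℝ} (hu : 1 ≤ u) :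
    P (A ∩ {ω | S.via j ω = none} ∩
        {ω | ∀ p, ∀ k < S.init ω p, S.res p k ω < S.arrival a₀ ω} ∩
        {ω | ∀ l < j₀, S.arrival l ω + S.dur l ω < S.arrival a₀ ω})
      ≤ ENNReal.ofReal (n * ((j + 1 : ℕ) - a₀ : ℕ) *
          (Real.exp (-(8 * Real.exp 1 * lam * n / 3)) + R * Real.exp (-(n * εmin / 3)))
        + n * (u⁻¹ ^ h * Real.exp ((u - 1) * (n * (α * Real.exp (-((4 * rate lam n)⁻¹ *
            ((j : ℝ) - a₀))) + 8 * Real.exp 1 * lam * 12 ^ d * ε R ^ d) / 4)))) * P A := by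
  set μ := rate lam n with hμdef
  have hμ : 0 < μ := rate_pos hlam hn
  have hn0 : (0 : ℝ) < n := by exact_mod_cast (by omega : 0 < n)
  have hα0 : 0 < α := by rw [hα]; positivity
  have hε : ∀ r, 0 ≤ ε r := fun r => hmin0.trans (hmin r)
  set z : ℕ → ℕ → ℝ := fun r i => α * Real.exp (-((4 * μ)⁻¹ * ((i : ℝ) - a₀))) + ε r with hz
  set X : ℕ → ℕ → ℝ := fun r i => n * min L⁻¹ (z r i) with hX
  have hX0 : ∀ r i, 0 ≤ X r i := fun r i => mul_nonneg hn0.le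
    (le_min (by positivity) (add_nonneg (by positivity) (hε r)))
  set y₀ : ℝ := 8 * Real.exp 1 * lam * n with hy₀
  have hy₀0 : 0 ≤ y₀ := by positivity
  -- the exceptional events
  set Bbase : Fin n → ℕ → Set Ω := fun v i =>
    A ∩ {ω | ⌈y₀⌉₊ ≤ occurrences (S.highEvent (fun _ => n) a₀ 0 i v) j₀ i ω} with hBbase
  set Blevel : Fin n → ℕ → ℕ → Set Ω := fun v i r =>
    A ∩ {ω | ⌈(n : ℝ) * z (r + 1) i⌉₊ ≤
      occurrences (S.highEvent (X r) a₀ (k₀ + r) i v) j₀ i ω} with hBlevel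
  set Blast : Fin n → Set Ω := fun v =>
    A ∩ {ω | h ≤ occurrences (S.highEvent (X R) a₀ (k₀ + R) j v) j₀ j ω} with hBlast
  have hbase : ∀ v, ∀ i ∈ Finset.Icc a₀ j,
      P (Bbase v i) ≤ ENNReal.ofReal (Real.exp (-(y₀ / 3))) * P A := by
    intro v i hi
    rw [Finset.mem_Icc] at hi
    refine (hS.prob_occurrences_highEvent_le hn (hja.trans hi.1) v hA
      (fun ω hω l hl hli => hnice ω hω l i hl hli hi.2) (p := fun _ => 2 / n)
      (fun _ => by positivity) (fun _ _ _ => Or.inl le_rfl) one_le_two _).trans ?_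
    refine mul_le_mul_left (ENNReal.ofReal_le_ofReal ?_) _
    refine two_inv_pow_mul_exp_le ?_ (Nat.le_ceil _)
    rw [← Finset.mul_sum, ← Finset.mul_sum]
    have h1 := sum_exp_neg_le (c := (2 * μ)⁻¹) (by positivity) j₀ i
    rw [inv_inv] at h1
    calc _ ≤ 2 / (n : ℝ) * (Real.exp 1 * (2 * μ)) := by gcongr
      _ ≤ 2 / (n : ℝ) * (Real.exp 1 * (2 * (lam * (n : ℝ) ^ 2 / 2))) := by
          gcongr; exact rate_le hlam n
      _ = y₀ / 4 := by rw [hy₀]; field_simp; ring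
  have hsum : ∀ r ε', 8 * Real.exp 1 * lam * 12 ^ d * ε r ^ d ≤ ε' → ∀ i, a₀ ≤ i →
      ∑ l ∈ Finset.Ico j₀ i, (if a₀ ≤ l then 2 / (n : ℝ) * (6 * X r l / n) ^ d else 2 / n) *
        (Real.exp 1 * Real.exp (-((2 * μ)⁻¹ * ((i : ℝ) - l)))) ≤
      n * (α * Real.exp (-((4 * μ)⁻¹ * ((i : ℝ) - a₀))) + ε') / 4 := fun r ε' hε' i hi =>
    sum_profile_le hlam hn0 hd hμ (rate_le hlam n) hα hL hαL (hε r) hε' hja hi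
  have hp : ∀ r l, 0 ≤ if a₀ ≤ l then 2 / (n : ℝ) * (6 * X r l / n) ^ d else 2 / n := by
    intro r l
    have := hX0 r l
    split_ifs <;> positivity
  have hp' : ∀ r l, 2 / (n : ℝ) ≤ (if a₀ ≤ l then 2 / (n : ℝ) * (6 * X r l / n) ^ d else 2 / n) ∨
      (a₀ ≤ l ∧ 2 / (n : ℝ) * (6 * X r l / n) ^ d ≤
        if a₀ ≤ l then 2 / (n : ℝ) * (6 * X r l / n) ^ d else 2 / n) := by
    intro r l
    split_ifs with hl
    · exact Or.inr ⟨hl, le_rfl⟩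
    · exact Or.inl le_rfl
  have hlevel : ∀ v, ∀ i ∈ Finset.Icc a₀ j, ∀ r,
      P (Blevel v i r) ≤ ENNReal.ofReal (Real.exp (-(n * εmin / 3))) * P A := by
    intro v i hi r
    rw [Finset.mem_Icc] at hi
    refine (hS.prob_occurrences_highEvent_le hn (hja.trans hi.1) v hA
      (fun ω hω l hl hli => hnice ω hω l i hl hli hi.2) (hp r)
      (fun l _ _ => hp' r l) one_le_two _).trans ?_
    refine mul_le_mul_left (ENNReal.ofReal_le_ofReal ?_) _
    have hz0 : εmin ≤ z (r + 1) i := (hmin (r + 1)).trans (le_add_of_nonneg_left (by positivity))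
    refine (two_inv_pow_mul_exp_le (y := n * z (r + 1) i) (hsum r _ (hεs r) i hi.1)
      (Nat.le_ceil _)).trans ?_
    gcongr
  have hlast : ∀ v, P (Blast v) ≤ ENNReal.ofReal (u⁻¹ ^ h * Real.exp ((u - 1) *
      (n * (α * Real.exp (-((4 * μ)⁻¹ * ((j : ℝ) - a₀))) +
        8 * Real.exp 1 * lam * 12 ^ d * ε R ^ d) / 4))) * P A := by
    intro v
    refine (hS.prob_occurrences_highEvent_le hn (hja.trans haj) v hA
      (fun ω hω l hl hli => hnice ω hω l j hl hli le_rfl) (hp R)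
      (fun l _ _ => hp' R l) hu _).trans ?_
    refine mul_le_mul_left (ENNReal.ofReal_le_ofReal ?_) _
    have := hsum R _ le_rfl j haj
    have hu1 : 0 ≤ u - 1 := by linarith
    gcongr
  have hsub : (A ∩ {ω | S.via j ω = none} ∩
        {ω | ∀ p, ∀ k < S.init ω p, S.res p k ω < S.arrival a₀ ω} ∩
        {ω | ∀ l < j₀, S.arrival l ω + S.dur l ω < S.arrival a₀ ω} : Set Ω) ≤ᵐ[P]
      ((⋃ v, ⋃ i ∈ Finset.Icc a₀ j, (Bbase v i ∪ ⋃ r ∈ Finset.range R, Blevel v i r)) ∪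
        ⋃ v, Blast v : Set Ω) := by
    filter_upwards [hS.ae_gap_nonneg, hbal] with ω hgap hb
    rintro ⟨⟨⟨hωA, hnone⟩, hinit⟩, hold⟩
    by_contra hcon
    have hcon' : ω ∉ ((⋃ v, ⋃ i ∈ Finset.Icc a₀ j,
        (Bbase v i ∪ ⋃ r ∈ Finset.range R, Blevel v i r)) ∪ ⋃ v, Blast v : Set Ω) := hcon
    simp only [Set.mem_union, Set.mem_iUnion, not_or, not_exists] at hcon'
    obtain ⟨hc1, hc2⟩ := hcon'
    have hk₀pos : 0 < k₀ := by
      have : (0 : ℝ) < k₀ := lt_of_lt_of_le (by positivity) hk₀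
      exact_mod_cast this
    refine via_ne_none_of_occurrences_lt (D := D) (by omega) hgap hb haj hinit hold
      hk₀pos hD (b := n * L⁻¹) (y₀ := y₀) (y := fun r i => n * z (r + 1) i) ?_
      (X := X) ?_ ?_ ?_ ?_ ?_ hnone
    · have h1 : 8 * Real.exp 1 * lam * L * (n * L⁻¹) ≤ k₀ * (n * L⁻¹) :=
        mul_le_mul_of_nonneg_right hk₀ (by positivity)
      refine le_trans (le_of_eq ?_) h1
      rw [hy₀]; field_simp
    · intro i
      simp only [hX, hz, hε0]
      rw [min_eq_left (le_add_of_nonneg_left (by positivity))]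
    · intro r i
      exact (mul_min_of_nonneg _ _ hn0.le)
    · intro v i hi
      have h1 := (hc1 v i hi).1
      by_contra hlt
      exact h1 ⟨hωA, Nat.ceil_le.2 (not_lt.1 hlt)⟩
    · intro v i hi r hr
      have h1 := (hc1 v i hi).2 r (Finset.mem_range.2 hr)
      by_contra hlt
      exact h1 ⟨hωA, Nat.ceil_le.2 (not_lt.1 hlt)⟩
    · intro v
      by_contra hlt
      exact hc2 v ⟨hωA, not_lt.1 hlt⟩
  refine (measure_mono_ae hsub).trans ?_
  set δ₀ := Real.exp (-(y₀ / 3)) with hδ₀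
  set δ₁ := Real.exp (-(n * εmin / 3)) with hδ₁
  set δ₂ := u⁻¹ ^ h * Real.exp ((u - 1) * (n * (α * Real.exp (-((4 * μ)⁻¹ *
            ((j : ℝ) - a₀))) + 8 * Real.exp 1 * lam * 12 ^ d * ε R ^ d) / 4)) with hδ₂
  have hδ₂0 : 0 ≤ δ₂ := by positivity
  have hδ₀0 : 0 ≤ δ₀ := (Real.exp_pos _).le
  have hδ₁0 : 0 ≤ δ₁ := (Real.exp_pos _).le
  clear_value δ₀ δ₁ δ₂
  calc _ ≤ P (⋃ v, ⋃ i ∈ Finset.Icc a₀ j, (Bbase v i ∪ ⋃ r ∈ Finset.range R, Blevel v i r)) +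
        P (⋃ v, Blast v) := measure_union_le _ _
    _ ≤ ∑ v : Fin n, ∑ i ∈ Finset.Icc a₀ j, (ENNReal.ofReal δ₀ * P A +
          ∑ r ∈ Finset.range R, ENNReal.ofReal δ₁ * P A) +
        ∑ v : Fin n, ENNReal.ofReal δ₂ * P A := by
        refine add_le_add ?_ ?_
        · refine (measure_iUnion_fintype_le _ _).trans (Finset.sum_le_sum fun v _ => ?_)
          refine (measure_biUnion_finset_le _ _).trans (Finset.sum_le_sum fun i hi => ?_)
          refine (measure_union_le _ _).trans (add_le_add (hbase v i hi) ?_)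
          exact (measure_biUnion_finset_le _ _).trans
            (Finset.sum_le_sum fun r _ => hlevel v i hi r)
        · exact (measure_iUnion_fintype_le _ _).trans (Finset.sum_le_sum fun v _ => hlast v)
    _ = _ := by
        simp only [Finset.sum_const, Finset.card_univ, Fintype.card_fin, Nat.card_Icc,
          Finset.card_range, nsmul_eq_mul]
        rw [ENNReal.ofReal_add (by positivity) (by positivity),
          ENNReal.ofReal_mul (by positivity), ENNReal.ofReal_mul (by positivity),
          ENNReal.ofReal_mul (by positivity), ENNReal.ofReal_add (by positivity) (by positivity),
          ENNReal.ofReal_mul (by positivity)]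
        simp only [ENNReal.ofReal_natCast]
        ring

end Evolution

/-! ### Exceptional events for the window before an arrival -/

/-- Summation over all pairs `l < j` by their difference `r + 1`. -/
theorem tsum_sum_range_eq (g : ℕ → ℕ → ℝ≥0∞) :
    ∑' j, ∑ l ∈ Finset.range j, g j l = ∑' r, ∑' l, g (l + (r + 1)) l := by
  have h1 : ∀ j, ∑ l ∈ Finset.range j, g j l = ∑' l, if l < j then g j l else 0 := by
    intro j
    rw [tsum_eq_sum (s := Finset.range j)]
    · exact Finset.sum_congr rfl fun l hl => by rw [if_pos (Finset.mem_range.1 hl)]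
    · intro l hl; rw [if_neg (by simpa using hl)]
  have h2 : ∀ l, ∑' j, (if l < j then g j l else 0) = ∑' r, g (l + (r + 1)) l := by
    intro l
    rw [← Summable.sum_add_tsum_nat_add' (f := fun j => if l < j then g j l else 0)
      (k := l + 1) ENNReal.summable, Finset.sum_eq_zero, zero_add]
    · refine tsum_congr fun r => ?_
      rw [if_pos (by omega), show r + (l + 1) = l + (r + 1) by ring]
    · intro j hj
      rw [if_neg (by simp at hj; omega)]
  calc _ = ∑' j, ∑' l, (if l < j then g j l else 0) := tsum_congr h1
    _ = ∑' l, ∑' j, (if l < j then g j l else 0) := ENNReal.tsum_comm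
    _ = ∑' l, ∑' r, g (l + (r + 1)) l := tsum_congr h2
    _ = _ := ENNReal.tsum_comm

theorem tsum_indicator_lt {Ω : Type u} (N : Ω → ℕ) (ω : Ω) :
    ∑' k, {ω | k < N ω}.indicator (1 : Ω → ℝ≥0∞) ω = (N ω : ℝ≥0∞) := by
  rw [tsum_eq_sum (s := Finset.range (N ω))]
  · rw [Finset.sum_congr rfl (g := fun _ => (1 : ℝ≥0∞))]
    · simp
    · intro k hk
      simp [Set.indicator, Finset.mem_range.1 hk]
  · intro k hk
    have : ¬ k < N ω := by simpa using hk
    simp [Set.indicator, this]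

namespace Evolution

variable {n d : ℕ} {Ω : Type u} [mΩ : MeasurableSpace Ω] {S : Evolution n d Ω} {lam : ℝ}
  {P : Measure Ω}

/-- The arrivals `j, …, J` are not too dense: any two of them, with indices `l < i`, are at least
the time `c * (i - l) - 1` apart. -/
def sparse (S : Evolution n d Ω) (c : ℝ) (j J : ℕ) : Set Ω :=
  {ω | ∀ l i, j ≤ l → l < i → i ≤ J → c * ((i : ℝ) - l) - 1 ≤ S.arrival i ω - S.arrival l ω}

theorem measurableSet_sparse_past {Ω : Type u} (S : Evolution n d Ω) (c : ℝ) (j J l : ℕ) :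
    MeasurableSet[S.past l] (S.sparse c j J) := by
  have hm := fun i => S.measurable_arrival_past l i
  let _ := S.past l
  unfold sparse
  simp only [Set.ofPred_forall]
  exact MeasurableSet.iInter fun a => MeasurableSet.iInter fun i => MeasurableSet.iInter fun _ =>
    MeasurableSet.iInter fun _ => MeasurableSet.iInter fun _ =>
    measurableSet_le measurable_const ((hm i).sub (hm a))

/-- Few arrivals are so early that the window before them is incomplete. -/
theorem IsModel.sum_short_le (hS : S.IsModel lam P) (hμ : 1 < rate lam n) (a b : ℝ) (W : ℕ) :
    ∑ i ∈ Finset.range W, P {ω | S.arrival i ω ∈ Set.Icc a b} ≤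
      ENNReal.ofReal (W * (rate lam n / (rate lam n - 1)) ^ W * Real.exp (-a)) := by
  set μ := rate lam n with hμdef
  have hμ0 : 0 < μ := by linarith
  have hμ1 : 0 < μ - 1 := by linarith
  have h1 : ∀ i ∈ Finset.range W, P {ω | S.arrival i ω ∈ Set.Icc a b} ≤
      ENNReal.ofReal ((μ / (μ - 1)) ^ W * Real.exp (-a)) := by
    intro i hi
    have hm := hS.measurable_arrival i
    have h2 := hS.lintegral_exp_arrival hμ0 (θ := -1) (by linarith) i
    have h3 : P {ω | S.arrival i ω ∈ Set.Icc a b} ≤ ENNReal.ofReal (Real.exp (-a)) *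
        ∫⁻ ω, ENNReal.ofReal (Real.exp (-(-1 * S.arrival i ω))) ∂P := by
      rw [← lintegral_const_mul _ (by fun_prop),
        ← lintegral_indicator_one (hS.measurableSet_arrival_mem i a b)]
      refine lintegral_mono fun ω => ?_
      by_cases hω : ω ∈ {ω | S.arrival i ω ∈ Set.Icc a b}
      · rw [Set.indicator_of_mem hω, Pi.one_apply, ← ENNReal.ofReal_mul (Real.exp_pos _).le,
          ← Real.exp_add, ← ENNReal.ofReal_one]
        apply ENNReal.ofReal_le_ofReal
        rw [Real.one_le_exp_iff]
        linarith [hω.1]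
      · rw [Set.indicator_of_notMem hω]; exact zero_le
    refine h3.trans ?_
    rw [h2, ← ENNReal.ofReal_mul (Real.exp_pos _).le]
    apply ENNReal.ofReal_le_ofReal
    rw [mul_comm, ← sub_eq_add_neg]
    gcongr
    · rw [le_div_iff₀ hμ1]; linarith
    · rw [Finset.mem_range] at hi; omega
  refine (Finset.sum_le_sum h1).trans ?_
  rw [Finset.sum_const, Finset.card_range, nsmul_eq_mul, ← ENNReal.ofReal_natCast,
    ← ENNReal.ofReal_mul (by positivity)]
  apply ENNReal.ofReal_le_ofReal
  rw [mul_assoc]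

variable [IsProbabilityMeasure P]

/-- It is unlikely that the arrivals of a window are more than twice as dense as they should be. -/
theorem IsModel.tsum_not_sparse_le (hS : S.IsModel lam P) (hμ : 0 < rate lam n) {ℓ : ℝ}
    (hℓ : 0 < ℓ) (a : ℝ) (W : ℕ) :
    ∑' j, P ({ω | S.arrival (j + W) ω ∈ Set.Icc a (a + ℓ)} \
        S.sparse (2 * rate lam n)⁻¹ j (j + W))
      ≤ ENNReal.ofReal (Real.exp 1 * (rate lam n * ℓ + 1) *
        ((W + 1 : ℕ) ^ 2 * Real.exp (-rate lam n))) := by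
  set μ := rate lam n with hμdef
  set V := Real.exp 1 * (μ * ℓ + 1) with hV
  have hV0 : 0 ≤ V := by positivity
  set I : ℕ → Set Ω := fun j => {ω | S.arrival (j + W) ω ∈ Set.Icc a (a + ℓ)} with hI
  have hIm : ∀ j, MeasurableSet (I j) := fun j => hS.measurableSet_arrival_mem _ _ _
  set B : ℕ → ℕ → ℕ → Set Ω := fun x y j => I j ∩
    {ω | x < y ∧ S.arrival (j + y) ω - S.arrival (j + x) ω < (2 * μ)⁻¹ * ((y : ℝ) - x) - 1} with hB
  have hsub : ∀ j, I j \ S.sparse (2 * μ)⁻¹ j (j + W) ⊆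
      ⋃ x ∈ Finset.range (W + 1), ⋃ y ∈ Finset.range (W + 1), B x y j := by
    rintro j ω ⟨hω, hns⟩
    have hns' : ¬ ∀ l i, j ≤ l → l < i → i ≤ j + W →
      (2 * μ)⁻¹ * ((i : ℝ) - l) - 1 ≤ S.arrival i ω - S.arrival l ω := hns
    push Not at hns'
    obtain ⟨l, i, h1, h2, h3, h4⟩ := hns'
    obtain ⟨x, rfl⟩ := Nat.exists_eq_add_of_le h1
    obtain ⟨y, rfl⟩ := Nat.exists_eq_add_of_le (h1.trans h2.le)
    simp only [Set.mem_iUnion, Finset.mem_range]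
    refine ⟨x, by omega, y, by omega, hω, by omega, ?_⟩
    push_cast at h4
    have h5 : ((j : ℝ) + y) - (j + x) = y - x := by ring
    rwa [h5] at h4
  have hBle : ∀ x ∈ Finset.range (W + 1), ∀ y ∈ Finset.range (W + 1),
      ∑' j, P (B x y j) ≤ ENNReal.ofReal (V * Real.exp (-μ)) := by
    intro x hx y hy
    rw [Finset.mem_range] at hx hy
    rcases lt_or_ge x y with hxy | hxy
    swap
    · have : ∀ j, B x y j = ∅ := fun j => by
        ext ω; simp only [hB, Set.mem_inter_iff, Set.mem_ofPred_eq, Set.mem_empty_iff_false]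
        constructor
        · rintro ⟨-, h, -⟩; omega
        · exact False.elim
      simp [this]
    have h1 : ∀ j, P (B x y j) ≤ ENNReal.ofReal (Real.exp (((y : ℝ) - x) / 2 - μ)) *
        ∫⁻ ω in I j, ENNReal.ofReal (Real.exp (-(μ * (S.arrival (j + y) ω -
          S.arrival (j + x) ω)))) ∂P := by
      intro j
      have hm : Measurable fun ω => ENNReal.ofReal (Real.exp (-(μ * (S.arrival (j + y) ω -
          S.arrival (j + x) ω)))) := by
        have h1 := hS.measurable_arrival (j + y)
        have h2 := hS.measurable_arrival (j + x)
        fun_prop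
      have hBm : MeasurableSet (B x y j) := (hIm j).inter ((MeasurableSet.const _).inter
        (measurableSet_lt ((hS.measurable_arrival _).sub (hS.measurable_arrival _))
          measurable_const))
      rw [← lintegral_const_mul _ hm, ← lintegral_indicator_one hBm,
        ← lintegral_indicator (hIm j)]
      refine lintegral_mono fun ω => ?_
      by_cases hω : ω ∈ B x y j
      · rw [Set.indicator_of_mem hω, Set.indicator_of_mem hω.1, Pi.one_apply,
          ← ENNReal.ofReal_mul (Real.exp_pos _).le, ← Real.exp_add, ← ENNReal.ofReal_one]
        apply ENNReal.ofReal_le_ofReal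
        rw [Real.one_le_exp_iff]
        have h2 := hω.2.2
        have h3 : μ * (S.arrival (j + y) ω - S.arrival (j + x) ω) ≤
            μ * ((2 * μ)⁻¹ * ((y : ℝ) - x) - 1) := by gcongr
        have h4 : μ * ((2 * μ)⁻¹ * ((y : ℝ) - x) - 1) = ((y : ℝ) - x) / 2 - μ := by field_simp
        linarith
      · rw [Set.indicator_of_notMem hω]; exact zero_le
    refine (ENNReal.tsum_le_tsum h1).trans ?_
    rw [ENNReal.tsum_mul_left]
    have h2 := hS.tsum_lintegral_exp_window_le hμ hℓ (θ := μ) (by positivity) hxy.le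
      (by omega : y ≤ W) a
    refine (mul_le_mul_right h2 _).trans ?_
    rw [← ENNReal.ofReal_mul (Real.exp_pos _).le]
    apply ENNReal.ofReal_le_ofReal
    rw [← hμdef, ← hV]
    have h3 : Real.exp (((y : ℝ) - x) / 2 - μ) * (μ / (μ + μ)) ^ (y - x) ≤ Real.exp (-μ) := by
      have h4 : μ / (μ + μ) = Real.exp (-Real.log 2) := by
        rw [Real.exp_neg, Real.exp_log (by norm_num)]; field_simp; norm_num
      rw [h4, ← Real.exp_nat_mul, ← Real.exp_add, Real.exp_le_exp, Nat.cast_sub hxy.le]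
      have h5 := Real.log_two_gt_d9
      have h6 : (x : ℝ) < y := by exact_mod_cast hxy
      nlinarith
    calc _ = V * (Real.exp (((y : ℝ) - x) / 2 - μ) * (μ / (μ + μ)) ^ (y - x)) := by ring
      _ ≤ _ := by gcongr
  calc _ ≤ ∑' j, ∑ x ∈ Finset.range (W + 1), ∑ y ∈ Finset.range (W + 1), P (B x y j) := by
        refine ENNReal.tsum_le_tsum fun j => (measure_mono (hsub j)).trans ?_
        refine (measure_biUnion_finset_le _ _).trans (Finset.sum_le_sum fun x _ => ?_)
        exact measure_biUnion_finset_le _ _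
    _ = ∑ x ∈ Finset.range (W + 1), ∑ y ∈ Finset.range (W + 1), ∑' j, P (B x y j) := by
        rw [Summable.tsum_finsetSum fun _ _ => ENNReal.summable]
        exact Finset.sum_congr rfl fun _ _ => Summable.tsum_finsetSum fun _ _ => ENNReal.summable
    _ ≤ ∑ x ∈ Finset.range (W + 1), ∑ y ∈ Finset.range (W + 1),
          ENNReal.ofReal (V * Real.exp (-μ)) :=
        Finset.sum_le_sum fun x hx => Finset.sum_le_sum fun y hy => hBle x hx y hy
    _ = _ := by
        simp only [Finset.sum_const, Finset.card_range, nsmul_eq_mul]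
        rw [← ENNReal.ofReal_natCast, ← ENNReal.ofReal_mul (by positivity),
          ← ENNReal.ofReal_mul (by positivity)]
        congr 1
        ring

/-- It is unlikely that a call that arrived before the window is still in progress after `m`
further arrivals. -/
theorem IsModel.tsum_old_le (hS : S.IsModel lam P) (hμ : 0 < rate lam n) {ℓ : ℝ}
    (hℓ : 0 < ℓ) (a : ℝ) {m W : ℕ} (hm : m ≤ W) :
    ∑' j, P ({ω | S.arrival (j + W) ω ∈ Set.Icc a (a + ℓ)} \
        {ω | ∀ l < j, S.arrival l ω + S.dur l ω < S.arrival (j + m) ω})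
      ≤ ENNReal.ofReal (Real.exp 1 * (rate lam n * ℓ + 1) *
        (rate lam n * (rate lam n / (rate lam n + 1)) ^ m)) := by
  set μ := rate lam n with hμdef
  set V := Real.exp 1 * (μ * ℓ + 1) with hV
  have hV0 : 0 ≤ V := by positivity
  set I : ℕ → Set Ω := fun j => {ω | S.arrival (j + W) ω ∈ Set.Icc a (a + ℓ)} with hI
  set g : ℕ → ℕ → ℝ≥0∞ := fun j l => ∫⁻ ω in I j,
    ENNReal.ofReal (Real.exp (-(1 * (S.arrival (j + m) ω - S.arrival l ω)))) ∂P with hg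
  have h1 : ∀ j l, P (I j ∩ {ω | S.arrival (j + m) ω - S.arrival l ω ≤ S.dur l ω}) ≤ g j l := by
    intro j l
    have hIm : MeasurableSet[S.past l] (I j) := by
      exact (S.measurable_arrival_past l (j + W)) measurableSet_Icc
    have hIm' : MeasurableSet (I j) := hS.past_le l _ hIm
    have hf : Measurable[S.past l] ((I j).indicator (1 : Ω → ℝ≥0∞)) := by
      let _ := S.past l
      exact measurable_one.indicator hIm
    have ha : Measurable[S.past l] fun ω => S.arrival (j + m) ω - S.arrival l ω :=
      (S.measurable_arrival_past l _).sub (S.measurable_arrival_past l _)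
    have h2 := lintegral_mul_indicator_exp (hS.past_le l) (hS.measurable_dur l)
      (indep_of_indep_of_le_left (hS.indep_dur l) le_sup_left) one_pos (hS.law_dur l) hf ha
    have h3 : MeasurableSet {ω | S.arrival (j + m) ω - S.arrival l ω ≤ S.dur l ω} :=
      measurableSet_le (ha.mono (hS.past_le l) le_rfl) (hS.measurable_dur l)
    rw [← lintegral_indicator_one (hIm'.inter h3)]
    simp_rw [Set.inter_indicator_one, Pi.mul_apply]
    rw [h2]
    simp only [hg]
    rw [← lintegral_indicator hIm']
    refine lintegral_mono fun ω => ?_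
    by_cases hω : ω ∈ I j
    · simp only [Set.indicator_of_mem hω, Pi.one_apply, one_mul]
      gcongr
      exact le_max_left _ _
    · simp [hω]
  have hsub : ∀ j, I j \ {ω | ∀ l < j, S.arrival l ω + S.dur l ω < S.arrival (j + m) ω} ⊆
      ⋃ l ∈ Finset.range j, I j ∩ {ω | S.arrival (j + m) ω - S.arrival l ω ≤ S.dur l ω} := by
    rintro j ω ⟨hω, hns⟩
    have hns' : ¬ ∀ l < j, S.arrival l ω + S.dur l ω < S.arrival (j + m) ω := hns
    push Not at hns'
    obtain ⟨l, hl, h⟩ := hns'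
    simp only [Set.mem_iUnion, Finset.mem_range]
    exact ⟨l, hl, hω, by simp only [Set.mem_ofPred_eq]; linarith⟩
  have hlt : μ / (μ + 1) < 1 := by rw [div_lt_one (by positivity)]; linarith
  have hpow : ∀ r : ℕ, V * (μ / (μ + 1)) ^ (r + 1 + m) =
      V * (μ / (μ + 1)) ^ (1 + m) * (μ / (μ + 1)) ^ r := by
    intro r
    rw [mul_assoc V, ← pow_add, show r + 1 + m = 1 + m + r by ring]
  calc _ ≤ ∑' j, ∑ l ∈ Finset.range j, g j l := by
        refine ENNReal.tsum_le_tsum fun j => (measure_mono (hsub j)).trans ?_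
        exact (measure_biUnion_finset_le _ _).trans (Finset.sum_le_sum fun l _ => h1 j l)
    _ = ∑' r, ∑' l, g (l + (r + 1)) l := tsum_sum_range_eq g
    _ ≤ ∑' r : ℕ, ENNReal.ofReal (V * (μ / (μ + 1)) ^ (r + 1 + m)) := by
        refine ENNReal.tsum_le_tsum fun r => ?_
        have h2 := hS.tsum_lintegral_exp_window_le hμ hℓ (θ := 1) (by positivity)
          (Nat.zero_le (r + 1 + m)) (by omega : r + 1 + m ≤ r + 1 + W) a
        simp only [add_zero, Nat.sub_zero, ← add_assoc] at h2
        simpa only [hg, hI, ← add_assoc] using h2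
    _ = ENNReal.ofReal (∑' r : ℕ, V * (μ / (μ + 1)) ^ (r + 1 + m)) := by
        rw [ENNReal.ofReal_tsum_of_nonneg (fun r => by positivity)]
        have := (summable_geometric_of_lt_one (by positivity) hlt).mul_left
          (V * (μ / (μ + 1)) ^ (1 + m))
        exact this.congr fun r => (hpow r).symm
    _ = _ := by
        congr 1
        rw [tsum_congr hpow]
        rw [tsum_mul_left, tsum_geometric_of_lt_one (by positivity) hlt, pow_add, pow_one]
        have h3 : 1 - μ / (μ + 1) = (μ + 1)⁻¹ := by field_simp; ring
        rw [h3, inv_inv]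
        field_simp

/-- It is unlikely that an initial call is still in progress late in the process. -/
theorem IsModel.tsum_init_le (hS : S.IsModel lam P) (hμ : 1 < rate lam n) {ℓ : ℝ}
    (hℓ : 0 < ℓ) (a : ℝ) {m W : ℕ} (hm : m ≤ W) (hint : Integrable S.initTotal P) :
    ∑' j, P ({ω | S.arrival (j + W) ω ∈ Set.Icc a (a + ℓ)} \
        {ω | ∀ p, ∀ k < S.init ω p, S.res p k ω < S.arrival (j + m) ω})
      ≤ ENNReal.ofReal (Real.exp 1 * (rate lam n * ℓ + 1) * ((∫ ω, S.initTotal ω ∂P) *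
        Real.exp (-a) * (rate lam n / (rate lam n - 1)) ^ (W - m))) := by
  set μ := rate lam n with hμdef
  have hμ0 : 0 < μ := by linarith
  set V := Real.exp 1 * (μ * ℓ + 1) with hV
  have hV0 : 0 ≤ V := by positivity
  set I : ℕ → Set Ω := fun j => {ω | S.arrival (j + W) ω ∈ Set.Icc a (a + ℓ)} with hI
  set w : ℕ → Ω → ℝ≥0∞ := fun j ω =>
    ENNReal.ofReal (Real.exp (-(-1 * (S.arrival (j + W) ω - S.arrival (j + m) ω)))) with hw
  have h1 : ∀ j p k, P (I j ∩ ({ω | k < S.init ω p} ∩ {ω | S.arrival (j + m) ω ≤ S.res p k ω}))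
      ≤ P {ω | k < S.init ω p} * (ENNReal.ofReal (Real.exp (-a)) * ∫⁻ ω in I j, w j ω ∂P) := by
    intro j p k
    have hIG : MeasurableSet[S.gapsBefore (j + W + 1)] (I j) :=
      (S.measurable_arrival_gapsBefore (Nat.lt_succ_self _)) measurableSet_Icc
    have hIj : MeasurableSet (I j) := hS.gapsBefore_le _ _ hIG
    have hstart : MeasurableSet[S.sourceAlgebra .start] {ω | k < S.init ω p} := by
      have : Measurable[S.sourceAlgebra .start] fun ω => S.init ω p :=
        (measurable_pi_apply p).comp (measurable_fst.comp
          (comap_measurable fun ω => (S.init ω, S.aux ω)))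
      exact this measurableSet_Ioi
    have hstart' : MeasurableSet {ω | k < S.init ω p} := hS.sourceAlgebra_le _ _ hstart
    have hind1 : Indep (S.sourceAlgebra .start ⊔ S.gapsBefore (j + W + 1))
        (S.sourceAlgebra (.res p k)) P := by
      have := indep_iSup_of_disjoint hS.sourceAlgebra_le hS.indep
        (S := {.start} ∪ {s : Source n | ∃ i < j + W + 1, s = .gap i}) (T := {Source.res p k})
        (by simp)
      rwa [iSup_union, iSup_singleton, iSup_singleton] at this
    have hind2 : Indep (S.sourceAlgebra .start) (S.gapsBefore (j + W + 1)) P := by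
      have := indep_iSup_of_disjoint hS.sourceAlgebra_le hS.indep
        (S := {Source.start}) (T := {s : Source n | ∃ i < j + W + 1, s = .gap i})
        (by simp)
      rwa [iSup_singleton] at this
    have hle : S.sourceAlgebra .start ⊔ S.gapsBefore (j + W + 1) ≤ mΩ :=
      sup_le (hS.sourceAlgebra_le _) (hS.gapsBefore_le _)
    have hTm : Measurable[S.gapsBefore (j + W + 1)] (S.arrival (j + m)) :=
      S.measurable_arrival_gapsBefore (by omega)
    have hTW : Measurable[S.gapsBefore (j + W + 1)] (S.arrival (j + W)) :=
      S.measurable_arrival_gapsBefore (by omega)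
    have hf1 : Measurable[S.sourceAlgebra .start] ({ω | k < S.init ω p}.indicator
        (1 : Ω → ℝ≥0∞)) := by
      let _ := S.sourceAlgebra .start
      exact measurable_one.indicator hstart
    have hf2 : Measurable[S.gapsBefore (j + W + 1)] ((I j).indicator (1 : Ω → ℝ≥0∞)) := by
      let _ := S.gapsBefore (j + W + 1)
      exact measurable_one.indicator hIG
    have hwG : Measurable[S.gapsBefore (j + W + 1)] fun ω => (I j).indicator (1 : Ω → ℝ≥0∞) ω *
        (ENNReal.ofReal (Real.exp (-a)) * w j ω) := by
      let _ := S.gapsBefore (j + W + 1)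
      exact hf2.mul (measurable_const.mul
        (Real.measurable_exp.comp (((hTW.sub hTm).const_mul (-1)).neg)).ennreal_ofReal)
    have hf : Measurable[S.sourceAlgebra .start ⊔ S.gapsBefore (j + W + 1)] fun ω =>
        {ω | k < S.init ω p}.indicator (1 : Ω → ℝ≥0∞) ω * (I j).indicator 1 ω := by
      have e1 := hf1.mono (le_sup_left (b := S.gapsBefore (j + W + 1))) le_rfl
      have e2 := hf2.mono (le_sup_right (a := S.sourceAlgebra .start)) le_rfl
      let _ := S.sourceAlgebra .start ⊔ S.gapsBefore (j + W + 1)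
      exact e1.mul e2
    have h2 := lintegral_mul_indicator_exp hle (hS.measurable_res p k) hind1 one_pos
      (hS.law_res p k) hf (hTm.mono le_sup_right le_rfl)
    have h3 : MeasurableSet {ω | S.arrival (j + m) ω ≤ S.res p k ω} :=
      measurableSet_le (hS.measurable_arrival _) (hS.measurable_res p k)
    have h4 := lintegral_mul_eq_lintegral_mul_lintegral_of_independent_measurableSpace
      (hS.sourceAlgebra_le .start) (hS.gapsBefore_le (j + W + 1)) hind2 hf1 hwG
    rw [← lintegral_indicator_one (hIj.inter (hstart'.inter h3)),
      ← lintegral_indicator_one hstart']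
    have h5 : ENNReal.ofReal (Real.exp (-a)) * ∫⁻ ω in I j, w j ω ∂P
        = ∫⁻ ω, (I j).indicator 1 ω * (ENNReal.ofReal (Real.exp (-a)) * w j ω) ∂P := by
      have hwm : Measurable (w j) := by
        have e1 := hS.measurable_arrival (j + W)
        have e2 := hS.measurable_arrival (j + m)
        fun_prop
      rw [← lintegral_const_mul _ hwm, ← lintegral_indicator hIj]
      refine lintegral_congr fun ω => ?_
      by_cases hω : ω ∈ I j <;> simp [hω]
    rw [h5, ← h4]
    refine (lintegral_mono fun ω => ?_).trans ((le_of_eq h2).trans (lintegral_mono fun ω => ?_))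
    · simp only [Set.inter_indicator_one, Pi.mul_apply]
      rw [← mul_assoc, mul_comm ((I j).indicator 1 ω)]
    · simp only
      rw [mul_assoc]
      refine mul_le_mul_right ?_ _
      by_cases hω : ω ∈ I j
      · simp only [Set.indicator_of_mem hω, Pi.one_apply, one_mul, hw]
        rw [← ENNReal.ofReal_mul (Real.exp_pos _).le, ← Real.exp_add]
        apply ENNReal.ofReal_le_ofReal
        rw [Real.exp_le_exp]
        have h6 : a ≤ S.arrival (j + W) ω := hω.1
        have h7 := le_max_left (S.arrival (j + m) ω) 0
        linarith
      · simp [hω]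
  have hsub : ∀ j, I j \ {ω | ∀ p, ∀ k < S.init ω p, S.res p k ω < S.arrival (j + m) ω} ⊆
      ⋃ p, ⋃ k, I j ∩ ({ω | k < S.init ω p} ∩ {ω | S.arrival (j + m) ω ≤ S.res p k ω}) := by
    rintro j ω ⟨hω, hns⟩
    have hns' : ¬ ∀ p, ∀ k < S.init ω p, S.res p k ω < S.arrival (j + m) ω := hns
    push Not at hns'
    obtain ⟨p, k, hk, h⟩ := hns'
    exact Set.mem_iUnion.2 ⟨p, Set.mem_iUnion.2 ⟨k, hω, hk, h⟩⟩
  have hmeasp : ∀ p, Measurable fun ω => (S.init ω p : ℝ≥0∞) := fun p =>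
    measurable_from_nat.comp ((measurable_pi_apply p).comp hS.measurable_init)
  have hE : ∑ p, ∑' k, P {ω | k < S.init ω p} = ENNReal.ofReal (∫ ω, S.initTotal ω ∂P) := by
    have e1 : ∀ p k, MeasurableSet {ω | k < S.init ω p} := fun p k =>
      ((measurable_pi_apply p).comp hS.measurable_init) measurableSet_Ioi
    have e2 : ∀ p, ∑' k, P {ω | k < S.init ω p} = ∫⁻ ω, (S.init ω p : ℝ≥0∞) ∂P := by
      intro p
      simp_rw [← lintegral_indicator_one (e1 p _)]
      rw [← lintegral_tsum fun k => (measurable_one.indicator (e1 p k)).aemeasurable]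
      exact lintegral_congr fun ω => tsum_indicator_lt (fun ω => S.init ω p) ω
    simp_rw [e2]
    rw [← lintegral_finsetSum _ fun p _ => hmeasp p,
      ofReal_integral_eq_lintegral_ofReal hint
        (ae_of_all _ fun ω => Finset.sum_nonneg fun p _ => Nat.cast_nonneg _)]
    refine lintegral_congr fun ω => ?_
    unfold initTotal
    rw [ENNReal.ofReal_sum_of_nonneg fun p _ => Nat.cast_nonneg _]
    simp
  calc _ ≤ ∑' j, ∑ p, ∑' k, P {ω | k < S.init ω p} *
          (ENNReal.ofReal (Real.exp (-a)) * ∫⁻ ω in I j, w j ω ∂P) := by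
        refine ENNReal.tsum_le_tsum fun j => (measure_mono (hsub j)).trans ?_
        refine (measure_iUnion_fintype_le _ _).trans (Finset.sum_le_sum fun p _ => ?_)
        exact (measure_iUnion_le _).trans (ENNReal.tsum_le_tsum fun k => h1 j p k)
    _ = ENNReal.ofReal (∫ ω, S.initTotal ω ∂P) * (ENNReal.ofReal (Real.exp (-a)) *
          ∑' j, ∫⁻ ω in I j, w j ω ∂P) := by
        simp_rw [ENNReal.tsum_mul_right]
        simp_rw [← Finset.sum_mul, hE]
        rw [ENNReal.tsum_mul_left, ENNReal.tsum_mul_left]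
    _ ≤ ENNReal.ofReal (∫ ω, S.initTotal ω ∂P) * (ENNReal.ofReal (Real.exp (-a)) *
          ENNReal.ofReal (V * (μ / (μ + -1)) ^ (W - m))) := by
        gcongr
        exact hS.tsum_lintegral_exp_window_le hμ0 hℓ (θ := -1) (by linarith) hm le_rfl a
    _ = _ := by
        have h0 : 0 ≤ ∫ ω, S.initTotal ω ∂P := integral_nonneg fun ω =>
          Finset.sum_nonneg fun p _ => Nat.cast_nonneg _
        rw [← ENNReal.ofReal_mul (Real.exp_pos _).le, ← ENNReal.ofReal_mul h0, ← sub_eq_add_neg]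
        congr 1
        ring

end Evolution

/-! ### The expected number of lost calls -/

namespace Evolution

theorem lost_eq_tsum {n d : ℕ} {Ω : Type u} (S : Evolution n d Ω) (a b : ℝ) (ω : Ω) :
    S.lost a b ω = ∑' j, ({ω | S.arrival j ω ∈ Set.Icc a b} ∩
      {ω | S.via j ω = none}).indicator (1 : Ω → ℝ≥0∞) ω := by
  have h : ∀ j, ({ω | S.arrival j ω ∈ Set.Icc a b} ∩
      {ω | S.via j ω = none}).indicator (1 : Ω → ℝ≥0∞) ω =
      {j : ℕ | S.arrival j ω ∈ Set.Icc a b ∧ S.via j ω = none}.indicator (fun _ => 1) j :=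
    fun j => rfl
  rw [tsum_congr h, ← tsum_subtype, ENNReal.tsum_set_one]
  rfl

variable {n d : ℕ} {Ω : Type u} [mΩ : MeasurableSpace Ω] {S : Evolution n d Ω} {lam : ℝ}
  {P : Measure Ω}

theorem IsModel.lintegral_lost (hS : S.IsModel lam P) (a b : ℝ) :
    ∫⁻ ω, S.lost a b ω ∂P = ∑' j, P ({ω | S.arrival j ω ∈ Set.Icc a b} ∩
      {ω | S.via j ω = none}) := by
  have hm : ∀ j, MeasurableSet ({ω | S.arrival j ω ∈ Set.Icc a b} ∩ {ω | S.via j ω = none}) :=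
    fun j => (hS.measurableSet_arrival_mem j a b).inter
      (hS.past_le _ _ (hS.measurableSet_via (Nat.lt_succ_self j) none))
  simp_rw [lost_eq_tsum]
  rw [lintegral_tsum fun j => (measurable_one.indicator (hm j)).aemeasurable]
  exact tsum_congr fun j => lintegral_indicator_one (hm j)

variable [IsProbabilityMeasure P]

/-- The expected number of calls lost under the balanced algorithm in an interval of length `ℓ`
that starts at time `s`. The window that decides about a call consists of the `m + m₂` preceding
arrivals: the calls that arrived before the window end within its first `m` arrivals, and the loads
settle during the last `m₂` arrivals. -/
theorem IsModel.lintegral_lost_le (hS : S.IsModel lam P) (hlam : 0 < lam) (hn : 3 ≤ n)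
    (hd : 2 ≤ d) {D : ℕ} (hbal : S.IsBDAR D P) (hint : Integrable S.initTotal P)
    (hμ : 1 < rate lam n) {s ℓ : ℝ} (hℓ : 0 < ℓ) (m m₂ : ℕ)
    {α L : ℝ} (hα : α = 32 * Real.exp 1 * lam) (hL : 1 ≤ L) (hαL : 4 * α * 6 ^ d ≤ L)
    {ε : ℕ → ℝ} {εmin : ℝ} (hε0 : ε 0 = L⁻¹) (hmin0 : 0 ≤ εmin) (hmin : ∀ r, εmin ≤ ε r)
    (hεs : ∀ r, 8 * Real.exp 1 * lam * 12 ^ d * ε r ^ d ≤ ε (r + 1))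
    {k₀ R h : ℕ} (hk₀ : 8 * Real.exp 1 * lam * L ≤ k₀) (hD : k₀ + R + h ≤ D)
    {u : ℝ} (hu : 1 ≤ u) :
    ∫⁻ ω, S.lost s (s + ℓ) ω ∂P ≤ ENNReal.ofReal (
      (m + m₂ : ℕ) * (rate lam n / (rate lam n - 1)) ^ (m + m₂) * Real.exp (-s) +
      Real.exp 1 * (rate lam n * ℓ + 1) * (
        ((m + m₂ : ℕ) + 1 : ℕ) ^ 2 * Real.exp (-rate lam n) +
        rate lam n * (rate lam n / (rate lam n + 1)) ^ m +
        (∫ ω, S.initTotal ω ∂P) * Real.exp (-s) * (rate lam n / (rate lam n - 1)) ^ m₂ +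
        (n * (m₂ + 1 : ℕ) *
          (Real.exp (-(8 * Real.exp 1 * lam * n / 3)) + R * Real.exp (-(n * εmin / 3)))
        + n * (u⁻¹ ^ h * Real.exp ((u - 1) * (n * (α * Real.exp (-((4 * rate lam n)⁻¹ * m₂)) +
            8 * Real.exp 1 * lam * 12 ^ d * ε R ^ d) / 4)))))) := by
  set μ := rate lam n with hμdef
  have hμ0 : 0 < μ := by linarith
  have hμ1 : 0 < μ - 1 := by linarith
  set W := m + m₂ with hW
  set δ := n * (m₂ + 1 : ℕ) *
          (Real.exp (-(8 * Real.exp 1 * lam * n / 3)) + R * Real.exp (-(n * εmin / 3)))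
        + n * (u⁻¹ ^ h * Real.exp ((u - 1) * (n * (α * Real.exp (-((4 * μ)⁻¹ * m₂)) +
            8 * Real.exp 1 * lam * 12 ^ d * ε R ^ d) / 4))) with hδ
  have hδ0 : 0 ≤ δ := by positivity
  have hE0 : 0 ≤ ∫ ω, S.initTotal ω ∂P := integral_nonneg fun ω =>
    Finset.sum_nonneg fun p _ => Nat.cast_nonneg _
  set I : ℕ → Set Ω := fun j => {ω | S.arrival j ω ∈ Set.Icc s (s + ℓ)} with hI
  set U : ℕ → Set Ω := fun j => S.sparse (2 * μ)⁻¹ j (j + W) with hU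
  set O : ℕ → Set Ω := fun j => {ω | ∀ l < j, S.arrival l ω + S.dur l ω < S.arrival (j + m) ω}
    with hO
  set Q : ℕ → Set Ω := fun j => {ω | ∀ p, ∀ k < S.init ω p, S.res p k ω < S.arrival (j + m) ω}
    with hQ
  have hmain : ∀ j, P (I (j + W) ∩ U j ∩ {ω | S.via (j + W) ω = none} ∩ Q j ∩ O j)
      ≤ ENNReal.ofReal δ * P (I (j + W)) := by
    intro j
    have hA : MeasurableSet[S.past j] (I (j + W) ∩ U j) :=
      MeasurableSet.inter ((S.measurable_arrival_past j (j + W)) measurableSet_Icc)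
        (S.measurableSet_sparse_past _ _ _ _)
    have h1 := hS.prob_lost_inter_le hlam hn hd hbal (j₀ := j) (a₀ := j + m) (j := j + W)
      (by omega) (by omega) hA (fun ω hω => hω.2) hα hL hαL hε0 hmin0 hmin hεs hk₀ hD hu
    have h2 : j + W + 1 - (j + m) = m₂ + 1 := by omega
    have h3 : (((j + W : ℕ) : ℝ) - (j + m : ℕ)) = m₂ := by rw [hW]; push_cast; ring
    rw [h2, h3] at h1
    refine h1.trans (mul_le_mul_right (measure_mono Set.inter_subset_left) _)
  have hcover : ∀ j, I (j + W) ∩ {ω | S.via (j + W) ω = none} ⊆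
      (I (j + W) \ U j) ∪ ((I (j + W) \ O j) ∪ ((I (j + W) \ Q j) ∪
        (I (j + W) ∩ U j ∩ {ω | S.via (j + W) ω = none} ∩ Q j ∩ O j))) := by
    rintro j ω ⟨h1, h2⟩
    by_cases hu : ω ∈ U j
    swap
    · exact Or.inl ⟨h1, hu⟩
    by_cases ho : ω ∈ O j
    swap
    · exact Or.inr (Or.inl ⟨h1, ho⟩)
    by_cases hq : ω ∈ Q j
    swap
    · exact Or.inr (Or.inr (Or.inl ⟨h1, hq⟩))
    exact Or.inr (Or.inr (Or.inr ⟨⟨⟨⟨h1, hu⟩, h2⟩, hq⟩, ho⟩))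
  have hstep : ∀ j, P (I (j + W) ∩ {ω | S.via (j + W) ω = none}) ≤
      P (I (j + W) \ U j) + (P (I (j + W) \ O j) + (P (I (j + W) \ Q j) +
        ENNReal.ofReal δ * P (I (j + W)))) := by
    intro j
    refine (measure_mono (hcover j)).trans ((measure_union_le _ _).trans ?_)
    refine add_le_add_right ((measure_union_le _ _).trans ?_) _
    refine add_le_add_right ((measure_union_le _ _).trans ?_) _
    exact add_le_add_right (hmain j) _
  have hUs := hS.tsum_not_sparse_le hμ0 hℓ s W
  have hOs := hS.tsum_old_le hμ0 hℓ s (m := m) (W := W) (by omega)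
  have hQs := hS.tsum_init_le hμ hℓ s (m := m) (W := W) (by omega) hint
  have hWs := hS.sum_short_le hμ s (s + ℓ) W
  have hIs : ∑' j, P (I (j + W)) ≤ ENNReal.ofReal (Real.exp 1 * (μ * ℓ + 1)) :=
    (ENNReal.tsum_comp_le_tsum_of_injective (add_left_injective W) (fun j => P (I j))).trans
      (hS.tsum_arrival_mem_le hμ0 hℓ s)
  have hWm : W - m = m₂ := by omega
  rw [hWm] at hQs
  rw [hS.lintegral_lost, ← Summable.sum_add_tsum_nat_add' (k := W) ENNReal.summable]
  set V := Real.exp 1 * (μ * ℓ + 1) with hV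
  have hV0 : 0 ≤ V := by positivity
  calc _ ≤ ENNReal.ofReal (W * (μ / (μ - 1)) ^ W * Real.exp (-s)) +
        (ENNReal.ofReal (V * ((W + 1 : ℕ) ^ 2 * Real.exp (-μ))) +
        (ENNReal.ofReal (V * (μ * (μ / (μ + 1)) ^ m)) +
        (ENNReal.ofReal (V * ((∫ ω, S.initTotal ω ∂P) * Real.exp (-s) * (μ / (μ - 1)) ^ m₂)) +
          ENNReal.ofReal δ * ENNReal.ofReal V))) := by
        refine add_le_add ?_ ?_
        · exact (Finset.sum_le_sum fun i _ => measure_mono Set.inter_subset_left).trans hWs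
        · refine (ENNReal.tsum_le_tsum hstep).trans ?_
          rw [ENNReal.tsum_add, ENNReal.tsum_add, ENNReal.tsum_add, ENNReal.tsum_mul_left]
          exact add_le_add hUs (add_le_add hOs (add_le_add hQs (mul_le_mul_right hIs _)))
    _ = _ := by
        rw [← ENNReal.ofReal_mul hδ0, ← ENNReal.ofReal_add (by positivity) (by positivity),
          ← ENNReal.ofReal_add (by positivity) (by positivity),
          ← ENNReal.ofReal_add (by positivity) (by positivity),
          ← ENNReal.ofReal_add (by positivity) (by positivity)]
        congr 1
        ring

end Evolution

/-! ### The balanced algorithm loses few calls -/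

theorem div_sub_one_pow_le_exp {μ : ℝ} (hμ : 2 ≤ μ) (k : ℕ) :
    (μ / (μ - 1)) ^ k ≤ Real.exp (2 * k / μ) := by
  have h1 : μ / (μ - 1) ≤ Real.exp (2 / μ) := by
    have h2 : μ / (μ - 1) ≤ 2 / μ + 1 := by
      rw [div_add_one (by positivity), div_le_div_iff₀ (by linarith) (by linarith)]
      nlinarith
    exact h2.trans (Real.add_one_le_exp _)
  calc _ ≤ Real.exp (2 / μ) ^ k := pow_le_pow_left₀ (div_nonneg (by linarith) (by linarith)) h1 k
    _ = _ := by rw [← Real.exp_nat_mul]; congr 1; ring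

theorem div_add_one_pow_le_exp {μ : ℝ} (hμ : 1 ≤ μ) (k : ℕ) :
    (μ / (μ + 1)) ^ k ≤ Real.exp (-(k / (2 * μ))) := by
  have h1 : μ / (μ + 1) ≤ Real.exp (-(1 / (2 * μ))) := by
    have h2 : μ / (μ + 1) ≤ -(1 / (2 * μ)) + 1 := by
      have h3 : -(1 / (2 * μ)) + 1 = (2 * μ - 1) / (2 * μ) := by field_simp; ring
      rw [h3, div_le_div_iff₀ (by linarith) (by linarith)]
      nlinarith
    exact h2.trans (Real.add_one_le_exp _)
  calc _ ≤ Real.exp (-(1 / (2 * μ))) ^ k := pow_le_pow_left₀ (by positivity) h1 k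
    _ = _ := by rw [← Real.exp_nat_mul]; congr 1; ring

theorem le_rate {lam : ℝ} (hlam : 0 < lam) {n : ℕ} (hn : 3 ≤ n) :
    lam * (n : ℝ) ^ 2 / 6 ≤ rate lam n := by
  unfold rate
  rw [Nat.cast_choose_two]
  have h : (3 : ℝ) ≤ n := by exact_mod_cast hn
  have : (n : ℝ) ^ 2 / 6 ≤ n * (n - 1) / 2 := by nlinarith
  calc _ = lam * ((n : ℝ) ^ 2 / 6) := by ring
    _ ≤ _ := by gcongr

theorem tendsto_sqrt_sqrt_natCast : Tendsto (fun n : ℕ => √√(n : ℝ)) atTop atTop :=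
  Real.tendsto_sqrt_atTop.comp (Real.tendsto_sqrt_atTop.comp tendsto_natCast_atTop_atTop)

/-- Failure probabilities of the form `exp (-c n ^ (1 / 4))` beat every power of `n`. The exponent
`1 / 4` comes from `n` nodes of which a proportion of `n ^ (-3 / 4)` is expected on a level. -/
theorem eventually_pow_mul_exp_le (N : ℕ) {c : ℝ} (hc : 0 < c) :
    ∀ᶠ n : ℕ in atTop, (n : ℝ) ^ N * Real.exp (-(c * √√(n : ℝ))) ≤ 1 := by
  have h1 := (Real.tendsto_pow_mul_exp_neg_atTop_nhds_zero (4 * N)).comp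
    (tendsto_sqrt_sqrt_natCast.const_mul_atTop hc)
  have h2 := h1.eventually_le_const (u := c ^ (4 * N)) (by positivity)
  filter_upwards [h2] with n hn
  simp only [Function.comp_apply] at hn
  have h3 : √√(n : ℝ) ^ (4 * N) = (n : ℝ) ^ N := by
    rw [pow_mul]
    congr 1
    rw [show (4 : ℕ) = 2 * 2 from rfl, pow_mul, Real.sq_sqrt (by positivity),
      Real.sq_sqrt (by positivity)]
  rw [mul_pow, h3, mul_assoc] at hn
  exact (mul_le_iff_le_one_right (by positivity)).1 hn

/-- The profile of the layered induction: `2 * 2 ^ (-d ^ r)`, cut off at `t`, and scaled by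
`L⁻¹`. -/
noncomputable def profile (d : ℕ) (L t : ℝ) (r : ℕ) : ℝ := max (2 * (2⁻¹ : ℝ) ^ d ^ r) t / L

theorem profile_zero {d : ℕ} {L t : ℝ} (ht : t ≤ 1) : profile d L t 0 = L⁻¹ := by
  unfold profile
  rw [pow_zero, pow_one, mul_inv_cancel₀ two_ne_zero, max_eq_left ht, one_div]

theorem le_profile {d : ℕ} {L t : ℝ} (hL : 0 ≤ L) (r : ℕ) : t / L ≤ profile d L t r :=
  div_le_div_of_nonneg_right (le_max_right _ _) hL

/-- The profile dominates the recursion `ε (r + 1) ≥ a * ε r ^ d` of the layers, if the scale `L` is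
large; the cut-off does no harm, as `t ^ d ≤ t`. -/
theorem mul_profile_pow_le {d : ℕ} (hd : 2 ≤ d) {L t a : ℝ} (hL : 1 ≤ L) (ht : t ≤ 1)
    (ht0 : 0 ≤ t) (ha : 0 ≤ a) (haL : a * 2 ^ d ≤ L) (r : ℕ) :
    a * profile d L t r ^ d ≤ profile d L t (r + 1) := by
  unfold profile
  have hL0 : 0 < L := by linarith
  set p : ℝ := (2⁻¹ : ℝ) ^ d ^ r with hp
  have hp0 : 0 ≤ p := by positivity
  have hps : (2⁻¹ : ℝ) ^ d ^ (r + 1) = p ^ d := by rw [hp, ← pow_mul, pow_succ]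
  rw [hps]
  have h1 : max (2 * p) t ^ d ≤ 2 ^ d * max (2 * p ^ d) t := by
    rcases le_total (2 * p) t with h | h
    · rw [max_eq_right h]
      calc t ^ d ≤ t ^ 1 := pow_le_pow_of_le_one ht0 ht (by omega)
        _ = 1 * t := by ring
        _ ≤ _ := by
            gcongr
            · exact one_le_pow₀ (by norm_num)
            · exact le_max_right _ _
    · rw [max_eq_left h, mul_pow]
      gcongr
      exact le_trans (by linarith [pow_nonneg hp0 d]) (le_max_left _ _)
  set X := max (2 * p ^ d) t with hX
  have hX0 : 0 ≤ X := le_max_of_le_right ht0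
  rw [div_pow, le_div_iff₀ hL0]
  have h2 : L ^ d = L ^ (d - 2) * L * L := by
    rw [mul_assoc, ← sq, ← pow_add]; congr 1; omega
  have h3 : 1 ≤ L ^ (d - 2) := one_le_pow₀ hL
  calc _ ≤ a * (2 ^ d * X / L ^ d) * L := by gcongr
    _ = (a * 2 ^ d) / L * X / L ^ (d - 2) := by
        rw [h2]; field_simp
    _ ≤ 1 * X / 1 := by
        gcongr
        rwa [div_le_one hL0]
    _ = X := by ring

/-- The profile reaches its cut-off `N ^ (-3 / 4)` within `log log N / log d + O(1)` layers. -/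
theorem exists_profile_eq {d : ℕ} (hd : 2 ≤ d) {y x : ℝ} (hx : 2 ≤ x)
    (hxy : Real.exp x = y ^ 4) (hy : 0 < y) (L : ℝ) :
    ∃ R : ℕ, (R : ℝ) ≤ Real.log x / Real.log d + 2 ∧ profile d L (y ^ 3)⁻¹ R = (y ^ 3)⁻¹ / L := by
  have hd1 : (1 : ℝ) < d := by exact_mod_cast (by omega : 1 < d)
  have hld : 0 < Real.log d := Real.log_pos hd1
  have hlx : 0 ≤ Real.log x := Real.log_nonneg (by linarith)
  refine ⟨⌈Real.log x / Real.log d⌉₊ + 1, ?_, ?_⟩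
  · push_cast
    have := Nat.ceil_lt_add_one (a := Real.log x / Real.log d) (by positivity)
    linarith
  · unfold profile
    congr 1
    apply max_eq_right
    set R' := ⌈Real.log x / Real.log d⌉₊ with hR'
    have h1 : x ≤ (d : ℝ) ^ R' := by
      have h2 : Real.log x / Real.log d ≤ R' := Nat.le_ceil _
      rw [div_le_iff₀ hld] at h2
      rw [← Real.log_le_log_iff (by linarith) (by positivity), Real.log_pow]
      exact h2
    have h2 : 2 * x ≤ ((d ^ (R' + 1) : ℕ) : ℝ) := by
      push_cast
      rw [pow_succ, mul_comm]
      have : (2 : ℝ) ≤ d := by exact_mod_cast hd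
      gcongr
    have h3 : (2⁻¹ : ℝ) ^ d ^ (R' + 1) = Real.exp (-(((d ^ (R' + 1) : ℕ) : ℝ) * Real.log 2)) := by
      rw [Real.exp_neg, Real.exp_nat_mul, Real.exp_log two_pos, inv_pow]
    have h4 : (y ^ 3)⁻¹ = Real.exp (-(3 / 4 * x)) := by
      have : y = Real.exp (x / 4) := by
        have h5 : y ^ 4 = Real.exp (x / 4) ^ 4 := by
          rw [← hxy, ← Real.exp_nat_mul]; congr 1; push_cast; ring
        exact (pow_left_inj₀ hy.le (Real.exp_pos _).le (by norm_num)).1 h5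
      rw [this, ← Real.exp_nat_mul, ← Real.exp_neg]
      congr 1; push_cast; ring
    have h5 : (2 : ℝ) = Real.exp (Real.log 2) := (Real.exp_log two_pos).symm
    rw [h3, h4]
    nth_rewrite 1 [h5]
    rw [← Real.exp_add, Real.exp_le_exp]
    have h6 := Real.log_two_gt_d9
    have h7 := Real.log_two_lt_d9
    nlinarith

namespace Evolution

set_option maxHeartbeats 1000000 in
/-- After a time of order `log n`, the balanced algorithm loses in expectation `O(1 / n)` calls in
a time interval of polynomial length. -/
theorem IsModel.exists_lintegral_lost_le_of_isBDAR {lam : ℝ} (hlam : 0 < lam) {d : ℕ} (hd : 2 ≤ d)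
    (M : ℕ) :
    ∃ b c : ℕ, ∀ᶠ n : ℕ in atTop, ∀ (Ω : Type u) [MeasurableSpace Ω] (P : Measure Ω)
      [IsProbabilityMeasure P] (S : Evolution n d Ω) (D : ℕ) (s ℓ : ℝ), S.IsModel lam P →
      Integrable S.initTotal P → Real.log ((∫ ω, S.initTotal ω ∂P) + 1) + b * Real.log n ≤ s →
      0 < ℓ → ℓ ≤ (n : ℝ) ^ M → Real.log (Real.log n) / Real.log d + c ≤ D → S.IsBDAR D P →
      ∫⁻ ω, S.lost s (s + ℓ) ω ∂P ≤ ENNReal.ofReal (6 * (n : ℝ)⁻¹) := by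
  set e := Real.exp 1 with he
  have he0 : 0 < e := Real.exp_pos 1
  have he3 : e ≤ 3 := Real.exp_one_lt_three.le
  set α := 32 * e * lam with hα
  have hα0 : 0 < α := by positivity
  set L := 1 + 4 * α * 6 ^ d + 8 * e * lam * 12 ^ d * 2 ^ d with hL
  have hL1 : 1 ≤ L := by
    have : 0 ≤ 4 * α * 6 ^ d + 8 * e * lam * 12 ^ d * 2 ^ d := by positivity
    linarith
  have hαL : 4 * α * 6 ^ d ≤ L := by
    have : 0 ≤ 8 * e * lam * 12 ^ d * 2 ^ d := by positivity
    linarith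
  have hgL : 8 * e * lam * 12 ^ d * 2 ^ d ≤ L := by
    have : 0 ≤ 4 * α * 6 ^ d := by positivity
    linarith
  set g := 8 * e * lam * 12 ^ d with hg
  have hg0 : 0 < g := by positivity
  set k₀ := ⌈8 * e * lam * L⌉₊ with hk₀
  -- A window contains arrivals for the time `(B + 6) log n`. Each of its two parts has to absorb a
  -- sum over `n ^ (M + O(1))` calls: calls from before the window survive its first part with
  -- probability about `n ^ (-B / 2)`, and `h` levels beyond the profile gain the factor
  -- `n ^ (-h / 2)`. The starting time `b log n` leaves room for all initial calls to end.
  set B := 2 * (M + 8) with hB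
  set h := 2 * (M + 8) with hh
  set b := 2 * B + M + 20 with hb
  set c₅ := min (8 * e * lam / 3) (1 / (3 * L)) with hc₅
  have hc₅0 : 0 < c₅ := lt_min (by positivity) (by positivity)
  have hk₀L : 8 * e * lam * L ≤ k₀ := Nat.le_ceil _
  have hc₅l : c₅ ≤ 8 * e * lam / 3 := min_le_left _ _
  have hc₅r : c₅ ≤ 1 / (3 * L) := min_le_right _ _
  clear_value c₅ k₀ h b B g L α e
  refine ⟨b, k₀ + h + 2, ?_⟩
  have hlog : Tendsto (fun n : ℕ => Real.log n) atTop atTop :=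
    Real.tendsto_log_atTop.comp tendsto_natCast_atTop_atTop
  have hlarge : ∀ᶠ n : ℕ in atTop,
      lam + 12 / lam + (B + 8 : ℕ) + Real.exp ((α + g) / 4) ≤ (n : ℝ) :=
    tendsto_natCast_atTop_atTop.eventually_ge_atTop _
  filter_upwards [eventually_ge_atTop 8, eventually_pow_mul_exp_le (M + 13) hc₅0,
    eventually_pow_mul_exp_le (M + 17) one_pos,
    hlarge, hlog.eventually_ge_atTop 2] with n hn hexp₅ hexp₂ hbig hx2 Ω _ P _ S D s ℓ hS hint hs
      hℓ hℓM hD hbal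
  set N : ℝ := (n : ℝ) with hN
  set x := Real.log N with hx
  have hN8 : (8 : ℝ) ≤ N := by rw [hN]; exact_mod_cast hn
  have hN0 : 0 < N := by linarith
  have hN1 : 1 ≤ N := by linarith
  have hexp0 := Real.exp_pos ((α + g) / 4)
  have hdl : 0 < 12 / lam := by positivity
  have hB0 : (0 : ℝ) ≤ (B + 8 : ℕ) := Nat.cast_nonneg _
  have hNl : lam ≤ N := by linarith
  have hNl' : 12 / lam ≤ N := by linarith
  have hNB : ((B + 8 : ℕ) : ℝ) ≤ N := by linarith
  have hNE : Real.exp ((α + g) / 4) ≤ N := by linarith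
  have hxN : x ≤ N := (Real.log_le_sub_one_of_pos hN0).trans (by linarith)
  have hNx : Real.exp x = N := Real.exp_log hN0
  have hNk : ∀ k : ℕ, Real.exp (k * x) = N ^ k := fun k => by rw [Real.exp_nat_mul, hNx]
  have hpow : ∀ {i j : ℕ}, i ≤ j → N ^ i ≤ N ^ j := fun hij => pow_le_pow_right₀ hN1 hij
  -- the profile is cut off at `n ^ (-3 / 4) = (y ^ 3)⁻¹`
  set y := √√N with hy
  have hy0 : 0 < y := by positivity
  have hy4 : y ^ 4 = N := by
    rw [show (4 : ℕ) = 2 * 2 from rfl, pow_mul, Real.sq_sqrt (by positivity),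
      Real.sq_sqrt (by positivity)]
  have hy1 : 1 ≤ y := by
    by_contra hlt
    have := pow_lt_one₀ hy0.le (not_le.1 hlt) (n := 4) (by norm_num)
    linarith
  have hyN : y ≤ N := by
    rw [← hy4]; exact le_self_pow₀ hy1 (by norm_num)
  clear_value y
  -- the arrival rate
  set μ := rate lam n with hμ
  have hμle : lam * N ^ 2 / 6 ≤ μ := le_rate hlam (by omega)
  have hμge : μ ≤ N ^ 3 := by
    have h1 : μ ≤ lam * N ^ 2 / 2 := rate_le hlam n
    have h2 : lam * N ^ 2 ≤ N * N ^ 2 := by gcongr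
    have h3 : N * N ^ 2 = N ^ 3 := by ring
    have h4 := pow_pos hN0 3
    linarith
  have hμN : 2 * N ≤ μ := by
    rw [div_le_iff₀ hlam] at hNl'
    have h1 : 12 * N ≤ N * lam * N := by gcongr
    have h2 : N * lam * N = lam * N ^ 2 := by ring
    linarith
  have hμ2 : 2 ≤ μ := by linarith
  have hμ0 : 0 < μ := by linarith
  -- the numbers of arrivals in the two parts of a window
  set m := ⌈B * μ * x⌉₊ with hm
  set m₂ := ⌈6 * μ * x⌉₊ with hm₂
  have hm1 : (B : ℝ) * μ * x ≤ m := Nat.le_ceil _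
  have hm2 : (m : ℝ) ≤ B * μ * x + 1 := (Nat.ceil_lt_add_one (by positivity)).le
  have hm₂1 : 6 * μ * x ≤ m₂ := Nat.le_ceil _
  have hm₂2 : (m₂ : ℝ) ≤ 6 * μ * x + 1 := (Nat.ceil_lt_add_one (by positivity)).le
  have hμx : μ * x ≤ N ^ 4 := by
    calc μ * x ≤ N ^ 3 * N := by gcongr
      _ = N ^ 4 := by ring
  have hN4 : 1 ≤ N ^ 4 := one_le_pow₀ hN1
  clear_value m m₂
  have hW : ((m + m₂ : ℕ) : ℝ) + 1 ≤ N ^ 5 := by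
    push_cast
    calc (m : ℝ) + m₂ + 1 ≤ (B + 6) * (μ * x) + 3 := by linarith
      _ ≤ (B + 6) * N ^ 4 + 2 * N ^ 4 := by
          have : (B + 6 : ℝ) * (μ * x) ≤ (B + 6) * N ^ 4 := by gcongr
          have h4 : (2 : ℝ) ≤ N ^ 4 := le_trans (by linarith) (le_self_pow₀ hN1 (by norm_num))
          have h5 : (3 : ℝ) ≤ 2 * N ^ 4 := by linarith
          linarith
      _ = ((B + 8 : ℕ) : ℝ) * N ^ 4 := by push_cast; ring
      _ ≤ N * N ^ 4 := by gcongr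
      _ = N ^ 5 := by ring
  have hm₂5 : ((m₂ + 1 : ℕ) : ℝ) ≤ N ^ 5 := by
    refine le_trans ?_ hW
    push_cast
    linarith [Nat.cast_nonneg (α := ℝ) m]
  -- the initial state
  set E := ∫ ω, S.initTotal ω ∂P with hE
  have hE0 : 0 ≤ E := integral_nonneg fun ω => Finset.sum_nonneg fun p _ => Nat.cast_nonneg _
  have hes : (E + 1) * Real.exp (-s) ≤ (N ^ b)⁻¹ := by
    rw [← hNk, ← Real.exp_neg]
    nth_rewrite 1 [← Real.exp_log (by linarith : 0 < E + 1)]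
    rw [← Real.exp_add, Real.exp_le_exp]
    linarith
  have hs0 := Real.exp_pos (-s)
  have hes1 : Real.exp (-s) ≤ (N ^ b)⁻¹ := le_trans (le_mul_of_one_le_left hs0.le (by linarith)) hes
  have hesE : E * Real.exp (-s) ≤ (N ^ b)⁻¹ :=
    le_trans (mul_le_mul_of_nonneg_right (by linarith) hs0.le) hes
  clear_value E
  set V := e * (μ * ℓ + 1) with hV
  have hV0 : 0 ≤ V := by positivity
  have hVle : V ≤ N ^ (M + 4) := by
    have h1 : μ * ℓ ≤ N ^ (M + 3) := by
      calc μ * ℓ ≤ N ^ 3 * N ^ M := by gcongr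
        _ = N ^ (M + 3) := by rw [← pow_add, add_comm]
    have h2 : 1 ≤ N ^ (M + 3) := one_le_pow₀ hN1
    calc V ≤ 3 * (N ^ (M + 3) + N ^ (M + 3)) := by rw [hV]; gcongr
      _ = 6 * N ^ (M + 3) := by ring
      _ ≤ N * N ^ (M + 3) := mul_le_mul_of_nonneg_right (by linarith) (by positivity)
      _ = N ^ (M + 4) := by rw [← pow_succ']
  clear_value V μ x N
  have he2 : Real.exp 2 ≤ N ^ 2 := by
    have h1 : Real.exp 2 ≤ N := by rw [← hNx, Real.exp_le_exp]; exact hx2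
    exact h1.trans (le_self_pow₀ hN1 (by norm_num))
  have hratio : ∀ k a : ℕ, (k : ℝ) ≤ a * μ * x + 2 → (μ / (μ - 1)) ^ k ≤ N ^ (2 * a + 2) := by
    intro k a hk
    refine (div_sub_one_pow_le_exp hμ2 k).trans ?_
    have h1 : 2 * (k : ℝ) / μ ≤ (2 * a : ℕ) * x + 2 := by
      have h2 : 2 * (a * μ * x + 2) ≤ (2 * a * x + 2) * μ := by linarith
      rw [div_le_iff₀ hμ0]
      push_cast
      linarith
    calc _ ≤ Real.exp ((2 * a : ℕ) * x + 2) := Real.exp_le_exp.2 h1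
      _ = N ^ (2 * a) * Real.exp 2 := by rw [Real.exp_add, hNk]
      _ ≤ N ^ (2 * a) * N ^ 2 := by gcongr
      _ = _ := by rw [← pow_add]
  have hinv : ∀ {i j : ℕ}, i + 1 ≤ j → N ^ i * (N ^ j)⁻¹ ≤ N⁻¹ := by
    intro i j hij
    rw [← div_eq_mul_inv, div_le_iff₀ (by positivity), inv_mul_eq_div, le_div_iff₀ hN0, ← pow_succ]
    exact hpow hij
  have hsucc : ∀ k : ℕ, N ^ k = N ^ (k + 1) * N⁻¹ := fun k => by rw [pow_succ]; field_simp
  -- the short windows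
  have hT1 : ((m + m₂ : ℕ) : ℝ) * (μ / (μ - 1)) ^ (m + m₂) * Real.exp (-s) ≤ N⁻¹ := by
    have h1 := hratio (m + m₂) (B + 6) (by push_cast; linarith)
    have h2 : 0 ≤ μ / (μ - 1) := div_nonneg hμ0.le (by linarith)
    calc _ ≤ N ^ 5 * N ^ (2 * (B + 6) + 2) * (N ^ b)⁻¹ := by
          gcongr
          linarith
      _ = N ^ (5 + (2 * (B + 6) + 2)) * (N ^ b)⁻¹ := by rw [← pow_add]
      _ ≤ _ := hinv (by omega)
  -- the dense windows
  have hT2 : V * (((m + m₂ : ℕ) + 1 : ℕ) ^ 2 * Real.exp (-μ)) ≤ N⁻¹ := by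
    have h1 : Real.exp (-μ) ≤ Real.exp (-(1 * y)) := Real.exp_le_exp.2 (by linarith)
    have h2 : N ^ (M + 17) * Real.exp (-(1 * y)) ≤ 1 := hexp₂
    calc _ ≤ N ^ (M + 4) * ((N ^ 5) ^ 2 * Real.exp (-(1 * y))) := by
          gcongr
          rw [Nat.cast_add, Nat.cast_one]
          exact hW
      _ = N ^ (M + 14) * Real.exp (-(1 * y)) := by ring
      _ ≤ N ^ (M + 16) * Real.exp (-(1 * y)) := by gcongr; omega
      _ = N ^ (M + 17) * Real.exp (-(1 * y)) * N⁻¹ := by rw [hsucc (M + 16)]; ring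
      _ ≤ 1 * N⁻¹ := by gcongr
      _ = _ := one_mul _
  -- the calls that arrived before the window
  have hT3 : V * (μ * (μ / (μ + 1)) ^ m) ≤ N⁻¹ := by
    have h1 : (μ / (μ + 1)) ^ m ≤ (N ^ (M + 8))⁻¹ := by
      refine (div_add_one_pow_le_exp (by linarith) m).trans ?_
      rw [← hNk, ← Real.exp_neg, Real.exp_le_exp, neg_le_neg_iff, le_div_iff₀ (by positivity)]
      refine le_trans (le_of_eq ?_) hm1
      rw [hB, hh]; push_cast; ring
    calc _ ≤ N ^ (M + 4) * (N ^ 3 * (N ^ (M + 8))⁻¹) := by gcongr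
      _ = N ^ (M + 7) * (N ^ (M + 8))⁻¹ := by ring
      _ ≤ _ := hinv (by omega)
  -- the initial calls
  have hT4 : V * (E * Real.exp (-s) * (μ / (μ - 1)) ^ m₂) ≤ N⁻¹ := by
    have h1 := hratio m₂ 6 (by push_cast; linarith)
    have h2 : 0 ≤ μ / (μ - 1) := div_nonneg hμ0.le (by linarith)
    calc _ ≤ N ^ (M + 4) * ((N ^ b)⁻¹ * N ^ (2 * 6 + 2)) := by gcongr
      _ = N ^ (M + 18) * (N ^ b)⁻¹ := by ring
      _ ≤ _ := hinv (by omega)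
  -- the layers
  obtain ⟨R, hRle, hRε⟩ := exists_profile_eq hd hx2 (by rw [hNx, hy4]) hy0 L
  have ht1 : (y ^ 3)⁻¹ ≤ 1 := inv_le_one_of_one_le₀ (one_le_pow₀ hy1)
  have ht0 : 0 ≤ (y ^ 3)⁻¹ := by positivity
  have hRN : (R : ℝ) ≤ N := by
    have h1 : (2 : ℝ) ≤ d := by exact_mod_cast hd
    have h2 : Real.log x ≤ x - 1 := Real.log_le_sub_one_of_pos (by linarith)
    have h3 : x ≤ N - 1 := by rw [hx]; exact Real.log_le_sub_one_of_pos hN0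
    have h4 : 1 / 2 ≤ Real.log d := by
      have := Real.log_le_log two_pos h1
      linarith [Real.log_two_gt_d9]
    have h5 : x ≤ N / 2 := by
      have h6 : x = Real.log (N / 4) + Real.log 4 := by
        rw [hx, ← Real.log_mul (by positivity) (by norm_num)]; congr 1; ring
      have h7 : Real.log (N / 4) ≤ N / 4 - 1 := Real.log_le_sub_one_of_pos (by positivity)
      have h8 : Real.log 4 = 2 * Real.log 2 := by
        rw [show (4 : ℝ) = 2 ^ 2 by norm_num, Real.log_pow]; push_cast; ring
      linarith [Real.log_two_lt_d9]
    have h6 : Real.log x / Real.log d ≤ 2 * (x - 1) := by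
      rw [div_le_iff₀ (by linarith)]
      nlinarith only [h2, h4, hx2]
    linarith
  have hT5 : V * (N * (m₂ + 1 : ℕ) * (Real.exp (-(8 * e * lam * N / 3)) +
      R * Real.exp (-(N * ((y ^ 3)⁻¹ / L) / 3)))) ≤ N⁻¹ := by
    have h1 : Real.exp (-(8 * e * lam * N / 3)) ≤ Real.exp (-(c₅ * y)) := by
      rw [Real.exp_le_exp, neg_le_neg_iff]
      calc c₅ * y ≤ 8 * e * lam / 3 * N := by gcongr
        _ = _ := by ring
    have h2 : Real.exp (-(N * ((y ^ 3)⁻¹ / L) / 3)) ≤ Real.exp (-(c₅ * y)) := by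
      rw [Real.exp_le_exp, neg_le_neg_iff]
      calc c₅ * y ≤ 1 / (3 * L) * y := by gcongr
        _ = _ := by rw [← hy4]; field_simp
    have h3 : N ^ (M + 13) * Real.exp (-(c₅ * y)) ≤ 1 := hexp₅
    have hey := Real.exp_pos (-(c₅ * y))
    calc _ ≤ N ^ (M + 4) * (N * N ^ 5 * (Real.exp (-(c₅ * y)) + N * Real.exp (-(c₅ * y)))) := by
          gcongr
      _ = N ^ (M + 10) * ((1 + N) * Real.exp (-(c₅ * y))) := by ring
      _ ≤ N ^ (M + 10) * (N ^ 2 * Real.exp (-(c₅ * y))) := by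
          have h4 : 1 + N ≤ N ^ 2 := by nlinarith only [hN8]
          gcongr
      _ = N ^ (M + 12) * Real.exp (-(c₅ * y)) := by ring
      _ = N ^ (M + 13) * Real.exp (-(c₅ * y)) * N⁻¹ := by rw [hsucc (M + 12)]; ring
      _ ≤ 1 * N⁻¹ := by gcongr
      _ = _ := one_mul _
  -- beyond the profile, the expected number of high calls is of order `n ^ (-1 / 2)`; with
  -- `u = y ^ 2 = √n` the exponential stays bounded, and each of the `h` levels gains a factor `√n`
  have hT6 : V * (N * ((y ^ 2)⁻¹ ^ h * Real.exp ((y ^ 2 - 1) * (N * (α * Real.exp (-((4 * μ)⁻¹ *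
      m₂)) + g * profile d L (y ^ 3)⁻¹ R ^ d) / 4)))) ≤ N⁻¹ := by
    have h1 : Real.exp (-((4 * μ)⁻¹ * m₂)) ≤ (y ^ 6)⁻¹ := by
      have h2 : y ^ 6 = Real.exp (3 / 2 * x) := by
        have h3 : (y ^ 6) ^ 2 = Real.exp (3 / 2 * x) ^ 2 := by
          rw [← pow_mul, show 6 * 2 = 4 * 3 from rfl, pow_mul, hy4, ← hNk, ← Real.exp_nat_mul]
          congr 1; push_cast; ring
        exact (pow_left_inj₀ (by positivity) (Real.exp_pos _).le two_ne_zero).1 h3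
      rw [h2, ← Real.exp_neg, Real.exp_le_exp, neg_le_neg_iff, inv_mul_eq_div,
        le_div_iff₀ (by positivity)]
      linarith
    have h2 : profile d L (y ^ 3)⁻¹ R ^ d ≤ (y ^ 6)⁻¹ := by
      rw [hRε]
      calc ((y ^ 3)⁻¹ / L) ^ d ≤ ((y ^ 3)⁻¹) ^ d := by gcongr; exact div_le_self ht0 hL1
        _ ≤ ((y ^ 3)⁻¹) ^ 2 := pow_le_pow_of_le_one ht0 ht1 hd
        _ = _ := by rw [inv_pow, ← pow_mul]
    have hy21 : 0 ≤ y ^ 2 - 1 := by linarith [one_le_pow₀ hy1 (n := 2)]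
    have h3 : (y ^ 2 - 1) * (N * (α * Real.exp (-((4 * μ)⁻¹ * m₂)) +
        g * profile d L (y ^ 3)⁻¹ R ^ d) / 4) ≤ (α + g) / 4 := by
      calc _ ≤ y ^ 2 * (N * (α * (y ^ 6)⁻¹ + g * (y ^ 6)⁻¹) / 4) := by
            gcongr
            · have : 0 ≤ profile d L (y ^ 3)⁻¹ R ^ d := by rw [hRε]; positivity
              positivity
            · linarith
        _ = _ := by rw [← hy4]; field_simp
    have h4 : (y ^ 2)⁻¹ ^ h = (N ^ (M + 8))⁻¹ := by
      rw [inv_pow, hh, ← hy4, ← pow_mul, ← pow_mul]; congr 2; ring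
    rw [h4]
    calc _ ≤ N ^ (M + 4) * (N * ((N ^ (M + 8))⁻¹ * N)) := by
          gcongr
          exact (Real.exp_le_exp.2 h3).trans hNE
      _ = N ^ (M + 6) * (N ^ (M + 8))⁻¹ := by ring
      _ ≤ _ := hinv (by omega)
  have hDR : k₀ + R + h ≤ D := by
    have : ((k₀ + R + h : ℕ) : ℝ) ≤ D := by
      push_cast at hD ⊢
      linarith
    exact_mod_cast this
  subst hN he hg
  refine (hS.lintegral_lost_le hlam (by omega) hd hbal hint (by linarith) hℓ m m₂ hα hL1 hαL
    (profile_zero ht1) (by positivity) (le_profile (t := (y ^ 3)⁻¹) (by linarith))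
    (mul_profile_pow_le hd hL1 ht1 ht0 hg0.le hgL) hk₀L hDR
    (u := y ^ 2) (one_le_pow₀ hy1)).trans ?_
  apply ENNReal.ofReal_le_ofReal
  rw [← hμ, ← hV, ← hE]
  linarith

end Evolution

/-! ### Every algorithm loses calls in a short window -/

theorem occurrences_add {Ω : Type u} (E : ℕ → Set Ω) {a b e : ℕ} (hab : a ≤ b) (hbe : b ≤ e)
    (ω : Ω) : occurrences E a e ω = occurrences E a b ω + occurrences E b e ω := by
  induction e, hbe using Nat.le_induction with
  | base => rw [occurrences_self, add_zero]
  | succ e hbe ih => rw [occurrences_succ E hbe, occurrences_succ E (hab.trans hbe), ih, add_assoc]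

namespace Evolution

section

variable {n d : ℕ} {Ω : Type u} {S : Evolution n d Ω} {ω : Ω}

open Classical in
/-- The number of calls among `b, …, i - 1` on the link `vw` whose duration is at least `3`. If
the arrivals `b, …, i` fall into an interval of length `3`, all of these are in progress when call
`i` arrives. -/
noncomputable def longCount (S : Evolution n d Ω) (v : Fin n) (b i : ℕ) (ω : Ω) (w : Fin n) : ℕ :=
  occurrences (fun l => {ω | v ∈ (S.call l ω).ends ∧ S.via l ω = some w ∧ 3 ≤ S.dur l ω}) b i ω

/-- The nodes `w` with at least `k` long calls on the link `vw`. -/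
noncomputable def longLevel (S : Evolution n d Ω) (v : Fin n) (b k i : ℕ) (ω : Ω) :
    Finset (Fin n) :=
  Finset.univ.filter fun w => k ≤ S.longCount v b i ω w

/-- The nodes `w` with exactly `k` long calls on the link `vw`. -/
noncomputable def exactLevel (S : Evolution n d Ω) (v : Fin n) (b k i : ℕ) (ω : Ω) :
    Finset (Fin n) :=
  Finset.univ.filter fun w => S.longCount v b i ω w = k

open Classical in
/-- The calls at `v` all of whose candidates have exactly `k` long calls; while there are fewer than
`x / 2` such nodes, all calls at `v`. -/
noncomputable def risingCalls (S : Evolution n d Ω) (v : Fin n) (b : ℕ) (x : ℝ) (k l : ℕ) (ω : Ω) :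
    Finset (Call n d) :=
  Finset.univ.filter fun q => v ∈ q.ends ∧
    (x ≤ 2 * (S.exactLevel v b k l ω).card → ∀ i, q.cand i ∈ S.exactLevel v b k l ω)

/-- Call `l` is long and one of the `risingCalls`: unless it is lost, it creates a new node with
`k + 1` long calls. -/
def riseEvent (S : Evolution n d Ω) (v : Fin n) (b : ℕ) (x : ℝ) (k l : ℕ) : Set Ω :=
  {ω | S.call l ω ∈ S.risingCalls v b x k l ω ∧ 3 ≤ S.dur l ω}

/-- The event that call `l` is lost. -/
def lostEvent (S : Evolution n d Ω) (l : ℕ) : Set Ω := {ω | S.via l ω = none}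

theorem longCount_succ (v : Fin n) {b i : ℕ} (hbi : b ≤ i) (w : Fin n) :
    S.longCount v b i ω w ≤ S.longCount v b (i + 1) ω w := by
  unfold longCount
  rw [occurrences_succ _ hbi]
  exact Nat.le_add_right _ _

theorem longLevel_succ (v : Fin n) {b i : ℕ} (hbi : b ≤ i) (k : ℕ) :
    S.longLevel v b k i ω ⊆ S.longLevel v b k (i + 1) ω := by
  intro w hw
  simp only [longLevel, Finset.mem_filter, Finset.mem_univ, true_and] at hw ⊢
  exact hw.trans (longCount_succ v hbi w)

theorem card_longLevel_mono (v : Fin n) {b i j : ℕ} (hbi : b ≤ i) (hij : i ≤ j) (k : ℕ) :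
    (S.longLevel v b k i ω).card ≤ (S.longLevel v b k j ω).card := by
  induction j, hij using Nat.le_induction with
  | base => exact le_rfl
  | succ j hij ih => exact ih.trans (Finset.card_le_card (longLevel_succ v (hbi.trans hij) k))

theorem card_longLevel_le (v : Fin n) (b k i : ℕ) :
    (S.longLevel v b k i ω).card ≤
      (S.exactLevel v b k i ω).card + (S.longLevel v b (k + 1) i ω).card := by
  classical
  refine (Finset.card_le_card fun w hw => ?_).trans (Finset.card_union_le _ _)
  simp only [longLevel, exactLevel, Finset.mem_filter, Finset.mem_univ, true_and,
    Finset.mem_union] at hw ⊢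
  omega

theorem longCount_le_load (hgap : ∀ j, 0 ≤ S.gap j ω) (hvia : S.ViaOffEnds ω) (v w : Fin n)
    {b i e : ℕ} (hie : i ≤ e) (hshort : S.arrival e ω - S.arrival b ω ≤ 3) :
    S.longCount v b i ω w ≤ S.load i ω v w := by
  classical
  refine le_trans ?_ (card_callsOn_le_load hvia i v w)
  unfold longCount occurrences
  refine Finset.card_le_card fun l hl => ?_
  simp only [Finset.mem_filter, Finset.mem_Ico, Set.mem_ofPred_eq] at hl
  obtain ⟨⟨hbl, hli⟩, hv, hw, hdur⟩ := hl
  rw [mem_callsOn]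
  refine ⟨hli, hv, hw, ?_⟩
  have h1 := arrival_mono hgap hbl
  have h2 := arrival_mono hgap hie
  show S.arrival i ω ≤ S.arrival l ω + S.dur l ω
  linarith

/-- Under the outcome `ω`, every call is routed via an available candidate, if there is one. -/
def RoutesAvailable (S : Evolution n d Ω) (D : ℕ) (ω : Ω) : Prop :=
  ∀ j, (∃ i, S.Available D j ω i ∧ S.via j ω = some ((S.call j ω).cand i)) ∨
    ((∀ i, ¬ S.Available D j ω i) ∧ S.via j ω = none)

variable {D : ℕ}

theorem viaOffEnds_of_route (hroute : S.RoutesAvailable D ω) : S.ViaOffEnds ω := by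
  intro l w hw
  rcases hroute l with ⟨i, -, hi⟩ | ⟨-, hi⟩
  · rw [Option.some_injective _ (hw.symm.trans hi)]
    exact (S.call l ω).cand_notMem i
  · rw [hi] at hw; exact absurd hw (by simp)

/-- During a window that lasts at most time `3`, long calls fill up the capacity of their links, so
no link receives more than `D` of them. -/
theorem longCount_le (hgap : ∀ j, 0 ≤ S.gap j ω) (hroute : S.RoutesAvailable D ω) (v w : Fin n)
    {b i e : ℕ} (hbi : b ≤ i) (hie : i ≤ e) (hshort : S.arrival e ω - S.arrival b ω ≤ 3) :
    S.longCount v b i ω w ≤ D := by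
  induction i, hbi using Nat.le_induction with
  | base => simp [longCount, occurrences_self]
  | succ i hbi ih =>
    have ih := ih (by omega)
    have h1 := longCount_le_load hgap (viaOffEnds_of_route hroute) v w (by omega : i ≤ e) hshort
    unfold longCount at ih h1 ⊢
    rw [occurrences_succ _ hbi]
    split_ifs with h
    · obtain ⟨hv, hw, -⟩ := h
      rcases hroute i with ⟨c, hc, hi⟩ | ⟨-, hi⟩
      · have h2 := hc v hv
        rw [← Option.some_injective _ (hw.symm.trans hi)] at h2
        unfold load at h1
        omega
      · rw [hi] at hw; exact absurd hw (by simp)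
    · omega

/-- A rising call that is not lost creates a new node of level `k + 1`, whichever of its candidates
the algorithm chooses. -/
theorem card_longLevel_lt (hroute : S.RoutesAvailable D ω) {v : Fin n} {b l k : ℕ} (hbl : b ≤ l)
    {x : ℝ} (hx : x ≤ 2 * (S.exactLevel v b k l ω).card) (hl : ω ∈ S.riseEvent v b x k l)
    (hlost : ω ∉ S.lostEvent l) :
    (S.longLevel v b (k + 1) l ω).card < (S.longLevel v b (k + 1) (l + 1) ω).card := by
  obtain ⟨hq, hdur⟩ := hl
  simp only [risingCalls, Finset.mem_filter, Finset.mem_univ, true_and] at hq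
  obtain ⟨hv, hc⟩ := hq
  have hc := hc hx
  rcases hroute l with ⟨c, -, hvia⟩ | ⟨-, hvia⟩
  swap
  · exact absurd hvia hlost
  have hw := hc c
  set w := (S.call l ω).cand c with hwdef
  simp only [exactLevel, Finset.mem_filter, Finset.mem_univ, true_and] at hw
  refine Finset.card_lt_card ((Finset.ssubset_iff_of_subset (longLevel_succ v hbl _)).2 ⟨w, ?_, ?_⟩)
  · simp only [longLevel, Finset.mem_filter, Finset.mem_univ, true_and]
    unfold longCount at hw ⊢
    rw [occurrences_succ _ hbl, hw, if_pos ⟨hv, hvia, hdur⟩]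
  · simp only [longLevel, Finset.mem_filter, Finset.mem_univ, true_and]
    omega

/-- While many nodes have exactly `k` long calls, each occurrence of a `riseEvent` is paid for by a
lost call or by a new node with `k + 1` long calls. -/
theorem occurrences_riseEvent_le (hroute : S.RoutesAvailable D ω) {v : Fin n} {b p e k : ℕ}
    (hbp : b ≤ p) (hpe : p ≤ e) {x : ℝ}
    (hx : ∀ l, p ≤ l → l < e → x ≤ 2 * (S.exactLevel v b k l ω).card) :
    occurrences (S.riseEvent v b x k) p e ω ≤
      occurrences S.lostEvent p e ω + (S.longLevel v b (k + 1) e ω).card := by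
  induction e, hpe using Nat.le_induction with
  | base => simp [occurrences_self]
  | succ e hpe ih =>
    have ih := ih fun l h1 h2 => hx l h1 (by omega)
    have h1 := card_longLevel_mono (S := S) (ω := ω) v (hbp.trans hpe) (by omega : e ≤ e + 1)
      (k + 1)
    rw [occurrences_succ _ hpe, occurrences_succ _ hpe]
    by_cases h2 : ω ∈ S.riseEvent v b x k e
    · by_cases h3 : ω ∈ S.lostEvent e
      · rw [if_pos h2, if_pos h3]; omega
      · have := card_longLevel_lt hroute (hbp.trans hpe) (hx e hpe (Nat.lt_succ_self e)) h2 h3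
        rw [if_pos h2, if_neg h3]; omega
    · rw [if_neg h2]; omega

/-- If the layers rise often enough in the successive slots `[bs k, bs (k + 1))` of a short window,
then calls are lost, since no link can have more than `D` long calls. -/
theorem le_occurrences_lostEvent (hgap : ∀ j, 0 ≤ S.gap j ω) (hroute : S.RoutesAvailable D ω)
    (v : Fin n) {bs : ℕ → ℕ}
    (hbs : Monotone bs) (hshort : S.arrival (bs (D + 1)) ω - S.arrival (bs 0) ω ≤ 3)
    {x : ℕ → ℝ} (hx0 : x 0 ≤ n) (hxpos : ∀ k, 0 < x k) (hxs : ∀ k, x (k + 1) ≤ x k / 2)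
    (hrise : ∀ k ≤ D, 2 * x (k + 1) ≤
      occurrences (S.riseEvent v (bs 0) (x k) k) (bs k) (bs (k + 1)) ω) :
    x (D + 1) ≤ occurrences S.lostEvent (bs 0) (bs (D + 1)) ω := by
  by_contra hlt
  push Not at hlt
  have hanti : Antitone x := antitone_nat_of_succ_le fun k => by
    have := hxs k
    have := hxpos k
    linarith
  -- few calls are lost, so at the end of slot `k` at least `x (k + 1)` nodes have level `k + 1`
  have key : ∀ k ≤ D + 1, x k ≤ (S.longLevel v (bs 0) k (bs k) ω).card := by
    intro k hk
    induction k with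
    | zero => simpa [longLevel] using hx0
    | succ k ih =>
      have ih := ih (by omega)
      by_contra hN
      push Not at hN
      have h1 : ∀ l, bs k ≤ l → l < bs (k + 1) →
          x k ≤ 2 * (S.exactLevel v (bs 0) k l ω).card := by
        intro l hl hl'
        have h2 := card_longLevel_mono (S := S) (ω := ω) v (hbs (Nat.zero_le k)) hl k
        have h3 := card_longLevel_mono (S := S) (ω := ω) v ((hbs (Nat.zero_le k)).trans hl)
          hl'.le (k + 1)
        have h4 := card_longLevel_le (S := S) (ω := ω) v (bs 0) k l
        have h2' : ((S.longLevel v (bs 0) k (bs k) ω).card : ℝ) ≤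
          (S.longLevel v (bs 0) k l ω).card := Nat.cast_le.2 h2
        have h3' : ((S.longLevel v (bs 0) (k + 1) l ω).card : ℝ) ≤
          (S.longLevel v (bs 0) (k + 1) (bs (k + 1)) ω).card := Nat.cast_le.2 h3
        have h4' : ((S.longLevel v (bs 0) k l ω).card : ℝ) ≤
            (S.exactLevel v (bs 0) k l ω).card + (S.longLevel v (bs 0) (k + 1) l ω).card := by
          rw [← Nat.cast_add]; exact Nat.cast_le.2 h4
        have := hxs k
        linarith
      have h2 := occurrences_riseEvent_le hroute (hbs (Nat.zero_le k)) (hbs (by omega : k ≤ k + 1))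
        h1
      have h3 : occurrences S.lostEvent (bs k) (bs (k + 1)) ω ≤
          occurrences S.lostEvent (bs 0) (bs (D + 1)) ω := by
        rw [occurrences_add _ (hbs (Nat.zero_le k)) (hbs (by omega : k ≤ D + 1)),
          occurrences_add _ (hbs (by omega : k ≤ k + 1)) (hbs hk)]
        omega
      have h2' : (occurrences (S.riseEvent v (bs 0) (x k) k) (bs k) (bs (k + 1)) ω : ℝ) ≤
          occurrences S.lostEvent (bs k) (bs (k + 1)) ω +
            (S.longLevel v (bs 0) (k + 1) (bs (k + 1)) ω).card := by
        rw [← Nat.cast_add]; exact Nat.cast_le.2 h2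
      have h3' : (occurrences S.lostEvent (bs k) (bs (k + 1)) ω : ℝ) ≤
          occurrences S.lostEvent (bs 0) (bs (D + 1)) ω := Nat.cast_le.2 h3
      have h4 := hrise k (by omega)
      have h5 := hanti hk
      linarith
  have h1 := key (D + 1) le_rfl
  have h2 : S.longLevel v (bs 0) (D + 1) (bs (D + 1)) ω = ∅ := by
    rw [longLevel, Finset.filter_eq_empty_iff]
    intro w _
    have := longCount_le hgap hroute v w (hbs (Nat.zero_le _)) le_rfl hshort
    omega
  rw [h2, Finset.card_empty, Nat.cast_zero] at h1
  exact absurd h1 (not_le.2 (hxpos _))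

/-- A rising call has conditional probability at least `(2 / n) (x / 4 n) ^ d`. -/
theorem le_card_risingCalls (hn : 3 ≤ n) (v : Fin n) (b k l : ℕ) {x : ℝ} (hx8 : 8 ≤ x)
    (hxn : x ≤ n) :
    2 / n * (x / (4 * n)) ^ d ≤ (S.risingCalls v b x k l ω).card * callMass n d := by
  classical
  have hn3 : (3 : ℝ) ≤ n := by exact_mod_cast hn
  set Y : Finset (Fin n) := if x ≤ 2 * (S.exactLevel v b k l ω).card then S.exactLevel v b k l ω
    else Finset.univ with hY
  have hYx : x ≤ 2 * Y.card := by
    rw [hY]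
    split_ifs with h
    · exact h
    · simp only [Finset.card_univ, Fintype.card_fin]; linarith
  have hB : ∀ u, x / 4 ≤ ((Y \ {v, u}).card : ℝ) := by
    intro u
    have h1 := Finset.le_card_sdiff {v, u} Y
    have h2 : ({v, u} : Finset (Fin n)).card ≤ 2 := Finset.card_le_two
    have h3 : Y.card ≤ (Y \ {v, u}).card + 2 := by omega
    have h3' : (Y.card : ℝ) ≤ (Y \ {v, u}).card + 2 := by exact_mod_cast h3
    linarith
  have h1 := le_card_calls v (fun u => Y \ {v, u}) (T := S.risingCalls v b x k l ω)
    (fun u => by simp) (fun q hv hq => by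
      simp only [risingCalls, Finset.mem_filter, Finset.mem_univ, true_and]
      refine ⟨hv, fun hbig i => ?_⟩
      have h2 := (Finset.mem_sdiff.1 (hq i)).1
      rwa [hY, if_pos hbig] at h2)
  have h2 : ((n : ℝ) - 1) * (x / 4) ^ d ≤ (S.risingCalls v b x k l ω).card := by
    calc ((n : ℝ) - 1) * (x / 4) ^ d = ∑ u ∈ Finset.univ.erase v, (x / 4) ^ d := by
          rw [Finset.sum_const, nsmul_eq_mul, Finset.card_erase_of_mem (Finset.mem_univ v),
            Finset.card_univ, Fintype.card_fin, Nat.cast_pred (by omega)]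
      _ ≤ ∑ u ∈ Finset.univ.erase v, ((Y \ {v, u}).card : ℝ) ^ d :=
          Finset.sum_le_sum fun u _ => pow_le_pow_left₀ (by linarith) (hB u) d
      _ ≤ _ := by
          have := (Nat.cast_le (α := ℝ)).2 h1
          push_cast at this
          exact this
  refine le_trans ?_ (mul_le_mul_of_nonneg_right h2 (callMass_nonneg hn))
  rw [card_mul_callMass hn]
  have h3 : x / (4 * n) = x / 4 / n := by rw [div_div]
  rw [h3]
  gcongr
  · linarith
  · linarith

end

variable {n d : ℕ} {Ω : Type u} [mΩ : MeasurableSpace Ω] {S : Evolution n d Ω} {lam : ℝ}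
  {P : Measure Ω}

theorem IsModel.measurable_longCount (hS : S.IsModel lam P) (v : Fin n) (b i : ℕ) (w : Fin n) :
    Measurable[S.past i] fun ω => S.longCount v b i ω w := by
  rcases lt_or_ge i b with hib | hbi
  · have h0 : (fun ω => S.longCount v b i ω w) = fun _ => 0 := by
      funext ω
      simp [longCount, occurrences, Finset.Ico_eq_empty_of_le hib.le]
    rw [h0]
    exact measurable_const
  refine measurable_occurrences S.past_mono (fun l => ?_) hbi
  have h1 := S.measurableSet_call_past (Nat.lt_succ_self l) {q | v ∈ q.ends}
  have h2 := hS.measurableSet_via (Nat.lt_succ_self l) (some w)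
  have h3 := S.measurable_dur_past (Nat.lt_succ_self l)
  let _ := S.past (l + 1)
  exact h1.inter (h2.inter (measurableSet_le measurable_const h3))

theorem IsModel.measurableSet_mem_risingCalls (hS : S.IsModel lam P) (v : Fin n) (b : ℕ) (x : ℝ)
    (k l : ℕ) (q : Call n d) : MeasurableSet[S.past l] {ω | q ∈ S.risingCalls v b x k l ω} := by
  classical
  have h1 := fun w => hS.measurable_longCount v b l w
  let _ := S.past l
  have h2 : ∀ w, MeasurableSet {ω | S.longCount v b l ω w = k} := fun w =>
    h1 w (MeasurableSet.singleton k)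
  have h3 : Measurable fun ω => (S.exactLevel v b k l ω).card := by
    simp only [exactLevel, Finset.card_filter]
    exact Finset.measurable_sum _ fun w _ => Measurable.ite (h2 w) measurable_const measurable_const
  have h4 : {ω | q ∈ S.risingCalls v b x k l ω} = {ω | v ∈ q.ends} ∩
      ({ω | x ≤ 2 * ((S.exactLevel v b k l ω).card : ℝ)}ᶜ ∪
        ⋂ i, {ω | S.longCount v b l ω (q.cand i) = k}) := by
    ext ω
    simp only [risingCalls, exactLevel, Finset.mem_filter, Finset.mem_univ, true_and,
      Set.mem_ofPred_eq, Set.mem_inter_iff, Set.mem_union, Set.mem_compl_iff, Set.mem_iInter]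
    tauto
  rw [h4]
  refine (MeasurableSet.const _).inter ((MeasurableSet.compl ?_).union
    (MeasurableSet.iInter fun i => h2 _))
  exact measurableSet_le measurable_const ((measurable_from_nat.comp h3).const_mul 2)

theorem IsModel.measurableSet_riseEvent (hS : S.IsModel lam P) (v : Fin n) (b : ℕ) (x : ℝ)
    (k l : ℕ) : MeasurableSet[S.past (l + 1)] (S.riseEvent v b x k l) := by
  have h1 := fun q => S.past_mono (Nat.le_succ l) _ (hS.measurableSet_mem_risingCalls v b x k l q)
  have h2 := fun q => S.measurableSet_call_past (Nat.lt_succ_self l) {q}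
  have h5 := S.measurable_dur_past (Nat.lt_succ_self l)
  let _ := S.past (l + 1)
  have : S.riseEvent v b x k l = (⋃ q, {ω | q ∈ S.risingCalls v b x k l ω} ∩
      {ω | S.call l ω ∈ ({q} : Set (Call n d))}) ∩ {ω | 3 ≤ S.dur l ω} := by
    ext ω; simp [riseEvent]
  rw [this]
  exact (MeasurableSet.iUnion fun q => (h1 q).inter (h2 q)).inter
    (measurableSet_le measurable_const h5)

variable [IsProbabilityMeasure P]

theorem IsModel.prob_occurrences_riseEvent_lt (hS : S.IsModel lam P) (hn : 3 ≤ n) (v : Fin n)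
    (b k : ℕ) {x z : ℝ} (hx8 : 8 ≤ x) (hxn : x ≤ n) {p e : ℕ} (hpe : p ≤ e) {A : Set Ω}
    (hA : MeasurableSet[S.past p] A)
    (hz : 4 * z ≤ (e - p : ℕ) * (2 / n * (x / (4 * n)) ^ d * Real.exp (-3))) :
    P (A ∩ {ω | (occurrences (S.riseEvent v b x k) p e ω : ℝ) < z}) ≤
      ENNReal.ofReal (Real.exp (-z)) * P A := by
  refine chernoff_lower S.past_mono hS.past_le (hS.measurableSet_riseEvent v b x k) hpe hA
    (by positivity) (fun l hl _ Z hZ => ?_) hz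
  exact hS.le_setLIntegral_call_dur l (hS.measurableSet_mem_risingCalls v b x k l)
    (by norm_num) (S.past_mono hl _ hA) (fun ω _ => le_card_risingCalls hn v b k l hx8 hxn) hZ

/-- Given an event `A` in the past, it is unlikely that a window of arrivals lasts at most time `3`
and has fewer than `x (D + 1)` losses. -/
theorem IsModel.prob_lost_window_lt (hS : S.IsModel lam P) (hn : 3 ≤ n) {D : ℕ}
    (hroute : S.IsGDAR D P) {bs : ℕ → ℕ} (hbs : Monotone bs) {x : ℕ → ℝ} (hx0 : x 0 ≤ n)
    (hx8 : ∀ k ≤ D + 1, 8 ≤ x k) (hxpos : ∀ k, 0 < x k) (hxs : ∀ k, x (k + 1) ≤ x k / 2)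
    (hslot : ∀ k ≤ D, 4 * (2 * x (k + 1)) ≤ (bs (k + 1) - bs k : ℕ) *
      (2 / n * (x k / (4 * n)) ^ d * Real.exp (-3)))
    {A : Set Ω} (hA : MeasurableSet[S.past (bs 0)] A) :
    P (A ∩ {ω | S.arrival (bs (D + 1)) ω - S.arrival (bs 0) ω ≤ 3} ∩
        {ω | (occurrences S.lostEvent (bs 0) (bs (D + 1)) ω : ℝ) < x (D + 1)}) ≤
      ENNReal.ofReal ((D + 1 : ℕ) * Real.exp (-(2 * x (D + 1)))) * P A := by
  set v : Fin n := ⟨0, by omega⟩ with hv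
  have hanti : Antitone x := antitone_nat_of_succ_le fun k => by
    have := hxs k
    have := hxpos k
    linarith
  have hsub : ∀ᵐ ω ∂P, ω ∈ A ∩ {ω | S.arrival (bs (D + 1)) ω - S.arrival (bs 0) ω ≤ 3} ∩
        {ω | (occurrences S.lostEvent (bs 0) (bs (D + 1)) ω : ℝ) < x (D + 1)} →
      ω ∈ ⋃ k ∈ Finset.range (D + 1), A ∩ {ω | (occurrences (S.riseEvent v (bs 0) (x k) k)
        (bs k) (bs (k + 1)) ω : ℝ) < 2 * x (k + 1)} := by
    filter_upwards [hroute, hS.ae_gap_nonneg] with ω h1 h2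
    rintro ⟨⟨hωA, hshort⟩, hlost⟩
    by_contra hcon
    simp only [Set.mem_iUnion, Finset.mem_range, not_exists] at hcon
    have hlost' : (occurrences S.lostEvent (bs 0) (bs (D + 1)) ω : ℝ) < x (D + 1) := hlost
    refine absurd (le_occurrences_lostEvent h2 h1 v hbs hshort hx0 hxpos hxs fun k hk => ?_)
      (not_le.2 hlost')
    by_contra hlt
    exact hcon k (by omega) ⟨hωA, not_le.1 hlt⟩
  refine (measure_mono_ae hsub).trans ((measure_biUnion_finset_le _ _).trans ?_)
  calc _ ≤ ∑ k ∈ Finset.range (D + 1),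
          ENNReal.ofReal (Real.exp (-(2 * x (D + 1)))) * P A := by
        refine Finset.sum_le_sum fun k hk => ?_
        rw [Finset.mem_range] at hk
        refine (hS.prob_occurrences_riseEvent_lt hn v (bs 0) k (hx8 k (by omega))
          ((hanti (Nat.zero_le k)).trans hx0) (hbs (Nat.le_succ k))
          (S.past_mono (hbs (Nat.zero_le k)) _ hA) (hslot k (by omega))).trans ?_
        gcongr
        exact hanti (by omega)
    _ = _ := by
        rw [Finset.sum_const, Finset.card_range, nsmul_eq_mul, ← mul_assoc,
          ENNReal.ofReal_mul (Nat.cast_nonneg _), ENNReal.ofReal_natCast]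

end Evolution

/-! ### Windows after the first arrival in an interval -/

namespace Evolution

/-- Call `j` is the first one to arrive at or after time `t`. -/
def firstArrival {n d : ℕ} {Ω : Type u} (S : Evolution n d Ω) (t : ℝ) (j : ℕ) : Set Ω :=
  {ω | (∀ i < j, S.arrival i ω < t) ∧ t ≤ S.arrival j ω}

theorem measurableSet_firstArrival {n d : ℕ} {Ω : Type u} (S : Evolution n d Ω) (t : ℝ) (j : ℕ) :
    MeasurableSet[S.gapsBefore (j + 1)] (S.firstArrival t j) := by
  have hm := fun i (h : i < j + 1) => S.measurable_arrival_gapsBefore h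
  let _ := S.gapsBefore (j + 1)
  have : S.firstArrival t j = (⋂ i, ⋂ (_ : i < j), {ω | S.arrival i ω < t}) ∩
      {ω | t ≤ S.arrival j ω} := by
    ext ω; simp [firstArrival]
  rw [this]
  exact (MeasurableSet.iInter fun i => MeasurableSet.iInter fun hi =>
    measurableSet_lt (hm i (by omega)) measurable_const).inter
    (measurableSet_le measurable_const (hm j (by omega)))

theorem disjoint_firstArrival {n d : ℕ} {Ω : Type u} (S : Evolution n d Ω) (t : ℝ) :
    Pairwise (Function.onFun Disjoint (S.firstArrival t)) := by
  have key : ∀ i j, i < j → Disjoint (S.firstArrival t i) (S.firstArrival t j) := by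
    intro i j hij
    rw [Set.disjoint_left]
    rintro ω ⟨-, h1⟩ ⟨h2, -⟩
    exact absurd (h2 i hij) (not_lt.2 h1)
  intro i j hij
  rcases lt_or_gt_of_ne hij with h | h
  · exact key i j h
  · exact (key j i h).symm

theorem occurrences_le_lost {n d : ℕ} {Ω : Type u} {S : Evolution n d Ω} {ω : Ω}
    (hgap : ∀ j, 0 ≤ S.gap j ω) {a b : ℝ} {i j : ℕ} (ha : a ≤ S.arrival i ω)
    (hb : S.arrival j ω ≤ b) :
    (occurrences S.lostEvent i j ω : ℝ≥0∞) ≤ S.lost a b ω := by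
  classical
  unfold occurrences lost
  have h : (((Finset.Ico i j).filter fun l => ω ∈ S.lostEvent l : Finset ℕ) : Set ℕ) ⊆
      {j : ℕ | S.arrival j ω ∈ Set.Icc a b ∧ S.via j ω = none} := by
    intro l hl
    simp only [Finset.coe_filter, Finset.mem_Ico, Set.mem_ofPred_eq] at hl
    exact ⟨⟨ha.trans (arrival_mono hgap hl.1.1), (arrival_mono hgap hl.1.2.le).trans hb⟩, hl.2⟩
  have h2 := Set.encard_le_encard h
  rw [Set.encard_coe_eq_coe_finsetCard] at h2
  have h3 := ENat.toENNReal_mono h2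
  simpa using h3

theorem mul_le_occurrences {Ω : Type u} (E : ℕ → Set Ω) (ω : Ω) {x : ℝ} (b m N : ℕ)
    (h : ∀ s < N, x ≤ occurrences E (b + s * m) (b + s * m + m) ω) :
    N * x ≤ occurrences E b (b + N * m) ω := by
  induction N with
  | zero => simp [occurrences_self]
  | succ N ih =>
    have h1 := ih fun s hs => h s (by omega)
    have h2 := h N (by omega)
    rw [show b + (N + 1) * m = b + N * m + m by ring,
      occurrences_add E (b := b + N * m) (by omega) (by omega)]
    push_cast
    linarith

variable {n d : ℕ} {Ω : Type u} [mΩ : MeasurableSpace Ω] {S : Evolution n d Ω} {lam : ℝ}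
  {P : Measure Ω}

/-- A window of `m ≤ μ` arrivals lasts longer than time `3` only with exponentially small
probability. -/
theorem IsModel.prob_long_window_le (hS : S.IsModel lam P) (hμ : 0 < rate lam n) (b m : ℕ)
    {A : Set Ω} (hA : MeasurableSet[S.gapsBefore (b + 1)] A) :
    P (A ∩ {ω | 3 < S.arrival (b + m) ω - S.arrival b ω}) ≤
      ENNReal.ofReal (2 ^ m * Real.exp (-(3 / 2 * rate lam n))) * P A := by
  set μ := rate lam n with hμdef
  have hAm : MeasurableSet A := hS.gapsBefore_le _ _ hA
  have hZ : Measurable[S.gapsBefore (b + 1)] (A.indicator (1 : Ω → ℝ≥0∞)) := by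
    let _ := S.gapsBefore (b + 1)
    exact measurable_one.indicator hA
  have h1 := hS.lintegral_mul_exp_arrival_sub hμ (θ := -(μ / 2)) (by linarith) b m hZ
  have h2 : μ / (μ + -(μ / 2)) = 2 := by field_simp; ring
  rw [← hμdef, h2, lintegral_indicator_one hAm] at h1
  rw [mul_comm ((2 : ℝ) ^ m), ENNReal.ofReal_mul (Real.exp_pos _).le, mul_assoc, ← h1]
  have hb := hS.measurable_arrival b
  have hbm := hS.measurable_arrival (b + m)
  have hm : MeasurableSet (A ∩ {ω | 3 < S.arrival (b + m) ω - S.arrival b ω}) :=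
    hAm.inter (measurableSet_lt measurable_const (hbm.sub hb))
  have hw : Measurable fun ω => A.indicator (1 : Ω → ℝ≥0∞) ω * ENNReal.ofReal
      (Real.exp (-(-(μ / 2) * (S.arrival (b + m) ω - S.arrival b ω)))) :=
    (measurable_one.indicator hAm).mul (by fun_prop)
  rw [← lintegral_const_mul _ hw, ← lintegral_indicator_one hm]
  refine lintegral_mono fun ω => ?_
  by_cases hω : ω ∈ A ∩ {ω | 3 < S.arrival (b + m) ω - S.arrival b ω}
  · rw [Set.indicator_of_mem hω, Set.indicator_of_mem hω.1, Pi.one_apply, one_mul,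
      ← ENNReal.ofReal_mul (Real.exp_pos _).le, ← Real.exp_add, ← ENNReal.ofReal_one]
    apply ENNReal.ofReal_le_ofReal
    rw [Real.one_le_exp_iff]
    have h3 : 3 < S.arrival (b + m) ω - S.arrival b ω := hω.2
    nlinarith
  · rw [Set.indicator_of_notMem hω]; exact zero_le

/-- The first arrival at or after time `t` comes before time `t + 1` except with probability
`exp (-μ)`, since the gaps are memoryless. -/
theorem IsModel.prob_overshoot_le [IsProbabilityMeasure P] (hS : S.IsModel lam P)
    (hμ : 0 < rate lam n) {t : ℝ} (ht : 0 ≤ t) (j : ℕ) :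
    P (S.firstArrival t j ∩ {ω | t + 1 < S.arrival j ω}) ≤
      ENNReal.ofReal (Real.exp (-rate lam n)) * P (S.firstArrival t j) := by
  set μ := rate lam n with hμdef
  set prev : Ω → ℝ := fun ω => ∑ i ∈ Finset.range j, S.gap i ω with hprev
  have harr : ∀ ω, S.arrival j ω = prev ω + S.gap j ω := fun ω => Finset.sum_range_succ _ _
  set U : Set Ω := {ω | ∀ i < j, S.arrival i ω < t} with hU
  have hUt : ∀ ω ∈ U, prev ω ≤ t := by
    intro ω hω
    rcases Nat.eq_zero_or_pos j with h | h
    · simpa [hprev, h] using ht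
    · have h1 := hω (j - 1) (by omega)
      have h2 : prev ω = S.arrival (j - 1) ω := by
        simp only [hprev, arrival]; rw [Nat.sub_add_cancel h]
      rw [h2]; exact h1.le
  have hUm : MeasurableSet[S.gapsBefore j] U := by
    have hm := fun i (h : i < j) => S.measurable_arrival_gapsBefore h
    let _ := S.gapsBefore j
    have : U = ⋂ i, ⋂ (_ : i < j), {ω | S.arrival i ω < t} := by ext ω; simp [hU]
    rw [this]
    exact MeasurableSet.iInter fun i => MeasurableSet.iInter fun hi =>
      measurableSet_lt (hm i hi) measurable_const
  have hpm : Measurable[S.gapsBefore j] prev :=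
    Finset.measurable_sum _ fun i hi => S.measurable_gap_gapsBefore (Finset.mem_range.1 hi)
  have hf : Measurable[S.gapsBefore j] (U.indicator (1 : Ω → ℝ≥0∞)) := by
    let _ := S.gapsBefore j
    exact measurable_one.indicator hUm
  have key : ∀ r : ℝ, 0 ≤ r → P (U ∩ {ω | t + r - prev ω ≤ S.gap j ω}) =
      ENNReal.ofReal (Real.exp (-(μ * r))) *
        ∫⁻ ω, U.indicator 1 ω * ENNReal.ofReal (Real.exp (-(μ * (t - prev ω)))) ∂P := by
    intro r hr
    have ha : Measurable[S.gapsBefore j] fun ω => t + r - prev ω := measurable_const.sub hpm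
    have h1 := lintegral_mul_indicator_exp (hS.gapsBefore_le j) (hS.measurable_gap j)
      (hS.indep_gap j) hμ (hS.law_gap j) hf ha
    have hpm' : Measurable prev := hpm.mono (hS.gapsBefore_le j) le_rfl
    have hU' : MeasurableSet U := hS.gapsBefore_le j _ hUm
    have h2 : MeasurableSet {ω | t + r - prev ω ≤ S.gap j ω} :=
      measurableSet_le (measurable_const.sub hpm') (hS.measurable_gap j)
    rw [← lintegral_indicator_one (hU'.inter h2)]
    simp_rw [Set.inter_indicator_one, Pi.mul_apply]
    have hw : Measurable fun ω => U.indicator (1 : Ω → ℝ≥0∞) ω *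
        ENNReal.ofReal (Real.exp (-(μ * (t - prev ω)))) :=
      (measurable_one.indicator hU').mul (by fun_prop)
    rw [h1, ← lintegral_const_mul _ hw]
    refine lintegral_congr fun ω => ?_
    by_cases hω : ω ∈ U
    · have h3 := hUt ω hω
      simp only [Set.indicator_of_mem hω, Pi.one_apply, one_mul]
      rw [max_eq_left (by linarith), ← ENNReal.ofReal_mul (Real.exp_pos _).le, ← Real.exp_add]
      congr 2
      ring
    · simp [hω]
  have h0 := key 0 le_rfl
  have h1 := key 1 zero_le_one
  have hF : S.firstArrival t j = U ∩ {ω | t + 0 - prev ω ≤ S.gap j ω} := by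
    ext ω
    have := harr ω
    simp only [firstArrival, hU, Set.mem_ofPred_eq, Set.mem_inter_iff, and_congr_right_iff]
    intro _
    constructor <;> intro h <;> linarith
  rw [mul_zero, neg_zero, Real.exp_zero, ENNReal.ofReal_one, one_mul, ← hF] at h0
  rw [mul_one, ← h0] at h1
  refine (measure_mono ?_).trans h1.le
  rintro ω ⟨⟨h2, -⟩, h3⟩
  have h3' : t + 1 < S.arrival j ω := h3
  have := harr ω
  exact ⟨h2, by simp only [Set.mem_ofPred_eq]; linarith⟩

theorem IsModel.ae_exists_firstArrival (hS : S.IsModel lam P) (hμ : 0 < rate lam n) (t : ℝ) :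
    ∀ᵐ ω ∂P, ∃ j, ω ∈ S.firstArrival t j := by
  set μ := rate lam n with hμdef
  have h1 : ∀ j, P {ω | ¬ ∃ j, ω ∈ S.firstArrival t j} ≤
      ENNReal.ofReal (Real.exp t * (μ / (μ + 1)) ^ (j + 1)) := by
    intro j
    have hm := hS.measurable_arrival j
    have h2 : {ω | ¬ ∃ j, ω ∈ S.firstArrival t j} ⊆ {ω | S.arrival j ω < t} := by
      intro ω hω
      by_contra hcon
      have h3 : ∃ j, t ≤ S.arrival j ω := ⟨j, not_lt.1 hcon⟩
      classical
      exact hω ⟨Nat.find h3, fun i hi => not_le.1 (Nat.find_min h3 hi), Nat.find_spec h3⟩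
    have h4 := hS.lintegral_exp_arrival hμ (θ := 1) (by linarith) j
    rw [← hμdef] at h4
    rw [ENNReal.ofReal_mul (Real.exp_pos _).le, ← h4,
      ← lintegral_const_mul _ (by fun_prop)]
    refine (measure_mono h2).trans ?_
    rw [← lintegral_indicator_one (measurableSet_lt hm measurable_const)]
    refine lintegral_mono fun ω => ?_
    by_cases hω : ω ∈ {ω | S.arrival j ω < t}
    · rw [Set.indicator_of_mem hω, Pi.one_apply, ← ENNReal.ofReal_mul (Real.exp_pos _).le,
        ← Real.exp_add, ← ENNReal.ofReal_one]
      apply ENNReal.ofReal_le_ofReal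
      rw [Real.one_le_exp_iff]
      have : S.arrival j ω < t := hω
      linarith
    · rw [Set.indicator_of_notMem hω]; exact zero_le
  have hlt : μ / (μ + 1) < 1 := by rw [div_lt_one (by positivity)]; linarith
  have h2 : Tendsto (fun j : ℕ => ENNReal.ofReal (Real.exp t * (μ / (μ + 1)) ^ (j + 1))) atTop
      (𝓝 0) := by
    rw [← ENNReal.ofReal_zero, ← mul_zero (Real.exp t)]
    exact ENNReal.tendsto_ofReal (((tendsto_pow_atTop_nhds_zero_of_lt_one (by positivity) hlt).comp
      (tendsto_add_atTop_nat 1)).const_mul _)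
  rw [ae_iff]
  exact le_antisymm (ge_of_tendsto' h2 h1) zero_le

/-- Every algorithm loses many calls in each of `N` successive windows of `∑ k ≤ D, ml k` arrivals
from time `t` on, and these windows have total length at most `3 * N`, except with small
probability. -/
theorem IsModel.prob_lost_lt_le [IsProbabilityMeasure P] (hS : S.IsModel lam P) (hn : 3 ≤ n)
    (hμ : 0 < rate lam n) {D : ℕ}
    (hroute : S.IsGDAR D P) {ml : ℕ → ℕ} {x : ℕ → ℝ} (hx0 : x 0 ≤ n)
    (hx8 : ∀ k ≤ D + 1, 8 ≤ x k) (hxpos : ∀ k, 0 < x k) (hxs : ∀ k, x (k + 1) ≤ x k / 2)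
    (hslot : ∀ k ≤ D, 4 * (2 * x (k + 1)) ≤ ml k *
      (2 / n * (x k / (4 * n)) ^ d * Real.exp (-3)))
    {t : ℝ} (ht : 0 ≤ t) (N : ℕ) :
    P {ω | S.lost t (t + (1 + 3 * N)) ω < ENNReal.ofReal (N * x (D + 1))} ≤
      ENNReal.ofReal (Real.exp (-rate lam n) +
        N * (2 ^ (∑ k ∈ Finset.range (D + 1), ml k) * Real.exp (-(3 / 2 * rate lam n)) +
          (D + 1 : ℕ) * Real.exp (-(2 * x (D + 1))))) := by
  set μ := rate lam n with hμdef
  set m := ∑ k ∈ Finset.range (D + 1), ml k with hm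
  set F := S.firstArrival t with hF
  set bs : ℕ → ℕ → ℕ := fun b k => b + ∑ i ∈ Finset.range k, ml i with hbs
  have hbs0 : ∀ b, bs b 0 = b := fun b => by simp [hbs]
  have hbsD : ∀ b, bs b (D + 1) = b + m := fun b => rfl
  have hbss : ∀ b k, bs b (k + 1) = bs b k + ml k := fun b k => by
    simp only [hbs, Finset.sum_range_succ, add_assoc]
  have hbsmono : ∀ b, Monotone (bs b) := fun b => monotone_nat_of_le_succ fun k => by
    rw [hbss]; omega
  set long : ℕ → Set Ω := fun b => {ω | 3 < S.arrival (b + m) ω - S.arrival b ω} with hlong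
  set few : ℕ → Set Ω := fun b => {ω | S.arrival (b + m) ω - S.arrival b ω ≤ 3} ∩
    {ω | (occurrences S.lostEvent b (b + m) ω : ℝ) < x (D + 1)} with hfew
  have hcover : ∀ᵐ ω ∂P, ω ∈ {ω | S.lost t (t + (1 + 3 * N)) ω < ENNReal.ofReal (N * x (D + 1))} →
      ω ∈ ⋃ j, (F j ∩ {ω | t + 1 < S.arrival j ω}) ∪
        ⋃ s ∈ Finset.range N, (F j ∩ long (j + s * m)) ∪ (F j ∩ few (j + s * m)) := by
    filter_upwards [hS.ae_gap_nonneg, hS.ae_exists_firstArrival hμ t] with ω hgap ⟨j, hj⟩ hω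
    refine Set.mem_iUnion.2 ⟨j, ?_⟩
    by_cases h1 : t + 1 < S.arrival j ω
    · exact Or.inl ⟨hj, h1⟩
    refine Or.inr ?_
    by_contra hcon
    simp only [Set.mem_iUnion, Finset.mem_range, not_exists] at hcon
    have hshort : ∀ s < N, S.arrival (j + s * m + m) ω - S.arrival (j + s * m) ω ≤ 3 :=
      fun s hs => not_lt.1 fun h => hcon s hs (Or.inl ⟨hj, h⟩)
    have hmany : ∀ s < N, x (D + 1) ≤
        occurrences S.lostEvent (j + s * m) (j + s * m + m) ω :=
      fun s hs => not_lt.1 fun h => hcon s hs (Or.inr ⟨hj, hshort s hs, h⟩)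
    have htime : ∀ s ≤ N, S.arrival (j + s * m) ω ≤ S.arrival j ω + 3 * s := by
      intro s hs
      induction s with
      | zero => simp
      | succ s ih =>
        have h2 := ih (by omega)
        have h3 := hshort s (by omega)
        rw [show j + (s + 1) * m = j + s * m + m by ring]
        push_cast
        linarith
    have h2 := htime N le_rfl
    have h3 := occurrences_le_lost hgap (b := t + (1 + 3 * N)) hj.2 (j := j + N * m) (by linarith)
    have h4 := mul_le_occurrences S.lostEvent ω j m N hmany
    have h5 : S.lost t (t + (1 + 3 * N)) ω < ENNReal.ofReal (N * x (D + 1)) := hω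
    refine absurd (h3.trans_lt h5) (not_lt.2 ?_)
    rw [← ENNReal.ofReal_natCast]
    exact ENNReal.ofReal_le_ofReal h4
  have hx0' : 0 ≤ Real.exp (-(3 / 2 * μ)) := (Real.exp_pos _).le
  set p₁ := 2 ^ m * Real.exp (-(3 / 2 * μ)) with hp₁
  set p₂ := (D + 1 : ℕ) * Real.exp (-(2 * x (D + 1))) with hp₂
  have hp₁0 : 0 ≤ p₁ := by positivity
  have hp₂0 : 0 ≤ p₂ := by positivity
  have hFle : ∀ {j b : ℕ}, j ≤ b → MeasurableSet[S.gapsBefore (b + 1)] (F j) := fun hjb =>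
    S.gapsBefore_mono (by omega) _ (S.measurableSet_firstArrival t _)
  have hj : ∀ j, P ((F j ∩ {ω | t + 1 < S.arrival j ω}) ∪
        ⋃ s ∈ Finset.range N, (F j ∩ long (j + s * m)) ∪ (F j ∩ few (j + s * m))) ≤
      ENNReal.ofReal (Real.exp (-μ) + N * (p₁ + p₂)) * P (F j) := by
    intro j
    have hw : ∀ s, P ((F j ∩ long (j + s * m)) ∪ (F j ∩ few (j + s * m))) ≤
        ENNReal.ofReal (p₁ + p₂) * P (F j) := by
      intro s
      have hA := hFle (show j ≤ j + s * m by omega)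
      have h1 := hS.prob_long_window_le hμ (j + s * m) m hA
      have h2 := hS.prob_lost_window_lt hn hroute (hbsmono (j + s * m)) hx0 hx8 hxpos hxs
        (fun k hk => by rw [hbss, Nat.add_sub_cancel_left]; exact hslot k hk)
        (A := F j) (by rw [hbs0]; exact S.gapsBefore_le_past _ _ _ hA)
      rw [hbs0, hbsD, Set.inter_assoc] at h2
      rw [ENNReal.ofReal_add hp₁0 hp₂0, add_mul]
      exact (measure_union_le _ _).trans (add_le_add h1 h2)
    refine (measure_union_le _ _).trans ((add_le_add (hS.prob_overshoot_le hμ ht j)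
      ((measure_biUnion_finset_le _ _).trans (Finset.sum_le_sum fun s _ => hw s))).trans ?_)
    rw [Finset.sum_const, Finset.card_range, nsmul_eq_mul, ← mul_assoc, ← add_mul,
      ← ENNReal.ofReal_natCast, ← ENNReal.ofReal_mul (Nat.cast_nonneg _),
      ← ENNReal.ofReal_add (Real.exp_pos _).le (by positivity)]
  refine (measure_mono_ae hcover).trans ((measure_iUnion_le _).trans
    ((ENNReal.tsum_le_tsum hj).trans ?_))
  rw [ENNReal.tsum_mul_left, ← measure_iUnion (S.disjoint_firstArrival t)
    fun j => hS.gapsBefore_le _ _ (S.measurableSet_firstArrival t j)]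
  exact mul_le_of_le_one_right zero_le prob_le_one

end Evolution

/-! ### Every algorithm loses many calls in a long interval -/

/-- A lower bound for the proportion of nodes that reach level `k` in a short window. The main term
`(β + 2) * d ^ k` of the exponent is multiplied by `d` from level to level; `k + β` absorbs the
constants and the decreasing lengths of the slots, see `levelProfile_succ_le`. -/
noncomputable def levelProfile (d : ℕ) (β : ℝ) (k : ℕ) : ℝ :=
  Real.exp (-((β + 2) * (d : ℝ) ^ k) + k + β)

theorem levelProfile_succ_le_half {d : ℕ} (hd : 2 ≤ d) {β : ℝ} (hβ : 0 ≤ β) (k : ℕ) :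
    levelProfile d β (k + 1) ≤ levelProfile d β k / 2 := by
  have h2 : levelProfile d β k / 2 = Real.exp (-((β + 2) * (d : ℝ) ^ k) + k + β - Real.log 2) := by
    rw [Real.exp_sub, Real.exp_log two_pos, levelProfile]
  rw [h2, levelProfile, Real.exp_le_exp]
  have hd' : (2 : ℝ) ≤ d := by exact_mod_cast hd
  have h3 : 1 ≤ (d : ℝ) ^ k := one_le_pow₀ (by linarith)
  have h4 : 2 * (d : ℝ) ^ k ≤ (d : ℝ) ^ (k + 1) := by
    rw [pow_succ, mul_comm]; gcongr
  have h5 := Real.log_two_lt_d9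
  push_cast
  nlinarith

theorem levelProfile_zero_le {d : ℕ} (β : ℝ) : levelProfile d β 0 ≤ 1 := by
  unfold levelProfile
  rw [Real.exp_le_one_iff]
  simp

/-- With `x k = n * levelProfile d β k`, a slot of order `μ * 2 ^ (-k)` arrivals suffices to pass
from level `k` to level `k + 1`. -/
theorem levelProfile_succ_le {d : ℕ} (hd : 2 ≤ d) {γ β : ℝ} (hγ : 0 < γ) (hβ : 0 ≤ β)
    (hβγ : 1 - Real.log γ ≤ β) (k : ℕ) :
    levelProfile d β (k + 1) ≤ γ / 2 ^ k * levelProfile d β k ^ d := by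
  have h2 : ((2 : ℝ) ^ k) = Real.exp (k * Real.log 2) := by
    rw [Real.exp_nat_mul, Real.exp_log two_pos]
  unfold levelProfile
  rw [h2, ← Real.exp_nat_mul]
  nth_rewrite 1 [← Real.exp_log hγ]
  rw [← Real.exp_sub, ← Real.exp_add, Real.exp_le_exp]
  have hd' : (2 : ℝ) ≤ d := by exact_mod_cast hd
  have h5 := Real.log_two_lt_d9
  have hk : (0 : ℝ) ≤ k := Nat.cast_nonneg k
  push_cast
  have h6 : (d : ℝ) * (-((β + 2) * (d : ℝ) ^ k) + k + β) =
      -((β + 2) * (d : ℝ) ^ (k + 1)) + d * k + d * β := by ring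
  rw [h6]
  nlinarith [mul_nonneg (sub_nonneg.2 hd') hk, mul_nonneg (sub_nonneg.2 hd') hβ]

/-- The bound on `D` in exponential form: a doubly logarithmic `D` leaves `d ^ D` below a small
multiple of `x = log n`. -/
theorem pow_le_of_le_log_log {d : ℕ} (hd : 2 ≤ d) {a x : ℝ} (ha : 0 < a) (hx : 0 < x) {D : ℕ}
    (hD : (D : ℝ) ≤ Real.log x / Real.log d - Real.log a / Real.log d) :
    a * (d : ℝ) ^ D ≤ x := by
  have hd1 : (1 : ℝ) < d := by exact_mod_cast (by omega : 1 < d)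
  have hld : 0 < Real.log d := Real.log_pos hd1
  rw [← sub_div, le_div_iff₀ hld] at hD
  rw [← Real.log_le_log_iff (by positivity) hx, Real.log_mul ha.ne' (by positivity), Real.log_pow]
  linarith

theorem sum_floor_div_two_pow_le {μ : ℝ} (hμ : 0 ≤ μ) (m : ℕ) :
    ((∑ k ∈ Finset.range m, ⌊μ / 2 ^ (k + 1)⌋₊ : ℕ) : ℝ) ≤ μ := by
  have h : ((∑ k ∈ Finset.range m, ⌊μ / 2 ^ (k + 1)⌋₊ : ℕ) : ℝ) ≤ μ - μ / 2 ^ m := by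
    induction m with
    | zero => simp
    | succ m ih =>
      rw [Finset.sum_range_succ, Nat.cast_add]
      have h1 : (⌊μ / 2 ^ (m + 1)⌋₊ : ℝ) ≤ μ / 2 ^ (m + 1) := Nat.floor_le (by positivity)
      have h2 : μ / 2 ^ m = 2 * (μ / 2 ^ (m + 1)) := by rw [pow_succ]; field_simp
      linarith
  have : 0 ≤ μ / 2 ^ m := by positivity
  linarith

theorem sqrt_le_self_of_one_le {z : ℝ} (hz : 1 ≤ z) : √z ≤ z :=
  Real.sqrt_le_iff.2 ⟨by linarith, by nlinarith⟩

theorem half_le_floor {z : ℝ} (hz : 1 ≤ z) : z / 2 ≤ ⌊z⌋₊ := by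
  have h1 := Nat.lt_floor_add_one z
  have h2 : (1 : ℝ) ≤ ⌊z⌋₊ := by exact_mod_cast Nat.one_le_floor_iff z |>.2 hz
  linarith

namespace Evolution

theorem lost_mono {n d : ℕ} {Ω : Type u} (S : Evolution n d Ω) (a : ℝ) {b c : ℝ} (h : b ≤ c)
    (ω : Ω) : S.lost a b ω ≤ S.lost a c ω := by
  unfold lost
  exact ENat.toENNReal_mono (Set.encard_le_encard fun j hj =>
    ⟨⟨hj.1.1, hj.1.2.trans h⟩, hj.2⟩)

set_option maxHeartbeats 1000000 in
/-- With capacities `log log n / log d - O(1)`, every algorithm loses at least `n ^ K` calls in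
time `n ^ K`, except with probability `1 / n`. -/
theorem IsModel.exists_prob_lost_lt_le {lam : ℝ} (hlam : 0 < lam) {d : ℕ} (hd : 2 ≤ d) :
    ∃ c : ℝ, 0 < c ∧ ∀ K : ℝ, 0 < K → ∀ᶠ n : ℕ in atTop, ∀ (Ω : Type u) [MeasurableSpace Ω]
      (P : Measure Ω) [IsProbabilityMeasure P] (S : Evolution n d Ω) (D : ℕ) (t : ℝ),
      S.IsModel lam P → 0 ≤ t → (D : ℝ) ≤ Real.log (Real.log n) / Real.log d - c → S.IsGDAR D P →
      P {ω | S.lost t (t + (n : ℝ) ^ K) ω < ENNReal.ofReal ((n : ℝ) ^ K)} ≤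
        ENNReal.ofReal (n : ℝ)⁻¹ := by
  have hd' : (2 : ℝ) ≤ d := by exact_mod_cast hd
  have hld : 0 < Real.log d := Real.log_pos (by linarith)
  -- `γ` collects the constants in the expected number of rises during a slot, and `a` makes the
  -- proportion of nodes on level `D + 1` at least `n ^ (-1 / 2)`
  obtain ⟨γ, hγ⟩ : ∃ γ, γ = lam * Real.exp (-3) / (96 * 4 ^ d) := ⟨_, rfl⟩
  have hγ0 : 0 < γ := by rw [hγ]; positivity
  obtain ⟨β, hβ⟩ : ∃ β, β = max 0 (1 - Real.log γ) := ⟨_, rfl⟩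
  have hβ0 : 0 ≤ β := hβ ▸ le_max_left _ _
  have hβγ : 1 - Real.log γ ≤ β := hβ ▸ le_max_right _ _
  obtain ⟨a, ha⟩ : ∃ a, a = 2 * (β + 2) * d := ⟨_, rfl⟩
  have ha2 : 2 ≤ a := by rw [ha]; nlinarith
  refine ⟨Real.log a / Real.log d, div_pos (Real.log_pos (by linarith)) hld, fun K hK => ?_⟩
  have hlarge : ∀ᶠ n : ℕ in atTop, 12 / lam + 64 ≤ (n : ℝ) :=
    tendsto_natCast_atTop_atTop.eventually_ge_atTop _
  have hlog : ∀ᶠ n : ℕ in atTop, 1 ≤ Real.log n :=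
    (Real.tendsto_log_atTop.comp tendsto_natCast_atTop_atTop).eventually_ge_atTop _
  have hpowK : ∀ᶠ n : ℕ in atTop, 8 ≤ (n : ℝ) ^ K :=
    ((tendsto_rpow_atTop hK).comp tendsto_natCast_atTop_atTop).eventually_ge_atTop _
  filter_upwards [hlarge, hlog, hpowK, eventually_pow_mul_exp_le (⌈K⌉₊ + 3) one_pos] with
    n hbig hx1 hNK8 hexp Ω _ P _ S D t hS ht hD hroute
  have hdl : 0 < 12 / lam := by positivity
  have hN64 : (64 : ℝ) ≤ n := by linarith
  have hn : 64 ≤ n := by exact_mod_cast hN64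
  obtain ⟨N, hN⟩ : ∃ N : ℝ, N = n := ⟨_, rfl⟩
  obtain ⟨x, hx⟩ : ∃ x, x = Real.log N := ⟨_, rfl⟩
  obtain ⟨μ, hμ⟩ : ∃ μ, μ = rate lam n := ⟨_, rfl⟩
  rw [← hN] at hbig hx1 hNK8 hexp hD hN64 ⊢
  rw [← hx] at hx1 hD
  have hN0 : 0 < N := by linarith
  have hN1 : 1 ≤ N := by linarith
  have hNx : Real.exp x = N := by rw [hx, Real.exp_log hN0]
  have hxN : x ≤ N := by
    rw [hx]; exact (Real.log_le_sub_one_of_pos hN0).trans (by linarith)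
  have hμle : lam * N ^ 2 / 6 ≤ μ := by rw [hμ, hN]; exact le_rate hlam (by omega)
  have hμN : 2 * N ≤ μ := by
    have h1 : 12 / lam ≤ N := by linarith
    rw [div_le_iff₀ hlam] at h1
    have h2 : 12 * N ≤ N * lam * N := by gcongr
    have h3 : N * lam * N = lam * N ^ 2 := by ring
    linarith
  have hμ0 : 0 < μ := by linarith
  -- the levels
  have hDa := pow_le_of_le_log_log hd (by linarith) (by linarith) hD
  have hdD : (β + 2) * (d : ℝ) ^ (D + 1) ≤ x / 2 := by
    have : a * (d : ℝ) ^ D = 2 * ((β + 2) * (d : ℝ) ^ (D + 1)) := by rw [ha]; ring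
    linarith
  have h2D : (2 : ℝ) ^ D ≤ x := by
    have h1 : (2 : ℝ) ^ D ≤ (d : ℝ) ^ D := by gcongr
    have h2 : 0 ≤ (d : ℝ) ^ D := by positivity
    nlinarith
  have hDN : ((D + 1 : ℕ) : ℝ) ≤ N := by
    have h1 : ((D + 1 : ℕ) : ℝ) ≤ ((2 ^ D : ℕ) : ℝ) := Nat.cast_le.2 Nat.lt_two_pow_self
    push_cast at h1 ⊢
    linarith
  obtain ⟨q, hq⟩ : ∃ q : ℕ → ℝ, q = fun k => N * levelProfile d β k := ⟨_, rfl⟩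
  have hqpos : ∀ k, 0 < q k := fun k => by
    rw [hq]; exact mul_pos hN0 (Real.exp_pos _)
  have hqs : ∀ k, q (k + 1) ≤ q k / 2 := fun k => by
    rw [hq]
    simp only
    rw [mul_div_assoc]
    exact mul_le_mul_of_nonneg_left (levelProfile_succ_le_half hd hβ0 k) hN0.le
  have hq0 : q 0 ≤ n := by
    rw [hq, ← hN]
    exact mul_le_of_le_one_right hN0.le (levelProfile_zero_le β)
  have hanti : Antitone q := antitone_nat_of_succ_le fun k => by
    have := hqs k
    have := hqpos k
    linarith
  have hsq : √N * √N = N := Real.mul_self_sqrt hN0.le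
  have hsq8 : 8 ≤ √N := Real.le_sqrt_of_sq_le (by linarith)
  have hqD : √N ≤ q (D + 1) := by
    have h1 : √N = Real.exp (x / 2) := by
      have h2 : √N ^ 2 = Real.exp (x / 2) ^ 2 := by
        rw [sq, hsq, ← Real.exp_nat_mul, ← hNx]; congr 1; push_cast; ring
      exact (pow_left_inj₀ (Real.sqrt_nonneg _) (Real.exp_pos _).le two_ne_zero).1 h2
    rw [hq, h1]
    simp only
    rw [← hNx, levelProfile, ← Real.exp_add, Real.exp_le_exp]
    have : (0 : ℝ) ≤ (D + 1 : ℕ) := Nat.cast_nonneg _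
    linarith
  have hq8 : ∀ k ≤ D + 1, 8 ≤ q k := fun k hk => hsq8.trans (hqD.trans (hanti hk))
  -- the slot for level `k` has `⌊μ / 2 ^ (k + 1)⌋` arrivals, so all slots together at most `μ`
  obtain ⟨ml, hml⟩ : ∃ ml : ℕ → ℕ, ml = fun k => ⌊μ / 2 ^ (k + 1)⌋₊ := ⟨_, rfl⟩
  have hmlk : ∀ k ≤ D, lam * N ^ 2 / (24 * 2 ^ k) ≤ ml k := by
    intro k hk
    have h1 : (2 : ℝ) ^ k ≤ 2 ^ D := pow_le_pow_right₀ one_le_two hk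
    have h2 : 1 ≤ μ / 2 ^ (k + 1) := by
      rw [one_le_div (by positivity), pow_succ]
      linarith
    rw [hml]
    refine le_trans ?_ (half_le_floor h2)
    calc _ = lam * N ^ 2 / 6 / 2 ^ (k + 1) / 2 := by rw [pow_succ]; field_simp; ring
      _ ≤ _ := by gcongr
  have hslot : ∀ k ≤ D, 4 * (2 * q (k + 1)) ≤ ml k *
      (2 / n * (q k / (4 * n)) ^ d * Real.exp (-3)) := by
    intro k hk
    have h1 : q k / (4 * n) = levelProfile d β k / 4 := by
      rw [hq, ← hN]; field_simp
    have h0 : 0 ≤ levelProfile d β k := (Real.exp_pos _).le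
    rw [h1, ← hN]
    calc 4 * (2 * q (k + 1)) = 8 * N * levelProfile d β (k + 1) := by rw [hq]; ring
      _ ≤ 8 * N * (γ / 2 ^ k * levelProfile d β k ^ d) := by
          gcongr
          exact levelProfile_succ_le hd hγ0 hβ0 hβγ k
      _ = lam * N ^ 2 / (24 * 2 ^ k) * (2 / N * (levelProfile d β k / 4) ^ d * Real.exp (-3)) := by
          rw [hγ, div_pow]; field_simp; ring
      _ ≤ _ := by
          gcongr
          exact hmlk k hk
  -- each window takes at most time `3` and loses at least `√n ≥ 8` calls
  obtain ⟨W, hW⟩ : ∃ W : ℕ, W = ⌊N ^ K / 4⌋₊ := ⟨_, rfl⟩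
  have hW1 : (W : ℝ) ≤ N ^ K / 4 := hW ▸ Nat.floor_le (by positivity)
  have hW2 : N ^ K / 4 - 1 ≤ W := by
    rw [hW]; linarith [Nat.lt_floor_add_one (N ^ K / 4)]
  have hWq : N ^ K ≤ W * q (D + 1) := by
    have h1 : N ^ K / 8 ≤ W := by linarith
    calc N ^ K = N ^ K / 8 * 8 := by ring
      _ ≤ W * q (D + 1) := by gcongr; exact hq8 _ le_rfl
  have hmain := hS.prob_lost_lt_le (by omega) (hμ ▸ hμ0) hroute hq0 hq8 hqpos hqs hslot ht W
  have hsub : {ω | S.lost t (t + N ^ K) ω < ENNReal.ofReal (N ^ K)} ⊆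
      {ω | S.lost t (t + (1 + 3 * W)) ω < ENNReal.ofReal (W * q (D + 1))} := by
    intro ω hω
    have h1 : S.lost t (t + N ^ K) ω < ENNReal.ofReal (N ^ K) := hω
    exact (S.lost_mono t (by linarith) ω).trans_lt
      (h1.trans_le (ENNReal.ofReal_le_ofReal hWq))
  refine (measure_mono hsub).trans (hmain.trans (ENNReal.ofReal_le_ofReal ?_))
  rw [← hμ]
  obtain ⟨y, hy⟩ : ∃ y, y = √√N := ⟨_, rfl⟩
  rw [← hy, one_mul] at hexp
  have hyN : y ≤ √N := by
    rw [hy]; exact sqrt_le_self_of_one_le (by linarith)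
  have hsN : √N ≤ N := sqrt_le_self_of_one_le hN1
  have he1 : Real.exp (-μ) ≤ Real.exp (-y) := Real.exp_le_exp.2 (by linarith)
  have he2 : 2 ^ (∑ k ∈ Finset.range (D + 1), ml k) * Real.exp (-(3 / 2 * μ)) ≤
      Real.exp (-y) := by
    have h1 : ((∑ k ∈ Finset.range (D + 1), ml k : ℕ) : ℝ) ≤ μ := by
      rw [hml]; exact sum_floor_div_two_pow_le hμ0.le (D + 1)
    have h2 : (2 : ℝ) ^ (∑ k ∈ Finset.range (D + 1), ml k) =
        Real.exp ((∑ k ∈ Finset.range (D + 1), ml k : ℕ) * Real.log 2) := by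
      rw [Real.exp_nat_mul, Real.exp_log two_pos]
    rw [h2, ← Real.exp_add, Real.exp_le_exp]
    have h3 := Real.log_two_lt_d9
    have h4 := Real.log_two_gt_d9
    have h5 : ((∑ k ∈ Finset.range (D + 1), ml k : ℕ) : ℝ) * Real.log 2 ≤ μ * 1 := by
      gcongr; linarith
    linarith
  have he3 : (D + 1 : ℕ) * Real.exp (-(2 * q (D + 1))) ≤ N * Real.exp (-y) := by
    gcongr
    linarith
  have hNKa : N ^ K ≤ N ^ ⌈K⌉₊ := by
    rw [← Real.rpow_natCast]
    exact Real.rpow_le_rpow_of_exponent_le hN1 (Nat.le_ceil K)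
  have hWa : (W : ℝ) ≤ N ^ ⌈K⌉₊ := by linarith
  have hey := Real.exp_pos (-y)
  have hNa : 1 ≤ N ^ ⌈K⌉₊ := one_le_pow₀ hN1
  calc _ ≤ Real.exp (-y) + N ^ ⌈K⌉₊ * (Real.exp (-y) + N * Real.exp (-y)) := by gcongr
    _ = (1 + N ^ ⌈K⌉₊ * (1 + N)) * Real.exp (-y) := by ring
    _ ≤ (N ^ ⌈K⌉₊ * N ^ 2) * Real.exp (-y) := by
        gcongr
        have h1 : 2 + N ≤ N ^ 2 := by nlinarith only [hN64]
        calc 1 + N ^ ⌈K⌉₊ * (1 + N) ≤ N ^ ⌈K⌉₊ + N ^ ⌈K⌉₊ * (1 + N) := by gcongr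
          _ = N ^ ⌈K⌉₊ * (2 + N) := by ring
          _ ≤ _ := by gcongr
    _ = N ^ (⌈K⌉₊ + 3) * Real.exp (-y) * N⁻¹ := by
        rw [pow_add]; field_simp
    _ ≤ 1 * N⁻¹ := by gcongr
    _ = _ := one_mul _

end Evolution

/-! ### Bounds that hold for all `n` -/

open Classical in
/-- The bound `a / n`, replaced by the trivial bound `⊤` for the finitely many `n < n₀`. -/
noncomputable def eventualBound (a : ℝ) (n₀ n : ℕ) : ℝ≥0∞ :=
  if n₀ ≤ n then ENNReal.ofReal (a * (n : ℝ)⁻¹) else ⊤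

theorem tendsto_eventualBound (a : ℝ) (n₀ : ℕ) : Tendsto (eventualBound a n₀) atTop (𝓝 0) := by
  have h1 : Tendsto (fun n : ℕ => ENNReal.ofReal (a * (n : ℝ)⁻¹)) atTop (𝓝 0) := by
    rw [← ENNReal.ofReal_zero, ← mul_zero a]
    exact ENNReal.tendsto_ofReal (tendsto_inv_atTop_nhds_zero_nat.const_mul a)
  refine h1.congr' ?_
  filter_upwards [eventually_ge_atTop n₀] with n hn
  rw [eventualBound, if_pos hn]

theorem le_eventualBound {a : ℝ} {n₀ n : ℕ} {r : ℝ≥0∞}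
    (h : n₀ ≤ n → r ≤ ENNReal.ofReal (a * (n : ℝ)⁻¹)) : r ≤ eventualBound a n₀ n := by
  unfold eventualBound
  split_ifs with hn
  · exact h hn
  · exact le_top

theorem Evolution.lost_le_add {n d : ℕ} {Ω : Type u} (S : Evolution n d Ω) (a b c : ℝ) (ω : Ω) :
    S.lost a c ω ≤ S.lost a b ω + S.lost b c ω := by
  unfold Evolution.lost
  rw [← ENat.toENNReal_add]
  refine ENat.toENNReal_mono (le_trans (Set.encard_le_encard ?_) (Set.encard_union_le _ _))
  rintro j ⟨⟨h1, h2⟩, h3⟩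
  rcases le_total (S.arrival j ω) b with h | h
  · exact Or.inl ⟨⟨h1, h⟩, h3⟩
  · exact Or.inr ⟨⟨h, h2⟩, h3⟩

theorem eventually_mul_log_le (b : ℝ) (hb : 0 ≤ b) : ∀ᶠ n : ℕ in atTop, b * Real.log n ≤ n := by
  have h1 := (Real.isLittleO_log_id_atTop.comp_tendsto tendsto_natCast_atTop_atTop).def
    (c := 1 / (b + 1)) (by positivity)
  filter_upwards [h1, eventually_ge_atTop 1] with n hn hn1
  have h2 : (1 : ℝ) ≤ n := by exact_mod_cast hn1
  have h3 := Real.log_nonneg h2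
  simp only [Function.comp_apply, id_eq, Real.norm_eq_abs, Nat.abs_cast] at hn
  rw [abs_of_nonneg h3, one_div, inv_mul_eq_div, le_div_iff₀ (by positivity)] at hn
  linarith

/-- The balanced algorithm loses `o(1)` calls in expectation. The bound for an interval of length
`n ^ M` needs a starting time that depends on `M`; it applies only from time `t + n` on, and the
time before that is covered by the bound for `M = 1`. -/
theorem Evolution.IsModel.exists_balanced_bound {lam : ℝ} (hlam : 0 < lam) {d : ℕ} (hd : 2 ≤ d) :
    ∃ κ : ℝ, 0 ≤ κ ∧ ∀ K : ℝ, 0 < K → ∃ c : ℝ, 0 ≤ c ∧ ∃ ρ : ℕ → ℝ≥0∞, Tendsto ρ atTop (𝓝 0) ∧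
      ∀ (n : ℕ) (Ω : Type u) [MeasurableSpace Ω] (P : Measure Ω) [IsProbabilityMeasure P]
        (S : Evolution n d Ω) (D : ℕ) (t : ℝ), S.IsModel lam P → Integrable S.initTotal P →
        Real.log ((∫ ω, S.initTotal ω ∂P) + 1) + κ * Real.log n ≤ t →
        Real.log (Real.log n) / Real.log d + c ≤ D → S.IsBDAR D P →
        ∫⁻ ω, S.lost t (t + (n : ℝ) ^ K) ω ∂P ≤ ρ n := by
  obtain ⟨b₁, c₁, h₁⟩ := Evolution.IsModel.exists_lintegral_lost_le_of_isBDAR.{u} hlam hd 1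
  refine ⟨b₁, Nat.cast_nonneg _, fun K hK => ?_⟩
  obtain ⟨b₂, c₂, h₂⟩ := Evolution.IsModel.exists_lintegral_lost_le_of_isBDAR.{u} hlam hd ⌈K⌉₊
  refine ⟨c₁ + c₂, by positivity, ?_⟩
  obtain ⟨n₀, hn₀⟩ := eventually_atTop.1 (h₁.and (h₂.and
    ((eventually_mul_log_le b₂ (Nat.cast_nonneg _)).and (eventually_ge_atTop 1))))
  refine ⟨eventualBound 12 n₀, tendsto_eventualBound 12 n₀,
    fun n Ω _ P _ S D t hS hint ht hD hbal => le_eventualBound fun hn => ?_⟩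
  obtain ⟨hn₁, hn₂, hlog, hn1⟩ := hn₀ n hn
  have hN1 : (1 : ℝ) ≤ n := by exact_mod_cast hn1
  have hN0 : (0 : ℝ) < n := by linarith
  have hκ : 0 ≤ (b₁ : ℝ) * Real.log n := mul_nonneg (Nat.cast_nonneg _) (Real.log_nonneg hN1)
  have hK1 : (n : ℝ) ^ K ≤ (n : ℝ) ^ ⌈K⌉₊ := by
    rw [← Real.rpow_natCast]
    exact Real.rpow_le_rpow_of_exponent_le hN1 (Nat.le_ceil K)
  have hc₁ : (0 : ℝ) ≤ c₁ := Nat.cast_nonneg _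
  have hc₂ : (0 : ℝ) ≤ c₂ := Nat.cast_nonneg _
  have h3 := hn₁ Ω P S D t n hS hint ht hN0 (by rw [pow_one]) (by linarith) hbal
  have h4 := hn₂ Ω P S D (t + n) ((n : ℝ) ^ K) hS hint (by linarith) (by positivity) hK1
    (by linarith) hbal
  have hm : Measurable fun ω => S.lost t (t + n) ω := by
    simp_rw [Evolution.lost_eq_tsum]
    exact Measurable.tsum fun j => measurable_one.indicator
      ((hS.measurableSet_arrival_mem j _ _).inter
        (hS.past_le _ _ (hS.measurableSet_via (Nat.lt_succ_self j) none)))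
  calc ∫⁻ ω, S.lost t (t + (n : ℝ) ^ K) ω ∂P
      ≤ ∫⁻ ω, (S.lost t (t + n) ω + S.lost (t + n) (t + n + (n : ℝ) ^ K) ω) ∂P :=
        lintegral_mono fun ω => (S.lost_mono t (by linarith) ω).trans
          (S.lost_le_add t (t + n) (t + n + (n : ℝ) ^ K) ω)
    _ ≤ ENNReal.ofReal (6 * (n : ℝ)⁻¹) + ENNReal.ofReal (6 * (n : ℝ)⁻¹) := by
        rw [lintegral_add_left hm]
        exact add_le_add h3 h4
    _ = _ := by
        rw [← ENNReal.ofReal_add (by positivity) (by positivity)]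
        congr 1
        ring

end AltRouting

theorem theorem2 (lam : ℝ) (hlam : 0 < lam) (d : ℕ) (hd : 2 ≤ d) :
    ∃ κ : ℝ, ∀ K : ℝ, 0 < K → ∃ c : ℝ, 0 < c ∧
      -- (a): with the balanced algorithm the expected number of lost calls is `o(1)`
      (∃ ρ : ℕ → ℝ≥0∞, Tendsto ρ atTop (𝓝 0) ∧
        ∀ (n : ℕ), 3 ≤ n →
        ∀ (Ω : Type*) [MeasurableSpace Ω] (P : Measure Ω) [IsProbabilityMeasure P]
          (S : AltRouting.Evolution n d Ω) (D : ℕ) (t₁ : ℝ),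
          S.IsModel lam P →
          Integrable S.initTotal P →
          Real.log ((∫ ω, S.initTotal ω ∂P) + 1) + κ * Real.log n ≤ t₁ →
          Real.log (Real.log n) / Real.log d + c ≤ (D : ℝ) →
          S.IsBDAR D P →
          ∫⁻ ω, S.lost t₁ (t₁ + (n : ℝ) ^ K) ω ∂P ≤ ρ n) ∧
      -- (b): with any algorithm, asymptotically almost surely at least `n ^ (K + 2 - d - o(1))` calls are lost
      (∃ (η : ℕ → ℝ) (ρ : ℕ → ℝ≥0∞), Tendsto η atTop (𝓝 0) ∧ Tendsto ρ atTop (𝓝 0) ∧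
        ∀ (n : ℕ), 3 ≤ n →
        ∀ (Ω : Type*) [MeasurableSpace Ω] (P : Measure Ω) [IsProbabilityMeasure P]
          (S : AltRouting.Evolution n d Ω) (D : ℕ) (t₁ : ℝ),
          S.IsModel lam P →
          Integrable S.initTotal P →
          Real.log ((∫ ω, S.initTotal ω ∂P) + 1) + κ * Real.log n ≤ t₁ →
          (D : ℝ) ≤ Real.log (Real.log n) / Real.log d - c →
          S.IsGDAR D P →
          P {ω | S.lost t₁ (t₁ + (n : ℝ) ^ K) ω <
            ENNReal.ofReal ((n : ℝ) ^ (K + 2 - d - η n))} ≤ ρ n) := by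
  obtain ⟨κ, hκ, ha⟩ := AltRouting.Evolution.IsModel.exists_balanced_bound hlam hd
  obtain ⟨c₂, hc₂, hb⟩ := AltRouting.Evolution.IsModel.exists_prob_lost_lt_le hlam hd
  refine ⟨κ, fun K hK => ?_⟩
  obtain ⟨c₁, hc₁, ρ₁, hρ₁, ha⟩ := ha K hK
  refine ⟨c₁ + c₂, by linarith, ⟨ρ₁, hρ₁, ?_⟩, fun _ => 0, ?_⟩
  · intro n _ Ω _ P _ S D t hS hint ht hD hbal
    exact ha n Ω P S D t hS hint ht (by linarith) hbal
  · obtain ⟨n₀, hn₀⟩ := eventually_atTop.1 (hb K hK)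
    refine ⟨AltRouting.eventualBound 1 n₀, tendsto_const_nhds,
      AltRouting.tendsto_eventualBound 1 n₀, fun n hn3 Ω _ P _ S D t hS hint ht hD hroute =>
        AltRouting.le_eventualBound fun hn => ?_⟩
    have hN1 : (1 : ℝ) ≤ n := by exact_mod_cast (by omega : 1 ≤ n)
    have hE : 0 ≤ ∫ ω, S.initTotal ω ∂P := integral_nonneg fun ω =>
      Finset.sum_nonneg fun p _ => Nat.cast_nonneg _
    have ht0 : 0 ≤ t := by
      have h1 := Real.log_nonneg (by linarith : (1 : ℝ) ≤ (∫ ω, S.initTotal ω ∂P) + 1)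
      have h2 := mul_nonneg hκ (Real.log_nonneg hN1)
      linarith
    have hd' : (2 : ℝ) ≤ d := by exact_mod_cast hd
    -- `n ^ (K + 2 - d) ≤ n ^ K`, as `d ≥ 2`
    have hpow : (n : ℝ) ^ (K + 2 - d - 0) ≤ (n : ℝ) ^ K :=
      Real.rpow_le_rpow_of_exponent_le hN1 (by linarith)
    rw [one_mul]
    refine (measure_mono fun ω hω => ?_).trans (hn₀ n hn Ω P S D t hS ht0 (by linarith) hroute)
    exact lt_of_lt_of_le hω (ENNReal.ofReal_le_ofReal hpow)
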